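/- Let $Q\subset\mathbb P^M$ be a non-degenerate quadric over $\mathbb C$, let $H_Q\in\operatorname{Pic}Q$ be the class of a hyperplane section, and let $B\subset Q$ be an irreducible subvariety with $\dim B\ge 3$. Let $D\sim lH_Q$ be an effective divisor on $Q$, that is, $D$ is cut out on $Q$ by a hypersurface of degree $l$ in $\mathbb P^M$ not containing $Q$ ($D$ need not be irreducible). For a point $p\in Q$ let $\varphi_p\colon Q_p\to Q$ be the blow up of $p$, let $E_p=\varphi_p^{-1}(p)\cong\mathbb P(T_pQ)$ be its exceptional divisor, and denote strict transforms on $Q_p$ by a tilde. Let $n\ge 1$ be an integer, and assume that $D$ satisfies the condition $H(n)$ with respect to $B$: for a point $p\in B$ of general position there is a hyperplane $F(p)\subset E_p$, depending algebraically on $p$, such that $$\operatorname{mult}_pD+\operatorname{mult}_{F(p)}\widetilde D>2n .$$ Then at least one of the following holds: 1) $l>2n$; 2) there is a hyperplane section $Z\subset Q$ containing $B$ such that $F(p)=\widetilde Z\cap E_p$ for a point $p\in B$ of general position, and $Z$ occurs in $D$ with multiplicity $a>2n-l$, that is, $D=aZ+D^*$, where $a\ge 0$ is an integer and $D^*$ is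 an effective divisor which does not contain $Z$ as a component. -/

import Mathlib

open MvPolynomial

noncomputable section

namespace QuadricDivisor

/-! ### Blow-ups and multiplicities, in affine charts -/

section Blowup

variable {A : Type*} [CommRing A]

/-- The multiplicity along the subvariety with prime ideal `P` of the divisor with ideal `J`:
the largest `k` such that `J` is contained in the `k`-th power of the maximal ideal of the
local ring at `P` (the denominators `s` range over the elements outside `P`).
It is `0` if `P` is the unit ideal, i.e. if the subvariety does not meet the chart. -/
def multAlong (P J : Ideal A) : ℕ∞ :=
  ⨆ k ∈ {k : ℕ | ∀ b ∈ J, ∃ s, s ∉ P ∧ s * b ∈ P ^ k}, (k : ℕ∞)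

/-- The affine chart `A[m/u]` of the blow-up of `Spec A` at the ideal `m`, where `u ∈ m`:
the `A`-subalgebra of `A[1/u]` generated by all fractions `y/u` with `y ∈ m`. -/
def blowupChart (m : Ideal A) (u : A) : Subalgebra A (Localization.Away u) :=
  Algebra.adjoin A
    {z | ∃ y ∈ m, z * algebraMap A (Localization.Away u) u = algebraMap A (Localization.Away u) y}

/-- The ideal `m · A[m/u]` of the exceptional divisor in the chart `A[m/u]`. -/
def exceptionalIdeal (m : Ideal A) (u : A) : Ideal (blowupChart m u) :=
  m.map (algebraMap A (blowupChart m u))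

/-- The ideal, in the chart `A[m/u]`, of the strict transform of the divisor `g = 0`, that is,
of the closure of the part of the divisor lying outside the exceptional divisor: the
contraction to `A[m/u]` of the ideal generated by `g` in `A[1/u] = A[m/u][1/u]`. -/
def strictTransformIdeal (m : Ideal A) (u g : A) : Ideal (blowupChart m u) :=
  (Ideal.span {algebraMap A (Localization.Away u) g}).comap (blowupChart m u).val.toRingHom

/-- The ideal, in the chart `A[m/u]`, of the hyperplane of the exceptional divisor given by
the cotangent vector `t mod m ^ 2`, where `t ∈ m`: it is generated by the ideal of the
exceptional divisor and the element `t/u`. -/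
def exceptionalHyperplaneIdeal (m : Ideal A) (u t : A) : Ideal (blowupChart m u) :=
  exceptionalIdeal m u ⊔
    Ideal.span {z | (z : Localization.Away u) * algebraMap A (Localization.Away u) u =
      algebraMap A (Localization.Away u) t}

/-- The multiplicity of the strict transform of the divisor `g = 0` along the hyperplane of the
exceptional divisor given by `t`. It is computed in any chart meeting that hyperplane (the
other charts contribute `0`); the charts with `u ∈ m \ m ^ 2` cover the exceptional divisor. -/
def multStrictTransform (m : Ideal A) (g t : A) : ℕ∞ :=
  ⨆ u ∈ {u : A | u ∈ m ∧ u ∉ m ^ 2},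
    multAlong (exceptionalHyperplaneIdeal m u t) (strictTransformIdeal m u g)

end Blowup

/-! ### Quadrics, their points, divisors and subvarieties -/

variable {M : ℕ}

/-- The quadratic form `∑ G j k X_j X_k` with Gram matrix `G`; the quadric `Q ⊂ ℙ^M` is its zero
locus. It is non-degenerate if `G` (symmetric) is invertible. -/
def quadric (G : Matrix (Fin (M + 1)) (Fin (M + 1)) ℂ) : MvPolynomial (Fin (M + 1)) ℂ :=
  ∑ j, ∑ k, C (G j k) * X j * X k

/-- An effective divisor `D ∼ l H_Q` on the quadric `Q`: it is cut out on `Q` by a hypersurface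
of degree `l` in `ℙ^M` which does not contain `Q`. -/
structure EffectiveDivisor (G : Matrix (Fin (M + 1)) (Fin (M + 1)) ℂ) (l : ℕ) where
  /-- the equation of the hypersurface -/
  form : MvPolynomial (Fin (M + 1)) ℂ
  isHomogeneous : form.IsHomogeneous l
  not_dvd : ¬ quadric G ∣ form

/-- A hyperplane section of `Q`. -/
abbrev HyperplaneSection (G : Matrix (Fin (M + 1)) (Fin (M + 1)) ℂ) := EffectiveDivisor G 1

/-- The equality of divisors `D = a Z + D'` on `Q`: the product of the equation of `D'` and the
`a`-th power of the equation of `Z` cuts out on `Q` the same subscheme as the equation of `D`. -/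
def EffectiveDivisor.EqSMulAdd {G : Matrix (Fin (M + 1)) (Fin (M + 1)) ℂ} {l l' : ℕ}
    (D : EffectiveDivisor G l) (a : ℕ) (Z : HyperplaneSection G) (D' : EffectiveDivisor G l') :
    Prop :=
  Ideal.span {quadric G, D.form} = Ideal.span {quadric G, Z.form ^ a * D'.form}

/-- The support of `D` contains the hyperplane section `Z` (points are given by their homogeneous
coordinates). -/
def EffectiveDivisor.ContainsSection {G : Matrix (Fin (M + 1)) (Fin (M + 1)) ℂ} {l : ℕ}
    (D : EffectiveDivisor G l) (Z : HyperplaneSection G) : Prop :=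
  ∀ x : Fin (M + 1) → ℂ, eval x (quadric G) = 0 → eval x Z.form = 0 → eval x D.form = 0

/-- An irreducible subvariety `B ⊂ Q`, given by its homogeneous prime ideal. -/
structure IrreducibleSubvariety (G : Matrix (Fin (M + 1)) (Fin (M + 1)) ℂ) where
  /-- the homogeneous ideal of `B` -/
  ideal : Ideal (MvPolynomial (Fin (M + 1)) ℂ)
  isPrime : ideal.IsPrime
  isHomogeneous : ∀ f ∈ ideal, ∀ d : ℕ, homogeneousComponent d f ∈ ideal
  quadric_mem : quadric G ∈ ideal

/-- `dim B ≥ d`: the homogeneous coordinate ring of `B` has Krull dimension `dim B + 1`. -/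
def IrreducibleSubvariety.DimGE {G : Matrix (Fin (M + 1)) (Fin (M + 1)) ℂ}
    (B : IrreducibleSubvariety G) (d : ℕ) : Prop :=
  ((d + 1 : ℕ) : WithBot ℕ∞) ≤ ringKrullDim (MvPolynomial (Fin (M + 1)) ℂ ⧸ B.ideal)

/-- The property `P` holds for a point of general position of `B`, i.e. for all points
(with homogeneous coordinates `x`) of a non-empty Zariski open subset of `B`. -/
def IrreducibleSubvariety.ForGeneralPoint {G : Matrix (Fin (M + 1)) (Fin (M + 1)) ℂ}
    (B : IrreducibleSubvariety G) (P : (Fin (M + 1) → ℂ) → Prop) : Prop :=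
  ∃ (e : ℕ) (h : MvPolynomial (Fin (M + 1)) ℂ), h.IsHomogeneous e ∧ h ∉ B.ideal ∧
    ∀ x : Fin (M + 1) → ℂ, x ≠ 0 → (∀ f ∈ B.ideal, eval x f = 0) → eval x h ≠ 0 → P x

/-! ### The quadric near a point -/

/-- The coordinate ring of the standard affine chart `X_i ≠ 0` (i.e. `X_i = 1`) of `Q`. -/
abbrev ChartRing (G : Matrix (Fin (M + 1)) (Fin (M + 1)) ℂ) (i : Fin (M + 1)) :=
  MvPolynomial (Fin (M + 1)) ℂ ⧸ Ideal.span {quadric G, X i - 1}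

/-- The equation of the hypersurface `f = 0` in the chart `X_i = 1` of `Q`. -/
def chartEquation (G : Matrix (Fin (M + 1)) (Fin (M + 1)) ℂ) (i : Fin (M + 1))
    (f : MvPolynomial (Fin (M + 1)) ℂ) : ChartRing G i :=
  Ideal.Quotient.mk _ f

/-- The maximal ideal, in the chart `X_i = 1` of `Q`, of the point with homogeneous coordinates
`x`, where `x i ≠ 0`. -/
def pointIdeal (G : Matrix (Fin (M + 1)) (Fin (M + 1)) ℂ) (i : Fin (M + 1))
    (x : Fin (M + 1) → ℂ) : Ideal (ChartRing G i) :=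
  Ideal.span (Set.range fun j => chartEquation G i (X j - C (x j / x i)))

/-- The linear form `∑ c_j X_j`. -/
def linearForm (c : Fin (M + 1) → ℂ) : MvPolynomial (Fin (M + 1)) ℂ := ∑ j, C (c j) * X j

/-- An algebraic family of hyperplanes `F(p) ⊂ E_p`, defined for `p ∈ B` of general position,
in the exceptional divisors `E_p = ℙ(T_p Q)` of the blow-ups of the points `p`.

For `p` with coordinates `x` one has `T_p Q = {v | (G x) ⬝ v = 0} / ℂ x`, so that a hyperplane
in `ℙ(T_p Q)` is given by a linear form `c` with `c ⬝ x = 0` which is not a multiple of `G x`;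
the hyperplane is `c ⬝ v = 0`. It depends algebraically on `p`: the coefficients of `c` can be
taken to be homogeneous polynomials of the same degree in the coordinates of `p`, for `p` in
some non-empty open subset of `B`. -/
structure HyperplaneFamily {G : Matrix (Fin (M + 1)) (Fin (M + 1)) ℂ}
    (B : IrreducibleSubvariety G) where
  /-- the coefficients of the linear form -/
  coeff : Fin (M + 1) → MvPolynomial (Fin (M + 1)) ℂ
  /-- their common degree -/
  degree : ℕ
  isHomogeneous : ∀ j, (coeff j).IsHomogeneous degree
  isHyperplane : B.ForGeneralPoint fun x =>
    (∑ j, eval x (coeff j) * x j = 0) ∧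
      (fun j => eval x (coeff j)) ∉ Submodule.span ℂ {G.mulVec x}

/-- The local equation, in the chart `X_i = 1` of `Q`, of a hyperplane in `ℙ^M` which passes
through `p` and cuts out `F(p)` on `T_p Q`; here `x` are the coordinates of `p`. -/
def HyperplaneFamily.equationAt {G : Matrix (Fin (M + 1)) (Fin (M + 1)) ℂ}
    {B : IrreducibleSubvariety G} (F : HyperplaneFamily B) (i : Fin (M + 1))
    (x : Fin (M + 1) → ℂ) : ChartRing G i :=
  chartEquation G i (linearForm fun j => eval x (F.coeff j))

/-- `mult_p D` for the point `p` with coordinates `x`, computed in the chart `X_i = 1`. -/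
def EffectiveDivisor.multAt {G : Matrix (Fin (M + 1)) (Fin (M + 1)) ℂ} {l : ℕ}
    (D : EffectiveDivisor G l) (i : Fin (M + 1)) (x : Fin (M + 1) → ℂ) : ℕ∞ :=
  multAlong (pointIdeal G i x) (Ideal.span {chartEquation G i D.form})

/-- `mult_{F(p)} D̃`, where `D̃` is the strict transform of `D` on the blow-up of the point `p`
with coordinates `x`, computed over the chart `X_i = 1`. -/
def EffectiveDivisor.multStrictAlong {G : Matrix (Fin (M + 1)) (Fin (M + 1)) ℂ} {l : ℕ}
    (D : EffectiveDivisor G l) {B : IrreducibleSubvariety G} (F : HyperplaneFamily B)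
    (i : Fin (M + 1)) (x : Fin (M + 1) → ℂ) : ℕ∞ :=
  multStrictTransform (pointIdeal G i x) (chartEquation G i D.form) (F.equationAt i x)

/-- The divisor `D` satisfies the condition `H(n)` with respect to `B`, with the hyperplanes
`F(p)`: for a point `p ∈ B` of general position, `mult_p D + mult_{F(p)} D̃ > 2n`. The
multiplicities do not depend on the standard affine chart containing `p` that is used. -/
def EffectiveDivisor.ConditionH {G : Matrix (Fin (M + 1)) (Fin (M + 1)) ℂ} {l : ℕ}
    (D : EffectiveDivisor G l) (n : ℕ) {B : IrreducibleSubvariety G} (F : HyperplaneFamily B) :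
    Prop :=
  B.ForGeneralPoint fun x => ∃ i, x i ≠ 0 ∧
    ((2 * n : ℕ) : ℕ∞) < D.multAt i x + D.multStrictAlong F i x

/-- `Z̃ ∩ E_p = F(p)` as subschemes of the blow-up of the point `p` with coordinates `x`, where
`Z̃` is the strict transform of `Z`: the ideals agree in all charts `A[m/u]` of the blow-up
that meet `E_p`, over every standard affine chart of `Q` containing `p`. -/
def EffectiveDivisor.StrictInterExceptionalEq {G : Matrix (Fin (M + 1)) (Fin (M + 1)) ℂ} {l : ℕ}
    (Z : EffectiveDivisor G l) {B : IrreducibleSubvariety G} (F : HyperplaneFamily B)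
    (x : Fin (M + 1) → ℂ) : Prop :=
  ∀ i, x i ≠ 0 → ∀ u ∈ pointIdeal G i x, u ∉ pointIdeal G i x ^ 2 →
    strictTransformIdeal (pointIdeal G i x) u (chartEquation G i Z.form) ⊔
        exceptionalIdeal (pointIdeal G i x) u =
      exceptionalHyperplaneIdeal (pointIdeal G i x) u (F.equationAt i x)

end QuadricDivisor

end

/-! Assume l ≤ 2n. Write b for the bilinear form of Q, q(v) = b(v, v), f for the equation of D, x
for the generic point of the cone over B, with coordinates in an algebraically closed field Ω ⊃ ℂ,
and c for the vector such that F(x) is cut out on x^⊥/x by b(c, ·).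

Lines. For r orthogonal to x and c, `arc` is a branch of conic on Q which leaves x in the direction
r when q(r) ≠ 0. Lifted to the blow-up it meets E_p at a point of F(p), so condition H(n) makes f
vanish along it to order at least 2n + 1 (`X_pow_dvd_of_lt_mult` at closed points,
`X_pow_dvd_generic` at the generic one). This is a closed condition on r, so it persists for
isotropic r. Then the arc is t times another curve, which for suitable w starts at r; as f has
degree l < 2n + 1, it follows that f(r) = 0. Thus D contains the lines of Q through p tangent to
F(p): f vanishes on the cone Q ∩ x^⊥ ∩ c^⊥, off degenerate vectors (`aeval_eq_zero_of_arcOrder`).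

Motion. Derivations of Ω over ℂ play the role of tangent vectors to B. If the moving cone swept out
Q at first order, the gradient of f at its points would be normal to Q, all infinitesimal rotations
of f would vanish there too, and exponentiating unipotent rotations would give f = 0 on Q
(`eval_eq_zero_of_words`), which is excluded. So the minors of the first variation of (x, c) vanish
on the cone (`minor_eq_zero`) and are proportional to q on x^⊥ ∩ c^⊥. Since dim B ≥ 3 gives two
independent variations of x modulo x and c, the factor is zero, and the plane ⟨x, c⟩ contains a
constant vector z with nonzero c-component (`exists_constant_vector`). The hyperplane section Z = Q
∩ z^⊥ contains B, and it cuts out F(p) because z and c agree up to a multiple of x and a nonzero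
scalar (`strictTransformIdeal_sup_exceptionalIdeal`).

Multiplicity. Write D = aZ + D* with a maximal. The equation of Z has order two along the general
arcs, so that of D*, of degree l - a, has order at least 2n + 1 - 2a. If a ≤ 2n - l this exceeds the
degree, D* contains the same cones, and rotations fixing z spread the vanishing over Z
(`eval_eq_zero_of_arcOrder`), contrary to the choice of D*. -/

noncomputable section

namespace QuadricDivisor

/-! ### The bilinear form with Gram matrix `G` over extensions of the base field -/

section Bil

variable {k ι R S : Type*} [Field k] [Fintype ι] [CommRing R] [Algebra k R] [CommRing S]
  [Algebra k S]

/-- The bilinear form with Gram matrix `G`, on vectors with entries in a `k`-algebra. -/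
def bil (G : Matrix ι ι k) (x y : ι → R) : R :=
  ∑ j, ∑ l, algebraMap k R (G j l) * x j * y l

/-- A vector with entries in `k`, viewed over a `k`-algebra. -/
def ext (R : Type*) [CommRing R] [Algebra k R] (a : ι → k) : ι → R := fun j => algebraMap k R (a j)

variable (G : Matrix ι ι k)

lemma bil_add_left (x x' y : ι → R) : bil G (x + x') y = bil G x y + bil G x' y := by
  simp [bil, mul_add, add_mul, Finset.sum_add_distrib]

lemma bil_add_right (x y y' : ι → R) : bil G x (y + y') = bil G x y + bil G x y' := by
  simp [bil, mul_add, Finset.sum_add_distrib]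

lemma bil_smul_left (a : R) (x y : ι → R) : bil G (a • x) y = a * bil G x y := by
  simp only [bil, Pi.smul_apply, smul_eq_mul, Finset.mul_sum]
  exact Finset.sum_congr rfl fun _ _ => Finset.sum_congr rfl fun _ _ => by ring

lemma bil_smul_right (a : R) (x y : ι → R) : bil G x (a • y) = a * bil G x y := by
  simp only [bil, Pi.smul_apply, smul_eq_mul, Finset.mul_sum]
  exact Finset.sum_congr rfl fun _ _ => Finset.sum_congr rfl fun _ _ => by ring

lemma bil_zero_left (y : ι → R) : bil G 0 y = 0 := by simp [bil]

lemma bil_zero_right (y : ι → R) : bil G y 0 = 0 := by simp [bil]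

lemma bil_neg_left (x y : ι → R) : bil G (-x) y = -bil G x y := by simp [bil]

lemma bil_neg_right (x y : ι → R) : bil G x (-y) = -bil G x y := by simp [bil]

lemma bil_sub_left (x x' y : ι → R) : bil G (x - x') y = bil G x y - bil G x' y := by
  rw [sub_eq_add_neg, bil_add_left, bil_neg_left, sub_eq_add_neg]

lemma bil_sub_right (x y y' : ι → R) : bil G x (y - y') = bil G x y - bil G x y' := by
  rw [sub_eq_add_neg, bil_add_right, bil_neg_right, sub_eq_add_neg]

lemma bil_sum_left {κ : Type*} (s : Finset κ) (x : κ → ι → R) (y : ι → R) :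
    bil G (∑ m ∈ s, x m) y = ∑ m ∈ s, bil G (x m) y := by
  classical
  induction s using Finset.induction_on with
  | empty => simp [bil_zero_left]
  | insert a s ha ih => rw [Finset.sum_insert ha, Finset.sum_insert ha, bil_add_left, ih]

variable {G}

lemma bil_comm (hG : G.IsSymm) (x y : ι → R) : bil G x y = bil G y x := by
  unfold bil
  rw [Finset.sum_comm]
  refine Finset.sum_congr rfl fun j _ => Finset.sum_congr rfl fun l _ => ?_
  rw [hG.apply]
  ring

lemma map_bil (φ : R →ₐ[k] S) (x y : ι → R) :
    φ (bil G x y) = bil G (fun j => φ (x j)) (fun j => φ (y j)) := by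
  simp [bil]

lemma bil_ext (x y : ι → k) : bil G (ext R x) (ext R y) = algebraMap k R (bil G x y) := by
  simp [bil, ext]

lemma bil_eq_dotProduct (x y : ι → R) :
    bil G x y = ∑ l, (∑ j, algebraMap k R (G j l) * x j) * y l := by
  unfold bil
  rw [Finset.sum_comm]
  simp [Finset.sum_mul]

lemma derivation_bil (D : Derivation k R R) (x y : ι → R) :
    D (bil G x y) = bil G (fun j => D (x j)) y + bil G x (fun j => D (y j)) := by
  simp only [bil, map_sum, ← Finset.sum_add_distrib]
  refine Finset.sum_congr rfl fun j _ => Finset.sum_congr rfl fun l _ => ?_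
  simp only [Derivation.leibniz, Derivation.map_algebraMap, smul_eq_mul]
  ring

/-- The linear form `bil G x`. -/
def bilLin (G : Matrix ι ι k) (x : ι → R) : (ι → R) →ₗ[R] R where
  toFun := bil G x
  map_add' := bil_add_right G x
  map_smul' a y := bil_smul_right G a x y

@[simp] lemma bilLin_apply (x y : ι → R) : bilLin G x y = bil G x y := rfl

lemma bil_single_right [DecidableEq ι] (x : ι → R) (j : ι) (a : R) :
    bil G x (Pi.single j a) = (∑ l, algebraMap k R (G l j) * x l) * a := by
  rw [bil_eq_dotProduct]
  simp [Pi.single_apply]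

lemma eq_zero_of_bil_eq_zero [DecidableEq ι] {Ω : Type*} [Field Ω] [Algebra k Ω] (hsymm : G.IsSymm)
    (hG : IsUnit (G.map (algebraMap k Ω)).det) {x : ι → Ω} (hx : ∀ y, bil G x y = 0) : x = 0 := by
  have h : (G.map (algebraMap k Ω)).mulVec x = 0 := by
    funext j
    have := hx (Pi.single j 1)
    rw [bil_single_right, mul_one] at this
    rw [← Pi.zero_apply (M := fun _ => Ω) j] at this
    simpa [Matrix.mulVec, dotProduct, hsymm.apply] using this
  exact Matrix.eq_zero_of_mulVec_eq_zero hG.ne_zero h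

end Bil

/-! ### Derivatives of polynomials at vectors -/

section Gradient

set_option linter.unusedSectionVars false

lemma map_aeval_apply {k ι A B : Type*} [Field k] [CommRing A] [Algebra k A] [CommRing B]
    [Algebra k B] (φ : A →ₐ[k] B) (g : ι → A) (F : MvPolynomial ι k) :
    φ (aeval g F) = aeval (fun j => φ (g j)) F := by
  rw [← AlgHom.comp_apply, comp_aeval]

variable {k ι A B : Type*} [Field k] [Fintype ι] [CommRing A] [Algebra k A]

lemma derivation_aeval (D : Derivation k A A) (g : ι → A) (F : MvPolynomial ι k) :
    D (aeval g F) = ∑ j, aeval g (pderiv j F) * D (g j) := by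
  classical
  induction F using MvPolynomial.induction_on with
  | C a => simp
  | add p q hp hq => simp [hp, hq, add_mul, Finset.sum_add_distrib]
  | mul_X p i hp =>
    simp only [map_mul, aeval_X, Derivation.leibniz, smul_eq_mul, hp, map_add, pderiv_X,
      Pi.single_apply, add_mul, Finset.sum_add_distrib, Finset.mul_sum]
    congr 1
    · simp [apply_ite]
    · exact Finset.sum_congr rfl fun _ _ => by ring

/-- The derivative of `F` at `u` in the direction `w`. -/
def grad (F : MvPolynomial ι k) (u w : ι → A) : A := ∑ j, aeval u (pderiv j F) * w j

/-- The derivative of `F` along the infinitesimal rotation `u ↦ b(a,u) a' - b(a',u) a`. -/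
def soD (G : Matrix ι ι k) (a a' : ι → k) (F : MvPolynomial ι k) : MvPolynomial ι k :=
  ∑ j, pderiv j F * (bil G (ext _ a) X * C (a' j) - bil G (ext _ a') X * C (a j))

/-- The direction on the right is the value at `u` of a skew endomorphism for b, so it is tangent to
the quadric (`bil_rotation_self`); if `a` and `a'` are orthogonal to z it also preserves b(z, ·). -/
lemma aeval_soD (G : Matrix ι ι k) (a a' : ι → k) (F : MvPolynomial ι k) (u : ι → A) :
    aeval u (soD G a a' F) =
      grad F u (bil G (ext A a) u • ext A a' - bil G (ext A a') u • ext A a) := by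
  have h (b : ι → k) : aeval u (bil G (ext (MvPolynomial ι k) b) X) = bil G (ext A b) u := by
    rw [map_bil]
    congr 1
    · funext j; simp [ext]
    · funext j; simp
  simp [soD, grad, h, ext]

lemma soD_isHomogeneous (G : Matrix ι ι k) (a a' : ι → k) {F : MvPolynomial ι k} {l : ℕ}
    (hF : F.IsHomogeneous l) : (soD G a a' F).IsHomogeneous l := by
  -- Constants are split off because the degree `l - 1` of a partial derivative is truncated at `l =
  -- 0`.
  rcases Nat.eq_zero_or_pos l with rfl | hl
  · obtain ⟨c, rfl⟩ : ∃ c, F = C c := ⟨_, totalDegree_eq_zero_iff_eq_C.mp (by simpa using hF.totalDegree_le)⟩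
    simpa [soD] using isHomogeneous_zero _ _ _
  have hb (b : ι → k) : (bil G (ext (MvPolynomial ι k) b) X).IsHomogeneous 1 := by
    unfold bil ext
    refine IsHomogeneous.sum _ _ _ fun j _ => IsHomogeneous.sum _ _ _ fun i _ => ?_
    rw [algebraMap_eq, ← C_mul]
    exact isHomogeneous_C_mul_X _ _
  refine IsHomogeneous.sum _ _ _ fun j _ => ?_
  have := (hF.pderiv (i := j)).mul
    (((hb a).mul (isHomogeneous_C _ (a' j))).sub ((hb a').mul (isHomogeneous_C _ (a j))))
  rwa [add_zero, Nat.sub_add_cancel hl] at this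

lemma aeval_smul_of_isHomogeneous {F : MvPolynomial ι k} {l : ℕ} (hF : F.IsHomogeneous l) (c : A)
    (u : ι → A) : aeval (c • u) F = c ^ l * aeval u F := by
  rw [aeval_def, aeval_def, eval₂_eq, eval₂_eq, Finset.mul_sum]
  refine Finset.sum_congr rfl fun d hd => ?_
  have hdeg : ∑ i ∈ d.support, d i = l := by
    simpa [Finsupp.weight_apply, Finsupp.sum] using hF (mem_support_iff.mp hd)
  simp only [Pi.smul_apply, smul_eq_mul, mul_pow, Finset.prod_mul_distrib, Finset.prod_pow_eq_pow_sum, hdeg]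
  ring

end Gradient

/-! ### Polynomial functions on quadrics -/

section PolynomialCurves

set_option linter.unusedSectionVars false

variable {k ι Ω : Type*} [Field k] [Fintype ι] [Field Ω] [CharZero Ω] [Algebra k Ω]

/-- The density device used throughout: an identity known on a curve away from the zeros of a
nonzero `d` holds on the whole curve, since Ω is infinite. -/
lemma polynomial_eq_zero_of_forall_eval {p d : Polynomial Ω} (hd : d ≠ 0)
    (h : ∀ t, d.eval t ≠ 0 → p.eval t = 0) : p = 0 := by
  have : p * d = 0 := Polynomial.funext fun t => by
    by_cases ht : d.eval t = 0 <;> simp [ht, h]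
  exact (mul_eq_zero.mp this).resolve_right hd

lemma X_pow_dvd_of_derivative {p : Polynomial Ω} {m : ℕ} (h0 : p.eval 0 = 0)
    (h : Polynomial.X ^ m ∣ Polynomial.derivative p) : Polynomial.X ^ (m + 1) ∣ p := by
  rw [Polynomial.X_pow_dvd_iff] at h ⊢
  intro d hd
  rcases d with _ | d
  · rwa [Polynomial.coeff_zero_eq_eval_zero]
  · have := h d (by omega)
    rw [Polynomial.coeff_derivative] at this
    exact (mul_eq_zero.mp this).resolve_right (by exact_mod_cast Nat.succ_ne_zero d)

/-- Evaluation of polynomials, as a homomorphism of algebras over a smaller field. -/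
def evalHom (k : Type*) {Ω : Type*} [Field k] [Field Ω] [Algebra k Ω] (t : Ω) :
    Polynomial Ω →ₐ[k] Ω := (Polynomial.aeval t : Polynomial Ω →ₐ[Ω] Ω).restrictScalars k

@[simp] lemma evalHom_apply (t : Ω) (p : Polynomial Ω) : evalHom k t p = p.eval t := by
  simp [evalHom, Polynomial.aeval_def, Polynomial.eval₂_eq_eval_map]

/-- A point of the line through `u` and `u + w`, with polynomial entries. -/
def lineVec {R : Type*} [CommRing R] (u w : ι → R) : ι → Polynomial R :=
  fun j => Polynomial.C (u j) + Polynomial.X * Polynomial.C (w j)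

/-- A vector, viewed as a vector with polynomial entries. -/
def constVec {R : Type*} [CommRing R] (u : ι → R) : ι → Polynomial R := fun j => Polynomial.C (u j)

lemma eval_lineVec (u w : ι → Ω) (t : Ω) :
    (fun j => (lineVec u w j).eval t) = u + t • w := by
  funext j; simp [lineVec]; ring

lemma eval_constVec (u : ι → Ω) (t : Ω) : (fun j => (constVec u j).eval t) = u := by
  funext j; simp [constVec]

lemma eval_bil (G : Matrix ι ι k) (x y : ι → Polynomial Ω) (t : Ω) :
    (bil G x y).eval t = bil G (fun j => (x j).eval t) (fun j => (y j).eval t) := by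
  simpa using map_bil (G := G) (evalHom k t) x y

lemma eval_aeval (x : ι → Polynomial Ω) (F : MvPolynomial ι k) (t : Ω) :
    (aeval x F).eval t = aeval (fun j => (x j).eval t) F := by
  simpa using map_aeval_apply (evalHom k t) x F

/-- The projection of the quadric from its point `r`, inverted. -/
def psi {R : Type*} [CommRing R] [Algebra k R] (G : Matrix ι ι k) (r w : ι → R) : ι → R :=
  (2 * bil G r w) • w - bil G w w • r

lemma bil_psi_self {R : Type*} [CommRing R] [Algebra k R] {G : Matrix ι ι k} (hG : G.IsSymm)
    {r : ι → R} (hr : bil G r r = 0) (w : ι → R) : bil G (psi G r w) (psi G r w) = 0 := by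
  simp only [psi, bil_sub_left, bil_sub_right, bil_smul_left, bil_smul_right, hr,
    bil_comm hG w r]
  ring

lemma bil_psi {R : Type*} [CommRing R] [Algebra k R] (G : Matrix ι ι k)
    (x r w : ι → R) : bil G x (psi G r w) = 2 * bil G r w * bil G x w - bil G w w * bil G x r := by
  simp only [psi, bil_sub_right, bil_smul_right]

lemma psi_of_isotropic {R : Type*} [CommRing R] [Algebra k R] (G : Matrix ι ι k)
    {r u : ι → R} (hu : bil G u u = 0) : psi G r u = (2 * bil G r u) • u := by
  simp [psi, hu]

lemma eval_psi (G : Matrix ι ι k) (r w : ι → Polynomial Ω) (t : Ω) :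
    (fun j => (psi G r w j).eval t) = psi G (fun j => (r j).eval t) (fun j => (w j).eval t) := by
  funext j
  simp [psi, eval_bil]

/-- The quadric cut out by the orthogonal complement of two vectors. -/
structure InCone {R : Type*} [CommRing R] [Algebra k R] (G : Matrix ι ι k) (x c v : ι → R) : Prop where
  left : bil G x v = 0
  right : bil G c v = 0
  self : bil G v v = 0

/-- The cone is a quadric in {x, c}^⊥, so projecting it from its point `r` parametrizes it by
vectors of this linear space. -/
lemma InCone.psi {R : Type*} [CommRing R] [Algebra k R] {G : Matrix ι ι k} (hG : G.IsSymm)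
    {x c r w : ι → R} (hr : InCone G x c r) (hxw : bil G x w = 0) (hcw : bil G c w = 0) :
    InCone G x c (psi G r w) where
  left := by simp [bil_psi, hxw, hr.left]
  right := by simp [bil_psi, hcw, hr.right]
  self := bil_psi_self hG hr.self w

/-- The part of the cone outside the hyperplane orthogonal to its point `r` is irreducible. -/
lemma aeval_eq_zero_of_dichotomy {G : Matrix ι ι k} (hG : G.IsSymm) {x c r : ι → Ω}
    (hr : InCone G x c r) {E₁ : MvPolynomial ι Ω} {E₂ : MvPolynomial ι k} {l : ℕ}
    (hE₂ : E₂.IsHomogeneous l)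
    (h : ∀ u, InCone G x c u → bil G r u ≠ 0 → eval u E₁ ≠ 0 → aeval u E₂ = 0)
    (hE₁ : ∃ u, InCone G x c u ∧ bil G r u ≠ 0 ∧ eval u E₁ ≠ 0)
    {l₁ : ℕ} (hl₁ : E₁.IsHomogeneous l₁)
    {u : ι → Ω} (hu : InCone G x c u) (hru : bil G r u ≠ 0) : aeval u E₂ = 0 := by
  obtain ⟨u₀, hu₀, hru₀, h₀⟩ := hE₁
  -- The segment from `u` to `u₀` in {x, c}^⊥ is carried by `psi` to a curve in the cone. Since `E₁`
  -- is nonzero at t = 1, it is nonzero at almost all t, where `E₂` vanishes; hence `E₂` vanishes at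
  -- t = 0 as well.
  set y : ι → Polynomial Ω := QuadricDivisor.psi G (constVec r) (lineVec u (u₀ - u)) with hy
  have hey (t : Ω) : (fun j => (y j).eval t) = QuadricDivisor.psi G r (u + t • (u₀ - u)) := by
    rw [hy, eval_psi, eval_constVec, eval_lineVec]
  set d : Polynomial Ω := bil G (constVec r) (lineVec u (u₀ - u)) with hd
  have hed (t : Ω) : d.eval t = bil G r (u + t • (u₀ - u)) := by
    rw [hd, eval_bil, eval_constVec, eval_lineVec]
  have hd0 : d ≠ 0 := by
    intro h0
    have := hed 0
    rw [h0] at this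
    simp at this
    exact hru this.symm
  set p₁ : Polynomial Ω := aeval y E₁ with hp₁
  have hep₁ (t : Ω) : p₁.eval t = eval (QuadricDivisor.psi G r (u + t • (u₀ - u))) E₁ := by
    rw [hp₁, eval_aeval, hey, aeval_eq_eval]
  have hp₁0 : p₁ ≠ 0 := by
    intro h0
    have := hep₁ 1
    rw [h0, one_smul, add_sub_cancel, psi_of_isotropic G hu₀.self, ← aeval_eq_eval,
      aeval_smul_of_isHomogeneous hl₁, aeval_eq_eval] at this
    simp only [Polynomial.eval_zero] at this
    exact mul_ne_zero (pow_ne_zero _ (mul_ne_zero two_ne_zero hru₀)) h₀ this.symm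
  have hW (t : Ω) : InCone G x c (QuadricDivisor.psi G r (u + t • (u₀ - u))) := by
    refine hr.psi hG ?_ ?_
    · simp [bil_add_right, bil_smul_right, bil_sub_right, hu.left, hu₀.left]
    · simp [bil_add_right, bil_smul_right, bil_sub_right, hu.right, hu₀.right]
  have key : aeval y E₂ = 0 := by
    refine polynomial_eq_zero_of_forall_eval (mul_ne_zero hd0 hp₁0) fun t ht => ?_
    rw [Polynomial.eval_mul, hed, hep₁] at ht
    rw [eval_aeval, hey]
    refine h _ (hW t) ?_ (right_ne_zero_of_mul ht)
    rw [bil_psi, hr.self]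
    have := left_ne_zero_of_mul ht
    simpa using this
  have := eval_aeval y E₂ 0
  rw [key, hey, zero_smul, add_zero, psi_of_isotropic G hu.self,
    aeval_smul_of_isHomogeneous hE₂] at this
  simp only [Polynomial.eval_zero] at this
  exact (mul_eq_zero.mp this.symm).resolve_left (pow_ne_zero _ (mul_ne_zero two_ne_zero hru))

/-- The derivation `d/dt` of polynomials, over a smaller field. -/
def polyDeriv (k Ω : Type*) [Field k] [Field Ω] [Algebra k Ω] :
    Derivation k (Polynomial Ω) (Polynomial Ω) :=
  Polynomial.derivative'.restrictScalars k

@[simp] lemma polyDeriv_apply (p : Polynomial Ω) :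
    polyDeriv k Ω p = Polynomial.derivative p := rfl

lemma grad_self {F : MvPolynomial ι k} {l : ℕ} (hF : F.IsHomogeneous l) (u : ι → Ω) :
    grad F u u = l * aeval u F := by
  have := congrArg (aeval u) hF.sum_X_mul_pderiv
  simpa [grad, mul_comm] using this

lemma grad_add (F : MvPolynomial ι k) (u v w : ι → Ω) :
    grad F u (v + w) = grad F u v + grad F u w := by
  simp [grad, mul_add, Finset.sum_add_distrib]

lemma grad_smul (F : MvPolynomial ι k) (a : Ω) (u w : ι → Ω) :
    grad F u (a • w) = a * grad F u w := by
  simp only [grad, Finset.mul_sum, Pi.smul_apply, smul_eq_mul]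
  exact Finset.sum_congr rfl fun _ _ => by ring

/-- The derivative of `F` at `u`, as a linear form. -/
def gradLin (F : MvPolynomial ι k) (u : ι → Ω) : (ι → Ω) →ₗ[Ω] Ω where
  toFun := grad F u
  map_add' := grad_add F u
  map_smul' a w := grad_smul F a u w

/-- A form vanishing on the cone outside `r^⊥` has its derivative there in the span of the
equations of the tangent space of the cone. -/
lemma exists_grad_eq {G : Matrix ι ι k} (hG : G.IsSymm) {x c r : ι → Ω}
    (hr : InCone G x c r) {F : MvPolynomial ι k} {l : ℕ} (hF : F.IsHomogeneous l)
    (h : ∀ u, InCone G x c u → bil G r u ≠ 0 → aeval u F = 0)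
    {u : ι → Ω} (hu : InCone G x c u) (hru : bil G r u ≠ 0) :
    ∃ α β γ : Ω, ∀ w, grad F u w = α * bil G x w + β * bil G c w + γ * bil G u w := by
  -- By duality of linear forms it suffices that the gradient kills every `w` orthogonal to x, c and
  -- u.
  have key (w : ι → Ω) (hxw : bil G x w = 0) (hcw : bil G c w = 0) (huw : bil G u w = 0) :
      grad F u w = 0 := by
    set y : ι → Polynomial Ω := QuadricDivisor.psi G (constVec r) (lineVec u w) with hy
    have hey (t : Ω) : (fun j => (y j).eval t) = QuadricDivisor.psi G r (u + t • w) := by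
      rw [hy, eval_psi, eval_constVec, eval_lineVec]
    set d : Polynomial Ω := bil G (constVec r) (lineVec u w) with hd
    have hed (t : Ω) : d.eval t = bil G r (u + t • w) := by
      rw [hd, eval_bil, eval_constVec, eval_lineVec]
    have hd0 : d ≠ 0 := by
      intro h0
      have := hed 0
      rw [h0] at this
      simp at this
      exact hru this.symm
    have hp : aeval y F = 0 := by
      refine polynomial_eq_zero_of_forall_eval hd0 fun t ht => ?_
      rw [hed] at ht
      rw [eval_aeval, hey]
      refine h _ (hr.psi hG ?_ ?_) ?_
      · simp [bil_add_right, bil_smul_right, hu.left, hxw]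
      · simp [bil_add_right, bil_smul_right, hu.right, hcw]
      · rw [bil_psi, hr.self]
        simpa using ht
    have h1 := derivation_aeval (polyDeriv k Ω) y F
    rw [hp, map_zero] at h1
    have h2 := congrArg (Polynomial.eval 0) h1
    -- The velocity at t = 0 of the curve `psi r (u + t w)`. Its `r`-component drops because b(u, w)
    -- = 0, and its `u`-component contributes nothing because Euler's relation gives l F(u) = 0.
    have h3 (j : ι) : (polyDeriv k Ω (y j)).eval 0 =
        2 * (bil G r w * u j + bil G r u * w j - bil G u w * r j) := by
      have e1 : (fun j => polyDeriv k Ω (lineVec u w j)) = constVec w := by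
        funext j; simp [lineVec, constVec]
      have e2 : (fun j => polyDeriv k Ω (constVec r j)) = 0 := by
        funext j; simp [constVec]
      have e3 : y j = (2 * bil G (constVec r) (lineVec u w)) * lineVec u w j
        - bil G (lineVec u w) (lineVec u w) * constVec r j := rfl
      have e4 : polyDeriv k Ω (bil G (constVec r) (lineVec u w)) = bil G (constVec r) (constVec w) := by
        rw [derivation_bil, e1, e2, bil_zero_left, zero_add]
      have e5 : polyDeriv k Ω (bil G (lineVec u w) (lineVec u w)) =
          2 * bil G (lineVec u w) (constVec w) := by
        rw [derivation_bil, e1, bil_comm hG (constVec w)]; ring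
      have e6 : polyDeriv k Ω 2 = 0 := by simp
      rw [e3, map_sub, Derivation.leibniz, Derivation.leibniz, Derivation.leibniz, e4, e5, e6,
        congrFun e1 j, congrFun e2 j]
      simp only [smul_eq_mul, Polynomial.eval_sub, Polynomial.eval_add, Polynomial.eval_mul,
        eval_bil, eval_constVec, eval_lineVec, zero_smul, add_zero, Pi.zero_apply,
        Polynomial.eval_zero, congrFun (eval_lineVec u w 0) j, congrFun (eval_constVec w 0) j,
        congrFun (eval_constVec r 0) j, Polynomial.eval_ofNat]
      ring
    simp only [Polynomial.eval_zero, Polynomial.eval_finsetSum, Polynomial.eval_mul, h3,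
      eval_aeval, hey, zero_smul, add_zero, psi_of_isotropic G hu.self,
      aeval_smul_of_isHomogeneous hF.pderiv] at h2
    have h4 : (2 * bil G r u) ^ (l - 1) * (2 * grad F u (bil G r w • u + bil G r u • w - bil G u w • r)) = 0 := by
      rw [h2]
      simp only [grad, Finset.mul_sum]
      refine Finset.sum_congr rfl fun j _ => ?_
      simp
      ring
    have h5 := (mul_eq_zero.mp h4).resolve_left (pow_ne_zero _ (mul_ne_zero two_ne_zero hru))
    have h6 := (mul_eq_zero.mp h5).resolve_left two_ne_zero
    rw [huw, zero_smul, sub_zero, grad_add, grad_smul, grad_smul, grad_self hF, h u hu hru] at h6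
    simpa [hru] using h6
  have hmem : gradLin F u ∈ Submodule.span Ω (Set.range ![bilLin G x, bilLin G c, bilLin G u]) := by
    refine mem_span_of_iInf_ker_le_ker fun w hw => ?_
    rw [Submodule.mem_iInf] at hw
    exact key w (hw 0) (hw 1) (hw 2)
  obtain ⟨a, ha⟩ := (Submodule.mem_span_range_iff_exists_fun Ω).mp hmem
  refine ⟨a 0, a 1, a 2, fun w => ?_⟩
  have := LinearMap.congr_fun ha w
  simpa [Fin.sum_univ_three, gradLin] using this.symm

end PolynomialCurves

/-! ### Iterated infinitesimal rotations and unipotent flows -/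

section Words

set_option linter.unusedSectionVars false

variable {k ι Ω : Type*} [Field k] [Fintype ι] [Field Ω] [CharZero Ω] [Algebra k Ω]

/-- The forms obtained from `f` by differentiating along infinitesimal rotations that fix `z`. -/
inductive IsWord (G : Matrix ι ι k) (z : ι → k) (f : MvPolynomial ι k) : MvPolynomial ι k → Prop
  | base : IsWord G z f f
  | step (a a' : ι → k) (F : MvPolynomial ι k) : bil G z a = 0 → bil G z a' = 0 →
      IsWord G z f F → IsWord G z f (soD G a a' F)

lemma IsWord.isHomogeneous {G : Matrix ι ι k} {z : ι → k} {f F : MvPolynomial ι k} {l : ℕ}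
    (hf : f.IsHomogeneous l) (hF : IsWord G z f F) : F.IsHomogeneous l := by
  induction hF with
  | base => exact hf
  | step a a' F _ _ _ ih => exact soD_isHomogeneous G a a' ih

/-- The `h m` are the standard basis vectors projected to z^⊥ along some y, so the coefficients are
the coordinates of `n` themselves. Words use rotations with coefficients in `k`, while the flow
below has coefficients in Ω; this bridges the two. -/
lemma exists_family_span_orthogonal [DecidableEq ι] (G : Matrix ι ι k) (z : ι → k) :
    ∃ h : ι → ι → k, (∀ m, bil G z (h m) = 0) ∧
      ∀ n : ι → Ω, bil G (ext Ω z) n = 0 → ∑ m, n m • ext Ω (h m) = n := by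
  obtain ⟨y, hy⟩ : ∃ y : ι → k, ∀ v, bil G z (v - bil G z v • y) = 0 := by
    by_cases hz : ∃ a, bil G z a ≠ 0
    · obtain ⟨a, ha⟩ := hz
      refine ⟨(bil G z a)⁻¹ • a, fun v => ?_⟩
      rw [bil_sub_right, bil_smul_right, bil_smul_right, inv_mul_cancel₀ ha, mul_one, sub_self]
    · push Not at hz
      exact ⟨0, fun v => hz _⟩
  refine ⟨fun m => Pi.single m 1 - bil G z (Pi.single m 1) • y, fun m => hy _, fun n hn => ?_⟩
  have h1 : bil G (ext Ω z) n = ∑ m, n m * algebraMap k Ω (bil G z (Pi.single m 1)) := by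
    rw [bil_eq_dotProduct]
    refine Finset.sum_congr rfl fun m _ => ?_
    rw [bil_single_right]
    simp [ext, mul_comm]
  funext j
  have h2 : ∀ m, (n m • ext Ω (Pi.single m 1 - bil G z (Pi.single m 1) • y)) j =
      n m * (if j = m then 1 else 0) -
        (n m * algebraMap k Ω (bil G z (Pi.single m 1))) * algebraMap k Ω (y j) := by
    intro m
    simp only [ext, Pi.smul_apply, Pi.sub_apply, Pi.single_apply, smul_eq_mul, map_sub, map_mul,
      apply_ite (algebraMap k Ω), map_one, map_zero]
    ring
  rw [Finset.sum_apply, Finset.sum_congr rfl fun m _ => h2 m, Finset.sum_sub_distrib,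
    ← Finset.sum_mul, ← h1, hn]
  simp

/-- If all words of `f` vanish at a point `u` of the quadric section `Q ∩ z^⊥`, then `f` vanishes
at the points obtained from `u` by the unipotent rotations attached to the isotropic vector `e`. -/
lemma aeval_eq_zero_of_words {G : Matrix ι ι k} (hG : G.IsSymm) {z : ι → k} {f : MvPolynomial ι k}
    {u v : ι → Ω} (hu : ∀ F, IsWord G z f F → aeval u F = 0)
    (hqu : bil G u u = 0) (hzu : bil G (ext Ω z) u = 0)
    (hqv : bil G v v = 0) (hzv : bil G (ext Ω z) v = 0)
    {e : ι → k} (hqe : bil G e e = 0) (hze : bil G z e = 0)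
    (heu : bil G (ext Ω e) u ≠ 0) (hev : bil G (ext Ω e) v = bil G (ext Ω e) u) :
    aeval v f = 0 := by
  classical
  obtain ⟨h, hh, hspan⟩ := exists_family_span_orthogonal (Ω := Ω) G z
  set β := bil G (ext Ω e) u with hβ
  -- Chosen so that the flow of the rotation R(y) = b(e, y) n - b(n, y) e carries `u` at time 0 to
  -- `v` at time 1.
  set n : ι → Ω := β⁻¹ • (v - u) with hn
  have hqeΩ : bil G (ext Ω e) (ext Ω e) = 0 := by rw [bil_ext, hqe, map_zero]
  have hzn : bil G (ext Ω z) n = 0 := by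
    rw [hn, bil_smul_right, bil_sub_right, hzu, hzv]; simp
  have hen : bil G (ext Ω e) n = 0 := by
    rw [hn, bil_smul_right, bil_sub_right, hev, sub_self, mul_zero]
  have hqn : bil G n n = -2 * bil G u v / β ^ 2 := by
    simp only [hn, bil_smul_right, bil_smul_left, bil_sub_right, bil_sub_left, hqu, hqv,
      bil_comm hG v u]
    field_simp
    ring
  have hnu : bil G n u = bil G u v / β := by
    simp only [hn, bil_smul_left, bil_sub_left, hqu, bil_comm hG v u]
    field_simp
    ring
  set A : ι → Ω := β • n - bil G n u • ext Ω e with hA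
  set κ : Ω := β * bil G n n with hκ
  -- This is exp(tR) u. As e is isotropic and orthogonal to n, R³ = 0 and the exponential is
  -- quadratic in t.
  set y : ι → Polynomial Ω := fun j => Polynomial.C (u j) + Polynomial.X * Polynomial.C (A j) -
    Polynomial.X ^ 2 * Polynomial.C (κ / 2 * ext Ω e j) with hy
  have hyvec : y = constVec u + (Polynomial.X : Polynomial Ω) • constVec A -
      (Polynomial.X ^ 2 * Polynomial.C (κ / 2)) • constVec (ext Ω e) := by
    funext j; simp [hy, constVec]; ring
  have hconst (a b : ι → Ω) : bil G (constVec a) (constVec b) = Polynomial.C (bil G a b) := by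
    simp [bil, constVec, map_sum, Polynomial.algebraMap_eq, IsScalarTower.algebraMap_apply k Ω (Polynomial Ω)]
  have hext (a : ι → k) : ext (Polynomial Ω) a = constVec (ext Ω a) := by
    funext j; simp [ext, constVec, IsScalarTower.algebraMap_apply k Ω (Polynomial Ω)]
  have hey : bil G (constVec (ext Ω e)) y = Polynomial.C β := by
    rw [hyvec]
    simp only [bil_add_right, bil_sub_right, bil_smul_right, hconst, hA, hqeΩ, hen, ← hβ]
    simp
  have hny : bil G (constVec n) y = Polynomial.C (bil G n u) + Polynomial.X * Polynomial.C κ := by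
    rw [hyvec]
    simp only [bil_add_right, bil_sub_right, bil_smul_right, hconst, hA, hκ,
      bil_comm hG n (ext Ω e), hen]
    simp
  have hdy (j : ι) : polyDeriv k Ω (y j) = ∑ m, Polynomial.C (n m) *
      (bil G (ext _ e) y * Polynomial.C (ext Ω (h m) j) -
        bil G (ext _ (h m)) y * Polynomial.C (ext Ω e j)) := by
    have e1 : ∑ m, Polynomial.C (n m) * Polynomial.C (ext Ω (h m) j) = Polynomial.C (n j) := by
      have := congrFun (hspan n hzn) j
      rw [Finset.sum_apply] at this
      rw [← this, map_sum]
      simp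
    have e2 : ∑ m, Polynomial.C (n m) * bil G (ext _ (h m)) y = bil G (constVec n) y := by
      have : constVec n = ∑ m, Polynomial.C (n m) • ext (Polynomial Ω) (h m) := by
        funext i
        simp only [Finset.sum_apply, hext]
        have := (congrFun (hspan n hzn) i).symm
        rw [Finset.sum_apply] at this
        simp only [constVec, Pi.smul_apply, smul_eq_mul] at this ⊢
        conv_lhs => rw [this, map_sum]
        simp
      conv_rhs => rw [this, bil_sum_left]
      simp [bil_smul_left]
    have e3 : ∑ m, Polynomial.C (n m) * (bil G (ext _ e) y * Polynomial.C (ext Ω (h m) j) -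
        bil G (ext _ (h m)) y * Polynomial.C (ext Ω e j)) =
        bil G (ext _ e) y * Polynomial.C (n j) - bil G (constVec n) y * Polynomial.C (ext Ω e j) := by
      rw [← e1, ← e2, Finset.mul_sum, Finset.sum_mul, ← Finset.sum_sub_distrib]
      exact Finset.sum_congr rfl fun _ _ => by ring
    rw [e3, hext, hey, hny, hy]
    simp only [polyDeriv_apply, Polynomial.derivative_sub, Polynomial.derivative_add,
      Polynomial.derivative_C, Polynomial.derivative_mul, Polynomial.derivative_X,
      Polynomial.derivative_X_pow, hA, Pi.sub_apply, Pi.smul_apply, smul_eq_mul]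
    have h2 : (Polynomial.C (2 : Ω)) * Polynomial.C (κ / 2 * ext Ω e j) = Polynomial.C κ * Polynomial.C (ext Ω e j) := by
      rw [← Polynomial.C_mul, ← Polynomial.C_mul]; congr 1; ring
    simp only [Polynomial.C_sub, Polynomial.C_mul, Nat.cast_ofNat, mul_zero, add_zero] at h2 ⊢
    linear_combination (-Polynomial.X) * h2
  -- The derivative of a word along the flow is a combination of longer words, all of which vanish
  -- at `u`. So every word vanishes at t = 0 to arbitrary order.
  have hdvd (m : ℕ) : ∀ F, IsWord G z f F → Polynomial.X ^ m ∣ aeval y F := by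
    induction m with
    | zero => intro F _; simp
    | succ m ih =>
      intro F hF
      refine X_pow_dvd_of_derivative ?_ ?_
      · rw [eval_aeval]
        have : (fun j => (y j).eval 0) = u := by funext j; simp [hy]
        rw [this, hu F hF]
      · rw [← polyDeriv_apply (k := k), derivation_aeval]
        have : ∑ j, aeval y (pderiv j F) * polyDeriv k Ω (y j) =
            ∑ m, Polynomial.C (n m) * aeval y (soD G e (h m) F) := by
          simp only [aeval_soD, grad, Finset.mul_sum, hdy]
          rw [Finset.sum_comm]
          refine Finset.sum_congr rfl fun i _ => Finset.sum_congr rfl fun j _ => ?_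
          simp only [hext, constVec, Pi.sub_apply, Pi.smul_apply, smul_eq_mul]
          ring
        rw [this]
        exact Finset.dvd_sum fun i _ =>
          Dvd.dvd.mul_left (ih _ (IsWord.step e (h i) F hze (hh i) hF)) _
  have hzero : aeval y f = 0 := by
    ext d
    have := (Polynomial.X_pow_dvd_iff.mp (hdvd (d + 1) f IsWord.base)) d (by omega)
    simpa using this
  have hy1 : (fun j => (y j).eval 1) = v := by
    funext j
    have hnj : n j = β⁻¹ * (v j - u j) := rfl
    simp only [hy, hA, hκ, hqn, hnu, hnj, Polynomial.eval_sub, Polynomial.eval_add,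
      Polynomial.eval_mul, Polynomial.eval_C, Polynomial.eval_X, Polynomial.eval_pow,
      Pi.sub_apply, Pi.smul_apply, smul_eq_mul]
    field_simp
    ring
  rw [← hy1, ← eval_aeval, hzero, Polynomial.eval_zero]

end Words

/-! ### Isotropic vectors and propagation of vanishing over a quadric section -/

section Isotropic

set_option linter.unusedSectionVars false

variable {k ι Ω : Type*} [Field k] [Fintype ι] [Field Ω] [CharZero Ω] [Algebra k Ω]

/-- The orthogonal complement of a finite family of vectors. -/
def perp (G : Matrix ι ι k) {s : ℕ} (L : Fin s → ι → Ω) : Submodule Ω (ι → Ω) :=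
  LinearMap.ker (LinearMap.pi fun i => bilLin G (L i))

lemma mem_perp {G : Matrix ι ι k} {s : ℕ} {L : Fin s → ι → Ω} {v : ι → Ω} :
    v ∈ perp G L ↔ ∀ i, bil G (L i) v = 0 := by
  simp [perp, LinearMap.mem_ker, funext_iff]

lemma card_le_finrank_perp (G : Matrix ι ι k) {s : ℕ} (L : Fin s → ι → Ω) :
    Fintype.card ι ≤ Module.finrank Ω (perp G L) + s := by
  have h := LinearMap.finrank_range_add_finrank_ker (LinearMap.pi fun i => bilLin G (L i))
  have h2 := Submodule.finrank_le (LinearMap.range (LinearMap.pi fun i => bilLin G (L i)))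
  simp only [Module.finrank_fintype_fun_eq_card, Fintype.card_fin] at h h2
  unfold perp
  omega

/-- A linear form killing the common kernel of finitely many forms is a combination of them;
nondegeneracy carries this back to vectors. -/
lemma eq_sum_of_perp [DecidableEq ι] {G : Matrix ι ι k} (hG : G.IsSymm)
    (hdet : IsUnit (G.map (algebraMap k Ω)).det) {s : ℕ} {L : Fin s → ι → Ω} {v : ι → Ω}
    (h : ∀ y ∈ perp G L, bil G v y = 0) : ∃ a : Fin s → Ω, v = ∑ i, a i • L i := by
  have hmem : bilLin G v ∈ Submodule.span Ω (Set.range fun i => bilLin G (L i)) := by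
    refine mem_span_of_iInf_ker_le_ker fun w hw => ?_
    rw [Submodule.mem_iInf] at hw
    exact h w (mem_perp.mpr hw)
  obtain ⟨a, ha⟩ := (Submodule.mem_span_range_iff_exists_fun Ω).mp hmem
  refine ⟨a, sub_eq_zero.mp (eq_zero_of_bil_eq_zero hG hdet fun y => ?_)⟩
  have := LinearMap.congr_fun ha y
  simp only [LinearMap.sum_apply, LinearMap.smul_apply, bilLin_apply, smul_eq_mul] at this
  rw [bil_sub_left, bil_sum_left, ← this]
  simp [bil_smul_left]

lemma exists_mem_notMem_of_finrank_lt {U R : Submodule Ω (ι → Ω)}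
    (h : Module.finrank Ω R < Module.finrank Ω U) : ∃ v ∈ U, v ∉ R := by
  by_contra! hc
  exact absurd (Submodule.finrank_mono (show U ≤ R from hc)) (by omega)

/-- A subspace of rank at least two contains a hyperbolic pair. -/
lemma exists_hyperbolic_pair [IsAlgClosed Ω] {G : Matrix ι ι k} (hG : G.IsSymm)
    {U R : Submodule Ω (ι → Ω)} (hR : ∀ v ∈ U, (∀ y ∈ U, bil G v y = 0) → v ∈ R)
    (hdim : Module.finrank Ω R + 2 ≤ Module.finrank Ω U) :
    ∃ e ∈ U, ∃ f ∈ U, bil G e e = 0 ∧ bil G f f = 0 ∧ bil G e f = 1 := by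
  -- An isotropic vector not orthogonal to all of U is completed to a hyperbolic pair by normalizing
  -- a partner and subtracting a multiple of r.
  suffices h : ∃ r ∈ U, bil G r r = 0 ∧ ∃ y ∈ U, bil G r y ≠ 0 by
    obtain ⟨r, hr, hrr, y, hy, hry⟩ := h
    refine ⟨r, hr, (bil G r y)⁻¹ • y - (bil G y y / (2 * bil G r y ^ 2)) • r,
      U.sub_mem (U.smul_mem _ hy) (U.smul_mem _ hr), hrr, ?_, ?_⟩
    · simp only [bil_sub_left, bil_sub_right, bil_smul_left, bil_smul_right, hrr, bil_comm hG y r]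
      field_simp
      ring
    · simp only [bil_sub_right, bil_smul_right, hrr]
      field_simp
      ring
  have hR' (v) (hv : v ∈ U) (hvR : v ∉ R) : ∃ y ∈ U, bil G v y ≠ 0 := by
    by_contra! hc
    exact hvR (hR v hv hc)
  -- Two orthogonal anisotropic vectors have an isotropic combination over an algebraically closed
  -- field. Passing to the complement of `w₁` costs one dimension, hence the margin of two.
  obtain ⟨w₁, hw₁, hw₁R⟩ := exists_mem_notMem_of_finrank_lt (U := U) (R := R) (by omega)
  by_cases h1 : bil G w₁ w₁ = 0
  · exact ⟨w₁, hw₁, h1, hR' w₁ hw₁ hw₁R⟩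
  have hdim1 : Module.finrank Ω U ≤ Module.finrank Ω (U ⊓ LinearMap.ker (bilLin G w₁) : Submodule Ω (ι → Ω)) + 1 := by
    have h1 := LinearMap.finrank_range_add_finrank_ker (bilLin G w₁)
    have h2 := Submodule.finrank_le (LinearMap.range (bilLin G w₁))
    have h3 := Submodule.finrank_sup_add_finrank_inf_eq U (LinearMap.ker (bilLin G w₁))
    have h4 := Submodule.finrank_le (U ⊔ LinearMap.ker (bilLin G w₁))
    rw [Module.finrank_self] at h2
    omega
  obtain ⟨w₂, hw₂, hw₂R⟩ := exists_mem_notMem_of_finrank_lt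
    (U := U ⊓ LinearMap.ker (bilLin G w₁)) (R := R) (by omega)
  have hw₂U := hw₂.1
  have h12 : bil G w₁ w₂ = 0 := hw₂.2
  by_cases h2 : bil G w₂ w₂ = 0
  · exact ⟨w₂, hw₂U, h2, hR' w₂ hw₂U hw₂R⟩
  obtain ⟨κ, hκ⟩ := IsAlgClosed.exists_pow_nat_eq (-bil G w₁ w₁ / bil G w₂ w₂) (n := 2) (by norm_num)
  refine ⟨w₁ + κ • w₂, U.add_mem hw₁ (U.smul_mem _ hw₂U), ?_, w₁, hw₁, ?_⟩
  · simp only [bil_add_left, bil_add_right, bil_smul_left, bil_smul_right, h12, bil_comm hG w₂ w₁]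
    field_simp at hκ
    linear_combination hκ
  · simp only [bil_add_left, bil_smul_left, bil_comm hG w₂ w₁, h12]
    simpa using h1

/-- Isotropic vectors which are not orthogonal to all others span a space with a hyperbolic
pair. -/
lemma exists_isotropic_apply_ne_zero {M : Type*} [AddCommGroup M] [Module Ω M]
    {G : Matrix ι ι k} (hG : G.IsSymm) {U : Submodule Ω (ι → Ω)} {e f : ι → Ω} (he : e ∈ U)
    (hf : f ∈ U) (hee : bil G e e = 0) (hff : bil G f f = 0) (hef : bil G e f = 1)
    (φ : (ι → Ω) →ₗ[Ω] M) {h : ι → Ω} (hh : h ∈ U) (hφ : φ h ≠ 0) :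
    ∃ v ∈ U, bil G v v = 0 ∧ φ v ≠ 0 ∧ ∃ r ∈ U, bil G r r = 0 ∧ bil G r v ≠ 0 := by
  by_cases h1 : φ e = 0
  swap
  · exact ⟨e, he, hee, h1, f, hf, hff, by rw [bil_comm hG, hef]; exact one_ne_zero⟩
  by_cases h2 : φ f = 0
  swap
  · exact ⟨f, hf, hff, h2, e, he, hee, by rw [hef]; exact one_ne_zero⟩
  -- The component of `h` orthogonal to the hyperbolic plane. Since φ kills e and f, the isotropic
  -- vector e + n - (q(n)/2) f has the same nonzero image as `h`.
  set n := h - bil G h f • e - bil G h e • f with hn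
  have hnU : n ∈ U := U.sub_mem (U.sub_mem hh (U.smul_mem _ he)) (U.smul_mem _ hf)
  have hne : bil G n e = 0 := by
    simp [hn, bil_sub_left, bil_smul_left, hee, bil_comm hG f e, hef]
  have hnf : bil G n f = 0 := by
    simp [hn, bil_sub_left, bil_smul_left, hff, hef]
  refine ⟨e + n - (bil G n n / 2) • f, U.sub_mem (U.add_mem he hnU) (U.smul_mem _ hf), ?_, ?_,
    f, hf, hff, ?_⟩
  · simp only [bil_add_left, bil_sub_left, bil_add_right, bil_sub_right, bil_smul_left,
      bil_smul_right, hee, hff, hef, hne, hnf, bil_comm hG e n, bil_comm hG f e, bil_comm hG f n]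
    ring
  · simpa [hn, h1, h2] using hφ
  · simp [bil_add_right, bil_sub_right, bil_smul_right, hff, bil_comm hG f e, hef,
      bil_comm hG f n, hnf]

variable [CharZero k] [IsAlgClosed k]

lemma exists_algebraMap_eval_ne_zero {p : Polynomial Ω} (hp : p ≠ 0) :
    ∃ τ : k, p.eval (algebraMap k Ω τ) ≠ 0 := by
  by_contra! h
  refine hp (Polynomial.eq_zero_of_infinite_isRoot p
    ((Set.infinite_range_of_injective (algebraMap k Ω).injective).mono ?_))
  rintro _ ⟨τ, rfl⟩
  exact h τ

/-- A form all of whose words vanish at a point `u` of the quadric section `Q ∩ z^⊥` vanishes on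
this section. -/
theorem eval_eq_zero_of_words [DecidableEq ι] {G : Matrix ι ι k} (hG : G.IsSymm) (hdet : IsUnit G.det)
    (hcard : 5 ≤ Fintype.card ι) {z : ι → k} {f : MvPolynomial ι k} {l : ℕ}
    (hf : f.IsHomogeneous l)
    {u : ι → Ω} (hu : ∀ F, IsWord G z f F → aeval u F = 0)
    (hqu : bil G u u = 0) (hzu : bil G (ext Ω z) u = 0)
    {r : ι → Ω} (hzr : bil G (ext Ω z) r = 0) (hru : bil G r u ≠ 0)
    {v : ι → k} (hqv : bil G v v = 0) (hzv : bil G z v = 0) : eval v f = 0 := by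
  have hdet' : IsUnit (G.map (algebraMap k k)).det := by simpa using hdet
  have hz1 : Module.finrank k (Submodule.span k {z}) ≤ 1 :=
    (finrank_span_le_card ({z} : Set (ι → k))).trans (by simp)
  have hU1 := card_le_finrank_perp G (Ω := k) ![z]
  have memU {y : ι → k} : y ∈ perp G ![z] ↔ bil G z y = 0 := by simp [mem_perp]
  have hrad (v : ι → k) (h : ∀ y, bil G z y = 0 → bil G v y = 0) : v ∈ Submodule.span k {z} := by
    obtain ⟨a, ha⟩ := eq_sum_of_perp hG hdet' (L := ![z]) (v := v) fun y hy => h y (memU.mp hy)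
    rw [Submodule.mem_span_singleton]
    exact ⟨a 0, by simp [ha]⟩
  obtain ⟨e, he, f', hf', hee, hff, hef⟩ := exists_hyperbolic_pair hG (U := perp G ![z])
    (R := Submodule.span k {z}) (fun v _ h => hrad v fun y hy => h y (memU.mpr hy)) (by omega)
  -- the pairing of `H` with `u`
  let φ : (ι → k) →ₗ[k] Ω :=
    { toFun := fun a => bil G (ext Ω a) u
      map_add' := fun a b => by
        rw [← bil_add_left]; congr 1; funext j; simp [ext]
      map_smul' := fun c a => by
        rw [RingHom.id_apply, Algebra.smul_def c (bil G (ext Ω a) u), ← bil_smul_left]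
        congr 1; funext j; simp [ext] }
  -- The vector `r` has coefficients in Ω but is a combination of vectors of z^⊥ over `k`, so one of
  -- the latter already pairs nontrivially with `u`.
  have hφ : ∃ h, bil G z h = 0 ∧ φ h ≠ 0 := by
    by_contra! hc
    obtain ⟨h, hh, hspan⟩ := exists_family_span_orthogonal (Ω := Ω) G z
    apply hru
    rw [← hspan r hzr, bil_sum_left]
    refine Finset.sum_eq_zero fun m _ => ?_
    rw [bil_smul_left, show bil G (ext Ω (h m)) u = 0 from hc _ (hh m), mul_zero]
  obtain ⟨h₁, hh₁, hφ₁⟩ := hφ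
  obtain ⟨e₁, he₁, hee₁, heu₁, -⟩ := exists_isotropic_apply_ne_zero hG he hf' hee hff hef φ
    (memU.mpr hh₁) hφ₁
  have main (v : ι → k) (hqv : bil G v v = 0) (hzv : bil G z v = 0)
      (hv : v ∉ Submodule.span k {z}) : eval v f = 0 := by
    -- A rescaling of `v`, harmless for a form, gives it the same pairing with `e` as `u`, as the
    -- unipotent flow requires.
    suffices hE : ∃ e, bil G z e = 0 ∧ bil G e e = 0 ∧ φ e ≠ 0 ∧ bil G e v ≠ 0 by
      obtain ⟨e, hze, hee, heu, hev⟩ := hE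
      have hev' : algebraMap k Ω (bil G e v) ≠ 0 := by simpa using hev
      set c : Ω := φ e / algebraMap k Ω (bil G e v) with hc
      have hc0 : c ≠ 0 := div_ne_zero heu hev'
      have := aeval_eq_zero_of_words hG (v := c • ext Ω v) hu hqu hzu
        (by rw [bil_smul_left, bil_smul_right, bil_ext, hqv]; simp)
        (by rw [bil_smul_right, bil_ext, hzv]; simp) hee hze heu
        (by rw [bil_smul_right, bil_ext, hc, div_mul_cancel₀ _ hev']; rfl)
      rw [aeval_smul_of_isHomogeneous hf] at this
      have h2 := (mul_eq_zero.mp this).resolve_left (pow_ne_zero _ hc0)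
      have h3 : aeval (ext Ω v) f = algebraMap k Ω (eval v f) := by
        rw [← aeval_eq_eval]
        exact (map_aeval_apply (Algebra.ofId k Ω) v f).symm
      rw [h3] at h2
      simpa using h2
    have hv' : ∃ h, bil G z h = 0 ∧ bilLin G v h ≠ 0 := by
      by_contra! hc
      exact hv (hrad v hc)
    obtain ⟨h₂, hh₂, hv₂⟩ := hv'
    obtain ⟨e₂, he₂, hee₂, hev₂, -⟩ := exists_isotropic_apply_ne_zero hG he hf' hee hff hef (bilLin G v)
      (memU.mpr hh₂) hv₂
    rw [bilLin_apply, bil_comm hG] at hev₂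
    rw [memU] at he₁ he₂
    by_cases h1 : bil G e₁ v = 0
    swap
    · exact ⟨e₁, he₁, hee₁, heu₁, h1⟩
    by_cases h2 : φ e₂ = 0
    swap
    · exact ⟨e₂, he₂, hee₂, h2, hev₂⟩
    -- Now `e₁` pairs with `u` only and `e₂` with `v` only. If they are orthogonal, their sum is
    -- isotropic and pairs with both.
    by_cases h12 : bil G e₁ e₂ = 0
    · refine ⟨e₁ + e₂, by rw [bil_add_right, he₁, he₂, add_zero], ?_, ?_, ?_⟩
      · simp [bil_add_left, bil_add_right, hee₁, hee₂, h12, bil_comm hG e₂ e₁]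
      · simpa [h2] using heu₁
      · simpa [bil_add_left, h1] using hev₂
    -- Otherwise {z, e₁, e₂}^⊥ would be totally isotropic, hence inside ⟨z, e₁, e₂⟩ and then inside
    -- ⟨z⟩, while its dimension is at least two.
    have hn : ∃ n, bil G z n = 0 ∧ bil G e₁ n = 0 ∧ bil G e₂ n = 0 ∧ bil G n n ≠ 0 := by
      by_contra! hc
      have memU3 {y : ι → k} : y ∈ perp G ![z, e₁, e₂] ↔
          bil G z y = 0 ∧ bil G e₁ y = 0 ∧ bil G e₂ y = 0 := by simp [mem_perp, Fin.forall_fin_succ]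
      have hle : perp G ![z, e₁, e₂] ≤ Submodule.span k {z} := by
        intro y hy
        obtain ⟨a, ha⟩ := eq_sum_of_perp hG hdet' (L := ![z, e₁, e₂]) (v := y) fun w hw => by
          have q (w) (hw : w ∈ perp G ![z, e₁, e₂]) : bil G w w = 0 := by
            obtain ⟨a, b, c⟩ := memU3.mp hw
            exact hc w a b c
          have := q _ (Submodule.add_mem _ hy hw)
          simp only [bil_add_left, bil_add_right, q _ hy, q _ hw, bil_comm hG w y] at this
          have h2 : (2 : k) * bil G y w = 0 := by linear_combination this
          exact (mul_eq_zero.mp h2).resolve_left two_ne_zero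
        obtain ⟨b0, b1, b2⟩ := memU3.mp hy
        simp only [Fin.sum_univ_three, Matrix.cons_val_zero, Matrix.cons_val_one,
          Matrix.cons_val_two, Matrix.tail_cons, Matrix.head_cons] at ha
        rw [ha] at b1 b2
        simp only [bil_add_right, bil_smul_right, bil_comm hG _ z, he₁, he₂, hee₁, hee₂,
          bil_comm hG e₂ e₁] at b1 b2
        simp [h12] at b1 b2
        rw [Submodule.mem_span_singleton]
        exact ⟨a 0, by rw [ha, b1, b2]; simp⟩
      have := Submodule.finrank_mono hle
      have h3 := card_le_finrank_perp G (Ω := k) ![z, e₁, e₂]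
      omega
    obtain ⟨n, hzn, hn₁, hn₂, hnn⟩ := hn
    -- With this σ the conic e₁ + τn + τ²σe₂ consists of isotropic vectors. The polynomial `p`
    -- collects the conditions for its pairings with `u` and `v` to be nonzero.
    set σ : k := -bil G n n / (2 * bil G e₁ e₂) with hσ
    have hσ0 : σ ≠ 0 := div_ne_zero (neg_ne_zero.mpr hnn) (mul_ne_zero two_ne_zero h12)
    set p : Polynomial Ω := (Polynomial.C (φ e₁) + Polynomial.X * Polynomial.C (φ n)) *
      (Polynomial.X * (Polynomial.C (algebraMap k Ω (bil G n v)) +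
        Polynomial.X * Polynomial.C (algebraMap k Ω (σ * bil G e₂ v)))) with hp
    have hp0 : p ≠ 0 := by
      refine mul_ne_zero ?_ (mul_ne_zero Polynomial.X_ne_zero ?_)
      · intro h0
        have := congrArg (Polynomial.eval 0) h0
        simp at this
        exact heu₁ this
      · intro h0
        have := congrArg (fun q => Polynomial.coeff q 1) h0
        simp at this
        exact this.elim hσ0 hev₂
    obtain ⟨τ, hτ⟩ := exists_algebraMap_eval_ne_zero (k := k) hp0
    refine ⟨e₁ + τ • n + (τ ^ 2 * σ) • e₂, ?_, ?_, ?_, ?_⟩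
    · simp [bil_add_right, bil_smul_right, he₁, he₂, hzn]
    · simp only [bil_add_left, bil_add_right, bil_smul_left, bil_smul_right, hee₁, hee₂, hn₁, hn₂,
        bil_comm hG e₂ e₁, bil_comm hG n e₁, bil_comm hG n e₂, hσ]
      field_simp
      ring
    · intro h0
      apply hτ
      have : φ e₁ + algebraMap k Ω τ * φ n = 0 := by
        rw [map_add, map_add, map_smul, map_smul, h2, smul_zero, add_zero] at h0
        rw [← h0, Algebra.smul_def]
      simp only [hp, Polynomial.eval_mul, Polynomial.eval_add, Polynomial.eval_X,
        Polynomial.eval_C, this, zero_mul]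
    · intro h0
      apply hτ
      simp only [bil_add_left, bil_smul_left, h1] at h0
      have : algebraMap k Ω τ * (algebraMap k Ω (bil G n v) +
          algebraMap k Ω τ * algebraMap k Ω (σ * bil G e₂ v)) = 0 := by
        rw [← map_mul, ← map_add, ← map_mul, ← map_zero (algebraMap k Ω)]
        congr 1
        linear_combination h0
      simp only [hp, Polynomial.eval_mul, Polynomial.eval_add, Polynomial.eval_X,
        Polynomial.eval_C, this, mul_zero]
  by_cases hv : v ∈ Submodule.span k {z}
  swap
  · exact main v hqv hzv hv
  obtain ⟨c, rfl⟩ := Submodule.mem_span_singleton.mp hv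
  -- Multiples of z are reached as limits: the points v + te with t ≠ 0 are isotropic, orthogonal to
  -- z and not proportional to z.
  have hp : aeval (lineVec (c • z) e) f = 0 := by
    refine polynomial_eq_zero_of_forall_eval Polynomial.X_ne_zero fun t ht => ?_
    rw [Polynomial.eval_X] at ht
    rw [eval_aeval, eval_lineVec, aeval_eq_eval]
    rw [memU] at he hf'
    refine main _ ?_ ?_ ?_
    · have h1 : bil G (c • z) e = 0 := by rw [bil_smul_left, he, mul_zero]
      rw [bil_add_left, bil_add_right, bil_add_right, hqv, bil_comm hG (t • e), bil_smul_right,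
        bil_smul_right, h1, bil_smul_left, hee]
      ring
    · rw [bil_add_right, hzv, bil_smul_right, he]; ring
    · intro hmem
      have h3 : t • e ∈ Submodule.span k {z} := by
        simpa using Submodule.sub_mem _ hmem hv
      obtain ⟨d, hd⟩ := Submodule.mem_span_singleton.mp h3
      have := congrArg (fun w => bil G w f') hd
      simp only [bil_smul_left, hf', hef] at this
      simp at this
      exact ht this.symm
  have := eval_aeval (lineVec (c • z) e) f 0
  rw [hp, eval_lineVec, zero_smul, add_zero, aeval_eq_eval] at this
  simpa using this.symm

end Isotropic

/-! ### First variation of the moving cone -/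

section Generic

set_option linter.unusedSectionVars false

variable {k ι Ω : Type*} [Field k] [Fintype ι] [Field Ω] [CharZero Ω] [Algebra k Ω]

/-- The coordinatewise derivative of a vector. -/
def dv (D : Derivation k Ω Ω) (x : ι → Ω) : ι → Ω := fun j => D (x j)

lemma dv_add (D : Derivation k Ω Ω) (x y : ι → Ω) : dv D (x + y) = dv D x + dv D y := by
  funext j; simp [dv]

lemma dv_sub (D : Derivation k Ω Ω) (x y : ι → Ω) : dv D (x - y) = dv D x - dv D y := by
  funext j; simp [dv]

lemma dv_smul (D : Derivation k Ω Ω) (a : Ω) (x : ι → Ω) : dv D (a • x) = D a • x + a • dv D x := by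
  funext j; simp [dv]; ring

lemma add_dv (D D' : Derivation k Ω Ω) (x : ι → Ω) : dv (D + D') x = dv D x + dv D' x := by
  funext j; simp [dv]

lemma sub_dv (D D' : Derivation k Ω Ω) (x : ι → Ω) : dv (D - D') x = dv D x - dv D' x := by
  funext j; simp [dv]

lemma smul_dv (a : Ω) (D : Derivation k Ω Ω) (x : ι → Ω) : dv (a • D) x = a • dv D x := by
  funext j; simp [dv]

lemma lie_dv (D D' : Derivation k Ω Ω) (x : ι → Ω) :
    dv ⁅D, D'⁆ x = dv D (dv D' x) - dv D' (dv D x) := by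
  funext j; simp [dv, Derivation.commutator_apply]

lemma dv_bil (G : Matrix ι ι k) (D : Derivation k Ω Ω) (x y : ι → Ω) :
    D (bil G x y) = bil G (dv D x) y + bil G x (dv D y) := derivation_bil D x y

/-- Differentiating the vanishing of `F` at a point of a moving cone. -/
lemma grad_relation {G : Matrix ι ι k} (hG : G.IsSymm) {x c u : ι → Ω} {F : MvPolynomial ι k}
    (hF : aeval u F = 0) (hu : InCone G x c u) {α β γ : Ω}
    (h : ∀ w, grad F u w = α * bil G x w + β * bil G c w + γ * bil G u w)
    (D : Derivation k Ω Ω) : α * bil G (dv D x) u + β * bil G (dv D c) u = 0 := by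
  -- The chain rule applied to F(u) = 0. The differentiated equations of the cone then eliminate the
  -- motion of `u`, leaving only that of x and c.
  have h1 : grad F u (dv D u) = 0 := by
    have := derivation_aeval D u F
    rw [hF, map_zero] at this
    exact this.symm
  have h2 := dv_bil G D x u
  have h3 := dv_bil G D c u
  have h4 := dv_bil G D u u
  rw [hu.left, map_zero] at h2
  rw [hu.right, map_zero] at h3
  rw [hu.self, map_zero, bil_comm hG (dv D u)] at h4
  have h5 : bil G u (dv D u) = 0 := by
    have : (2 : Ω) * bil G u (dv D u) = 0 := by linear_combination -h4
    exact (mul_eq_zero.mp this).resolve_left two_ne_zero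
  have h6 := h (dv D u)
  rw [h1, h5] at h6
  linear_combination (-α) * h2 - β * h3 + h6

/-- The quadratic form `u ↦ b(p₁,u) b(r₂,u) - b(p₂,u) b(r₁,u)` as a polynomial. -/
def minorPoly (G : Matrix ι ι k) (p₁ p₂ r₁ r₂ : ι → Ω) : MvPolynomial ι Ω :=
  bil G (fun j => C (p₁ j)) X * bil G (fun j => C (r₂ j)) X -
    bil G (fun j => C (p₂ j)) X * bil G (fun j => C (r₁ j)) X

lemma eval_minorPoly (G : Matrix ι ι k) (p₁ p₂ r₁ r₂ u : ι → Ω) :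
    eval u (minorPoly G p₁ p₂ r₁ r₂) =
      bil G p₁ u * bil G r₂ u - bil G p₂ u * bil G r₁ u := by
  have h (p : ι → Ω) : eval u (bil G (fun j => C (p j)) X) = bil G p u := by
    have := map_bil (G := G) ((aeval u : MvPolynomial ι Ω →ₐ[Ω] Ω).restrictScalars k)
      (fun j => C (p j)) X
    simpa [aeval_eq_eval] using this
  simp [minorPoly, h]

lemma minorPoly_isHomogeneous (G : Matrix ι ι k) (p₁ p₂ r₁ r₂ : ι → Ω) :
    (minorPoly G p₁ p₂ r₁ r₂).IsHomogeneous 2 := by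
  have h (p : ι → Ω) : (bil G (fun j => (C (p j) : MvPolynomial ι Ω)) X).IsHomogeneous 1 := by
    refine IsHomogeneous.sum _ _ _ fun j _ => IsHomogeneous.sum _ _ _ fun i _ => ?_
    rw [IsScalarTower.algebraMap_apply k Ω (MvPolynomial ι Ω), algebraMap_eq, ← C_mul]
    exact isHomogeneous_C_mul_X _ _
  exact ((h _).mul (h _)).sub ((h _).mul (h _))

variable [CharZero k] [IsAlgClosed k] [DecidableEq ι]

lemma bil_rotation_self {G : Matrix ι ι k} (hG : G.IsSymm) (a a' u : ι → Ω) :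
    bil G u (bil G a u • a' - bil G a' u • a) = 0 := by
  rw [bil_sub_right, bil_smul_right, bil_smul_right, bil_comm hG u, bil_comm hG u]
  ring

/-- The minors of the first variation of `(x, c)` vanish on the cone. -/
lemma minor_eq_zero {G : Matrix ι ι k} (hG : G.IsSymm) (hdet : IsUnit G.det)
    (hcard : 5 ≤ Fintype.card ι) {x c : ι → Ω} {f : MvPolynomial ι k} {l : ℕ}
    (hf : f.IsHomogeneous l)
    (hV : ∀ r u, InCone G x c r → InCone G x c u → bil G r u ≠ 0 → aeval u f = 0)
    (hne : ∃ v : ι → k, bil G v v = 0 ∧ eval v f ≠ 0) (D₁ D₂ : Derivation k Ω Ω)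
    {r u : ι → Ω} (hr : InCone G x c r) (hu : InCone G x c u) (hru : bil G r u ≠ 0) :
    bil G (dv D₁ x) u * bil G (dv D₂ c) u - bil G (dv D₂ x) u * bil G (dv D₁ c) u = 0 := by
  by_contra h0
  obtain ⟨v, hqv, hfv⟩ := hne
  apply hfv
  have hext0 : ext Ω (0 : ι → k) = 0 := by funext j; simp [ext]
  -- Where the minor is nonzero, the relations for D₁ and D₂ force α = β = 0; the gradient is then γ
  -- b(u, ·), which kills rotations. The dichotomy extends this over the cone. With z = 0 all
  -- rotations are allowed, so f would vanish on the whole quadric.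
  have words (F) (hF : IsWord G 0 f F) :
      ∀ u, InCone G x c u → bil G r u ≠ 0 → aeval u F = 0 := by
    induction hF with
    | base => exact fun u hu hru => hV r u hr hu hru
    | step a a' F _ _ hF ih =>
      intro u' hu' hru'
      refine aeval_eq_zero_of_dichotomy hG hr
        (E₁ := minorPoly G (dv D₁ x) (dv D₂ x) (dv D₁ c) (dv D₂ c))
        (soD_isHomogeneous G a a' (hF.isHomogeneous hf)) ?_
        ⟨u, hu, hru, by rwa [eval_minorPoly]⟩ (minorPoly_isHomogeneous G _ _ _ _) hu' hru'
      intro u hu hru hmin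
      rw [eval_minorPoly] at hmin
      obtain ⟨α, β, γ, hgrad⟩ := exists_grad_eq hG hr (hF.isHomogeneous hf) ih hu hru
      have e₁ := grad_relation hG (ih u hu hru) hu hgrad D₁
      have e₂ := grad_relation hG (ih u hu hru) hu hgrad D₂
      have hα : α = 0 := by
        refine (mul_eq_zero.mp (?_ : α * _ = 0)).resolve_right hmin
        linear_combination bil G (dv D₂ c) u * e₁ - bil G (dv D₁ c) u * e₂
      have hβ : β = 0 := by
        refine (mul_eq_zero.mp (?_ : β * _ = 0)).resolve_right hmin
        linear_combination bil G (dv D₁ x) u * e₂ - bil G (dv D₂ x) u * e₁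
      rw [aeval_soD, hgrad, hα, hβ, bil_rotation_self hG]
      ring
  exact eval_eq_zero_of_words hG hdet hcard hf (fun F hF => words F hF u hu hru) hu.self
    (by rw [hext0, bil_zero_left]) (by rw [hext0, bil_zero_left]) hru hqv (bil_zero_left G v)

/-- A generic point `x` moving in all directions of the quadric lies in no proper divisor. -/
lemma six_le_card {G : Matrix ι ι k} (hG : G.IsSymm) (hdet : IsUnit G.det)
    (hcard : 5 ≤ Fintype.card ι) {x : ι → Ω} (hx : bil G x x = 0) {f : MvPolynomial ι k} {l : ℕ}
    (hf : f.IsHomogeneous l) (hfx : aeval x f = 0)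
    (hne : ∃ v : ι → k, bil G v v = 0 ∧ eval v f ≠ 0) {d : Fin 4 → Derivation k Ω Ω}
    (hd : LinearIndependent Ω fun i => dv (d i) x) : 6 ≤ Fintype.card ι := by
  by_contra h0
  have hcard5 : Fintype.card ι = 5 := by omega
  have hdetΩ : IsUnit (G.map (algebraMap k Ω)).det := by
    rw [← RingHom.mapMatrix_apply, ← RingHom.map_det]; exact hdet.map _
  obtain ⟨v, hqv, hfv⟩ := hne
  apply hfv
  have hext0 : ext Ω (0 : ι → k) = 0 := by funext j; simp [ext]
  have hx0 : x ≠ 0 := by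
    rintro rfl
    exact hd.ne_zero 0 (by funext j; simp [dv])
  obtain ⟨r, hr⟩ : ∃ r, bil G x r ≠ 0 := by
    by_contra! hc
    exact hx0 (eq_zero_of_bil_eq_zero hG hdetΩ hc)
  have hxd (D : Derivation k Ω Ω) : bil G x (dv D x) = 0 := by
    have := dv_bil G D x x
    rw [hx, map_zero, bil_comm hG (dv D x)] at this
    have : (2 : Ω) * bil G x (dv D x) = 0 := by linear_combination -this
    exact (mul_eq_zero.mp this).resolve_left two_ne_zero
  -- In five variables x^⊥ has dimension four, so the variations of x fill it. A form vanishing at x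
  -- then has zero derivative in every direction of x^⊥, in particular along rotations.
  have hspan : Submodule.span Ω (Set.range fun i => dv (d i) x) = LinearMap.ker (bilLin G x) := by
    refine Submodule.eq_of_le_of_finrank_le ?_ ?_
    · rw [Submodule.span_le]
      rintro _ ⟨i, rfl⟩
      exact hxd (d i)
    · rw [finrank_span_eq_card hd, Fintype.card_fin]
      have h1 := LinearMap.finrank_range_add_finrank_ker (bilLin G x)
      have h2 : 0 < Module.finrank Ω (LinearMap.range (bilLin G x)) := by
        rw [Module.finrank_pos_iff, Submodule.nontrivial_iff_ne_bot, Ne, LinearMap.range_eq_bot]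
        intro h; exact hr (LinearMap.congr_fun h r)
      rw [Module.finrank_fintype_fun_eq_card] at h1
      omega
  have words (F) (hF : IsWord G 0 f F) : aeval x F = 0 := by
    induction hF with
    | base => exact hfx
    | step a a' F _ _ hF ih =>
      have hle : Submodule.span Ω (Set.range fun i => dv (d i) x) ≤ LinearMap.ker (gradLin F x) := by
        rw [Submodule.span_le]
        rintro _ ⟨i, rfl⟩
        have := derivation_aeval (d i) x F
        rw [ih, map_zero] at this
        exact this.symm
      rw [aeval_soD]
      refine hle ?_
      rw [hspan]
      exact bil_rotation_self hG (ext Ω a) (ext Ω a') x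
  exact eval_eq_zero_of_words hG hdet hcard hf words hx
    (by rw [hext0, bil_zero_left]) (by rw [hext0, bil_zero_left]) (r := r)
    (by rwa [bil_comm hG]) hqv (bil_zero_left G v)

end Generic

/-! ### Quadratic forms vanishing on isotropic vectors -/

section QuadraticForms

variable {k ι Ω : Type*} [Field k] [Fintype ι] [Field Ω] [CharZero Ω] [Algebra k Ω]

/-- A quadratic form of the shape `p₁ r₂ - p₂ r₁` vanishing on the isotropic vectors of a space
with a hyperbolic pair is proportional to the given quadratic form. -/
lemma exists_minor_eq_mul {G : Matrix ι ι k} (hG : G.IsSymm) {U : Submodule Ω (ι → Ω)}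
    {e f : ι → Ω} (he : e ∈ U) (hf : f ∈ U) (hee : bil G e e = 0) (hff : bil G f f = 0)
    (hef : bil G e f = 1) (p₁ p₂ r₁ r₂ : (ι → Ω) →ₗ[Ω] Ω)
    (h : ∀ u ∈ U, bil G u u = 0 → (∃ r ∈ U, bil G r r = 0 ∧ bil G r u ≠ 0) →
      p₁ u * r₂ u - p₂ u * r₁ u = 0) :
    ∃ a : Ω, ∀ u ∈ U, p₁ u * r₂ u - p₂ u * r₁ u = a * bil G u u := by
  have hfe : bil G f e = 1 := by rw [bil_comm hG, hef]
  have key (e f : ι → Ω) (he : e ∈ U) (hf : f ∈ U) (hee : bil G e e = 0) (hff : bil G f f = 0)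
      (hef : bil G e f = 1) (n) (hn : n ∈ U) (hne : bil G n e = 0) (hnf : bil G n f = 0) :
      p₁ e * r₂ n + p₁ n * r₂ e - p₂ e * r₁ n - p₂ n * r₁ e = 0 ∧
      2 * (p₁ n * r₂ n - p₂ n * r₁ n) =
        (p₁ e * r₂ f + p₁ f * r₂ e - p₂ e * r₁ f - p₂ f * r₁ e) * bil G n n := by
    have hfe : bil G f e = 1 := by rw [bil_comm hG, hef]
    have hP (τ : Ω) := h (e + τ • n - (τ ^ 2 * (bil G n n / 2)) • f)
      (U.sub_mem (U.add_mem he (U.smul_mem _ hn)) (U.smul_mem _ hf))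
      (by
        simp only [bil_add_left, bil_sub_left, bil_add_right, bil_sub_right, bil_smul_left,
          bil_smul_right, hee, hff, hef, hne, hnf, bil_comm hG e n, hfe, bil_comm hG f n]
        ring)
      ⟨f, hf, hff, by
        simp [bil_add_right, bil_sub_right, bil_smul_right, hff, hfe, bil_comm hG f n, hnf]⟩
    have he0 := h e he hee ⟨f, hf, hff, by rw [hfe]; exact one_ne_zero⟩
    have hf0 := h f hf hff ⟨e, he, hee, by rw [hef]; exact one_ne_zero⟩
    -- Along e + τn - τ²(q(n)/2)f the form is a quartic in τ whose extreme coefficients vanish by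
    -- `he0` and `hf0`; the values at 1, -1 and 2 determine the three others.
    have h1 := hP 1
    have h2 := hP (-1)
    have h3 := hP 2
    simp only [map_sub, map_add, map_smul, smul_eq_mul] at h1 h2 h3
    set q := bil G n n
    constructor
    · linear_combination (1 : Ω) * h1 - (1 / 3 : Ω) * h2 - (1 / 6 : Ω) * h3 - (1 / 2 : Ω) * he0 + q ^ 2 / 4 * hf0 * 2
    · linear_combination h1 + h2 - 2 * he0 - q ^ 2 / 2 * hf0
  have he0 := h e he hee ⟨f, hf, hff, by rw [hfe]; exact one_ne_zero⟩
  have hf0 := h f hf hff ⟨e, he, hee, by rw [hef]; exact one_ne_zero⟩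
  -- The factor is read off from the hyperbolic plane, where q(αe + βf) = 2αβ.
  refine ⟨(p₁ e * r₂ f + p₁ f * r₂ e - p₂ e * r₁ f - p₂ f * r₁ e) / 2, fun u hu => ?_⟩
  obtain ⟨n, hn⟩ : ∃ n, n = u - bil G u f • e - bil G u e • f := ⟨_, rfl⟩
  have hnU : n ∈ U := hn ▸ U.sub_mem (U.sub_mem hu (U.smul_mem _ he)) (U.smul_mem _ hf)
  have hne : bil G n e = 0 := by
    simp [hn, bil_sub_left, bil_smul_left, hee, hfe]
  have hnf : bil G n f = 0 := by
    simp [hn, bil_sub_left, bil_smul_left, hff, hef]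
  obtain ⟨k1, k2⟩ := key e f he hf hee hff hef n hnU hne hnf
  obtain ⟨k3, -⟩ := key f e hf he hff hee hfe n hnU hnf hne
  have hu' : u = bil G u f • e + bil G u e • f + n := by rw [hn]; abel
  generalize bil G u f = α at hu'
  generalize bil G u e = β at hu'
  have hq : bil G u u = 2 * α * β + bil G n n := by
    rw [hu']
    simp only [bil_add_left, bil_add_right, bil_smul_left, bil_smul_right, hee, hff, hef, hfe,
      hne, hnf, bil_comm hG e n, bil_comm hG f n]
    ring
  rw [hq, hu']
  simp only [map_add, map_smul, smul_eq_mul]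
  linear_combination α ^ 2 * he0 + β ^ 2 * hf0 + α * k1 + β * k3 + (1 / 2 : Ω) * k2

end QuadraticForms

/-! ### A plane ⟨x, c⟩ with degenerate first variation contains a constant vector -/

section MovingPlane

set_option linter.unusedSectionVars false

variable {k ι Ω : Type*} [Field k] [Fintype ι] [Field Ω] [CharZero Ω] [Algebra k Ω]

/-- The first variations of `x` along `D₁` and `D₂` are linearly independent modulo `x` and `c`. -/
def IndepVar (G : Matrix ι ι k) (x c : ι → Ω) (D₁ D₂ : Derivation k Ω Ω) : Prop :=
  ∀ a b : Ω, (∀ u, bil G x u = 0 → bil G c u = 0 →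
    a * bil G (dv D₁ x) u + b * bil G (dv D₂ x) u = 0) → a = 0 ∧ b = 0

/-- The minors of the first variation of `(x, c)` along `D₁` and `D₂` are proportional to the
quadratic form on the orthogonal complement of `x` and `c`. -/
def MinorsProp (G : Matrix ι ι k) (x c : ι → Ω) : Prop :=
  ∀ D₁ D₂ : Derivation k Ω Ω, ∃ a : Ω, ∀ u, bil G x u = 0 → bil G c u = 0 →
    bil G (dv D₁ x) u * bil G (dv D₂ c) u - bil G (dv D₂ x) u * bil G (dv D₁ c) u =
      a * bil G u u

variable {G : Matrix ι ι k} {x c : ι → Ω}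

/-- Polarization; the arguments below feed it the vectors x, D₁x and D₂x, where many pairings
vanish. -/
lemma minors_polar (hG : G.IsSymm) {p₁ p₂ r₁ r₂ : ι → Ω} {a : Ω}
    (h : ∀ u, bil G x u = 0 → bil G c u = 0 →
      bil G p₁ u * bil G r₂ u - bil G p₂ u * bil G r₁ u = a * bil G u u)
    {u v : ι → Ω} (hxu : bil G x u = 0) (hcu : bil G c u = 0) (hxv : bil G x v = 0)
    (hcv : bil G c v = 0) :
    bil G p₁ u * bil G r₂ v + bil G p₁ v * bil G r₂ u - bil G p₂ u * bil G r₁ v -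
      bil G p₂ v * bil G r₁ u = 2 * a * bil G u v := by
  have h1 := h (u + v) (by rw [bil_add_right, hxu, hxv, add_zero])
    (by rw [bil_add_right, hcu, hcv, add_zero])
  have h2 := h u hxu hcu
  have h3 := h v hxv hcv
  simp only [bil_add_right, bil_add_left, bil_comm hG v u] at h1
  linear_combination h1 - h2 - h3

/-- If `D` does not vary `x` independently of `D₁`, then `D + D₂` does. -/
lemma IndepVar.or_add {D₁ D₂ : Derivation k Ω Ω} (h : IndepVar G x c D₁ D₂)
    (D : Derivation k Ω Ω) : IndepVar G x c D₁ D ∨ IndepVar G x c D₁ (D + D₂) := by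
  by_contra! hc
  obtain ⟨h1, h2⟩ := hc
  unfold IndepVar at h1 h2
  push Not at h1 h2
  obtain ⟨a, b, hab, hne⟩ := h1
  obtain ⟨a', b', hab', hne'⟩ := h2
  have hb : b ≠ 0 := by
    rintro rfl
    obtain ⟨ha, -⟩ := h a 0 (by simpa using hab)
    exact hne ha rfl
  obtain ⟨e1, e2⟩ := h (a' * b - a * b') (b * b') fun u hx hc => by
    have i1 := hab u hx hc
    have i2 := hab' u hx hc
    rw [add_dv, bil_add_left] at i2
    linear_combination b * i2 - b' * i1
  have hb' : b' = 0 := (mul_eq_zero.mp e2).resolve_left hb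
  rw [hb', mul_zero, sub_zero] at e1
  exact hne' ((mul_eq_zero.mp e1).resolve_right hb) hb'

variable (hG : G.IsSymm) (hx : bil G x x = 0) (hcx : bil G c x = 0)
include hG hx

lemma bil_dv_self (D : Derivation k Ω Ω) : bil G x (dv D x) = 0 := by
  have := dv_bil G D x x
  rw [hx, map_zero, bil_comm hG (dv D x)] at this
  have : (2 : Ω) * bil G x (dv D x) = 0 := by linear_combination -this
  exact (mul_eq_zero.mp this).resolve_left two_ne_zero

include hcx

/-- The vector x lies in {x, c}^⊥, and is orthogonal to this space and to all Dx. Polarizing at x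
leaves b(D₂c, x) b(D₁x, v) = b(D₁c, x) b(D₂x, v), and independence kills both coefficients. -/
lemma bil_dv_eq_zero_of_indep (hP : MinorsProp G x c) {D₁ D₂ : Derivation k Ω Ω}
    (h : IndepVar G x c D₁ D₂) : bil G (dv D₁ c) x = 0 ∧ bil G (dv D₂ c) x = 0 := by
  obtain ⟨a, ha⟩ := hP D₁ D₂
  obtain ⟨e1, e2⟩ := h (bil G (dv D₂ c) x) (-bil G (dv D₁ c) x) fun v hxv hcv => by
    have := minors_polar hG ha hx hcx hxv hcv
    rw [bil_comm hG (dv D₁ x) x, bil_dv_self hG hx, bil_comm hG (dv D₂ x) x, bil_dv_self hG hx,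
      hxv] at this
    linear_combination this
  exact ⟨neg_eq_zero.mp e2, e1⟩

/-- The claim is additive in D, and `D` or `D + D₂` is independent of D₁. -/
lemma bil_dv_eq_zero (hP : MinorsProp G x c) {D₁ D₂ : Derivation k Ω Ω}
    (h : IndepVar G x c D₁ D₂) (D : Derivation k Ω Ω) : bil G (dv D c) x = 0 := by
  rcases h.or_add D with h' | h'
  · exact (bil_dv_eq_zero_of_indep hG hx hcx hP h').2
  · have h1 := (bil_dv_eq_zero_of_indep hG hx hcx hP h').2
    have h2 := (bil_dv_eq_zero_of_indep hG hx hcx hP h).2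
    rw [add_dv, bil_add_left] at h1
    linear_combination h1 - h2

/-- The symmetry of a second fundamental form: apply D₁ and D₂ to b(Dc, x) = 0 and use the same
vanishing for the bracket of D₁ and D₂. -/
lemma bil_dv_dv_comm (h : ∀ D : Derivation k Ω Ω, bil G (dv D c) x = 0)
    (D₁ D₂ : Derivation k Ω Ω) : bil G (dv D₁ c) (dv D₂ x) = bil G (dv D₂ c) (dv D₁ x) := by
  have h1 := dv_bil G D₁ (dv D₂ c) x
  have h2 := dv_bil G D₂ (dv D₁ c) x
  have h3 := h ⁅D₁, D₂⁆
  rw [lie_dv, bil_sub_left] at h3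
  rw [h, map_zero] at h1 h2
  linear_combination h1 - h2 + h3

/-- Polarizing at D₁x gives b(D₂c, D₁x) = 2a. If a ≠ 0, the value at D₂x, with the symmetry, makes
D₂x isotropic; polarizing at D₂x then gives b(D₂c, D₁x) = -2a, a contradiction. -/
lemma minor_coeff_eq_zero_of_isotropic (h : ∀ D : Derivation k Ω Ω, bil G (dv D c) x = 0)
    {D₁ D₂ : Derivation k Ω Ω} (hind : IndepVar G x c D₁ D₂) {a : Ω}
    (ha : ∀ u, bil G x u = 0 → bil G c u = 0 →
      bil G (dv D₁ x) u * bil G (dv D₂ c) u - bil G (dv D₂ x) u * bil G (dv D₁ c) u =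
        a * bil G u u)
    (h11 : bil G (dv D₁ x) (dv D₁ x) = 0) (h12 : bil G (dv D₁ x) (dv D₂ x) = 0) : a = 0 := by
  have hxd := bil_dv_self hG hx
  have hcd (D : Derivation k Ω Ω) : bil G c (dv D x) = 0 := by
    have := dv_bil G D c x
    rw [hcx, map_zero, h] at this
    linear_combination -this
  have hs := bil_dv_dv_comm hG hx hcx h D₁ D₂
  have h21 : bil G (dv D₂ x) (dv D₁ x) = 0 := by rw [bil_comm hG, h12]
  obtain ⟨e1, e2⟩ := hind (bil G (dv D₂ c) (dv D₁ x) - 2 * a) (-bil G (dv D₁ c) (dv D₁ x))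
    fun v hxv hcv => by
      have := minors_polar hG ha (hxd D₁) (hcd D₁) hxv hcv
      rw [h11, h21] at this
      linear_combination this
  have h22 := ha _ (hxd D₂) (hcd D₂)
  rw [h12, zero_mul, zero_sub, hs] at h22
  by_contra ha0
  have h22' : bil G (dv D₂ x) (dv D₂ x) = 0 := by
    have : 3 * a * bil G (dv D₂ x) (dv D₂ x) = 0 := by
      linear_combination -h22 - bil G (dv D₂ x) (dv D₂ x) * e1
    exact (mul_eq_zero.mp this).resolve_left (mul_ne_zero three_ne_zero ha0)
  obtain ⟨e3, e4⟩ := hind (bil G (dv D₂ c) (dv D₂ x)) (-bil G (dv D₂ c) (dv D₁ x) - 2 * a)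
    fun v hxv hcv => by
      have := minors_polar hG ha (hxd D₂) (hcd D₂) hxv hcv
      rw [h12, h22', hs] at this
      linear_combination this
  apply ha0
  have : (4 : Ω) * a = 0 := by linear_combination -e1 - e4
  exact (mul_eq_zero.mp this).resolve_left (by norm_num)

/-- If a ≠ 0, the values of the identity at D₁x, D₂x and its polarization make the Gram matrix of
these vectors singular. Then D₁x itself, or g₁₂D₁x - g₁₁D₂x, is isotropic and orthogonal to both,
and a change of the pair of derivations reduces to the isotropic case; it multiplies the minors by
g₁₁. -/
lemma minor_coeff_eq_zero (h : ∀ D : Derivation k Ω Ω, bil G (dv D c) x = 0)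
    {D₁ D₂ : Derivation k Ω Ω} (hind : IndepVar G x c D₁ D₂) {a : Ω}
    (ha : ∀ u, bil G x u = 0 → bil G c u = 0 →
      bil G (dv D₁ x) u * bil G (dv D₂ c) u - bil G (dv D₂ x) u * bil G (dv D₁ c) u =
        a * bil G u u) : a = 0 := by
  have hxd := bil_dv_self hG hx
  have hcd (D : Derivation k Ω Ω) : bil G c (dv D x) = 0 := by
    have := dv_bil G D c x
    rw [hcx, map_zero, h] at this
    linear_combination -this
  have hs := bil_dv_dv_comm hG hx hcx h D₁ D₂
  set g₁₁ := bil G (dv D₁ x) (dv D₁ x) with hg₁₁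
  set g₁₂ := bil G (dv D₁ x) (dv D₂ x) with hg₁₂
  set g₂₂ := bil G (dv D₂ x) (dv D₂ x) with hg₂₂
  have h21 : bil G (dv D₂ x) (dv D₁ x) = g₁₂ := by rw [bil_comm hG]
  have i11 := ha _ (hxd D₁) (hcd D₁)
  have i22 := ha _ (hxd D₂) (hcd D₂)
  have i12 := minors_polar hG ha (hxd D₁) (hcd D₁) (hxd D₂) (hcd D₂)
  rw [← hg₁₁, h21] at i11
  rw [← hg₁₂, ← hg₂₂, hs] at i22
  rw [← hg₁₁, ← hg₁₂, ← hg₂₂, h21, hs] at i12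
  by_contra ha0
  have hdet : g₁₂ ^ 2 = g₁₁ * g₂₂ := by
    have : 2 * a * (g₁₂ ^ 2 - g₁₁ * g₂₂) = 0 := by
      linear_combination (-g₁₂) * i12 + g₁₁ * i22 + g₂₂ * i11
    exact sub_eq_zero.mp ((mul_eq_zero.mp this).resolve_left (mul_ne_zero two_ne_zero ha0))
  by_cases h0 : g₁₁ = 0
  · have h12 : g₁₂ = 0 := by rw [h0, zero_mul] at hdet; exact pow_eq_zero_iff two_ne_zero |>.mp hdet
    exact ha0 (minor_coeff_eq_zero_of_isotropic hG hx hcx h hind ha h0 h12)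
  · refine mul_ne_zero h0 ha0 (minor_coeff_eq_zero_of_isotropic hG hx hcx h
      (D₁ := g₁₂ • D₁ - g₁₁ • D₂) (D₂ := D₁) ?_ (a := g₁₁ * a) ?_ ?_ ?_)
    · intro α β hαβ
      obtain ⟨e1, e2⟩ := hind (α * g₁₂ + β) (-(α * g₁₁)) fun u hxu hcu => by
        have := hαβ u hxu hcu
        rw [sub_dv, smul_dv, smul_dv, bil_sub_left, bil_smul_left, bil_smul_left] at this
        linear_combination this
      have hα : α = 0 := (mul_eq_zero.mp (neg_eq_zero.mp e2)).resolve_right h0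
      rw [hα, zero_mul, zero_add] at e1
      exact ⟨hα, e1⟩
    · intro u hxu hcu
      simp only [sub_dv, smul_dv, bil_sub_left, bil_smul_left]
      linear_combination g₁₁ * ha u hxu hcu
    · simp only [sub_dv, smul_dv, bil_sub_left, bil_smul_left, bil_sub_right, bil_smul_right,
        ← hg₁₁, ← hg₁₂, ← hg₂₂, h21]
      linear_combination (-g₁₁) * hdet
    · simp only [sub_dv, smul_dv, bil_sub_left, bil_smul_left, ← hg₁₁, h21]
      ring

omit hx hcx in
-- Independence provides v with p₁(v) ≠ 0 = p₂(v) and w with the roles exchanged. Polarizing at v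
-- computes r₂/p₂, polarizing at w computes r₁/p₁, and the two ratios agree at w.
lemma exists_smul_of_minors_eq_zero {p₁ p₂ r₁ r₂ : ι → Ω}
    (hind : ∀ a b : Ω, (∀ u, bil G x u = 0 → bil G c u = 0 →
      a * bil G p₁ u + b * bil G p₂ u = 0) → a = 0 ∧ b = 0)
    (h : ∀ u, bil G x u = 0 → bil G c u = 0 →
      bil G p₁ u * bil G r₂ u - bil G p₂ u * bil G r₁ u = 0) :
    ∃ μ : Ω, ∀ u, bil G x u = 0 → bil G c u = 0 →
      bil G r₁ u = μ * bil G p₁ u ∧ bil G r₂ u = μ * bil G p₂ u := by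
  have key (p₁ p₂ : ι → Ω) (hind : ∀ a b : Ω, (∀ u, bil G x u = 0 → bil G c u = 0 →
      a * bil G p₁ u + b * bil G p₂ u = 0) → a = 0 ∧ b = 0) :
      ∃ v, bil G x v = 0 ∧ bil G c v = 0 ∧ bil G p₁ v ≠ 0 ∧ bil G p₂ v = 0 := by
    by_contra! hc
    have hmem : bilLin G p₁ ∈ Submodule.span Ω (Set.range ![bilLin G x, bilLin G c, bilLin G p₂]) := by
      refine mem_span_of_iInf_ker_le_ker fun w hw => ?_
      rw [Submodule.mem_iInf] at hw
      by_contra hw1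
      exact hc w (hw 0) (hw 1) hw1 (hw 2)
    obtain ⟨a, ha⟩ := (Submodule.mem_span_range_iff_exists_fun Ω).mp hmem
    refine one_ne_zero (hind 1 (-a 2) fun u hxu hcu => ?_).1
    have := LinearMap.congr_fun ha u
    simp [Fin.sum_univ_three, hxu, hcu] at this
    rw [← this]; ring
  obtain ⟨v, hxv, hcv, hv1, hv2⟩ := key p₁ p₂ hind
  obtain ⟨w, hxw, hcw, hw2, hw1⟩ := key p₂ p₁ fun a b hab =>
    (hind b a fun u hx hc => by linear_combination hab u hx hc).symm
  have h' : ∀ u, bil G x u = 0 → bil G c u = 0 →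
      bil G p₁ u * bil G r₂ u - bil G p₂ u * bil G r₁ u = 0 * bil G u u := by simpa using h
  have hr2v : bil G r₂ v = 0 := by
    have := h v hxv hcv
    rw [hv2, zero_mul, sub_zero] at this
    exact (mul_eq_zero.mp this).resolve_left hv1
  have hr1w : bil G r₁ w = 0 := by
    have := h w hxw hcw
    rw [hw1, zero_mul, zero_sub, neg_eq_zero] at this
    exact (mul_eq_zero.mp this).resolve_left hw2
  have e1 (u) (hxu : bil G x u = 0) (hcu : bil G c u = 0) :
      bil G r₂ u = bil G r₁ v / bil G p₁ v * bil G p₂ u := by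
    have := minors_polar hG h' hxv hcv hxu hcu
    rw [hr2v, hv2] at this
    field_simp
    linear_combination this
  have e2 (u) (hxu : bil G x u = 0) (hcu : bil G c u = 0) :
      bil G r₁ u = bil G r₂ w / bil G p₂ w * bil G p₁ u := by
    have := minors_polar hG h' hxw hcw hxu hcu
    rw [hr1w, hw1] at this
    field_simp
    linear_combination -this
  have e3 : bil G r₂ w / bil G p₂ w = bil G r₁ v / bil G p₁ v := by
    rw [e1 w hxw hcw]
    field_simp
  exact ⟨_, fun u hxu hcu => ⟨by rw [e2 u hxu hcu, e3], e1 u hxu hcu⟩⟩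

/-- A moving plane `⟨x, c⟩` whose first variation has rank-one minors contains a fixed vector. -/
lemma exists_constant_vector [DecidableEq ι] (hdet : IsUnit (G.map (algebraMap k Ω)).det)
    (hconst : ∀ a : Ω, (∀ D : Derivation k Ω Ω, D a = 0) → ∃ b : k, algebraMap k Ω b = a)
    (hc : c ∉ Submodule.span Ω {x}) (hP : MinorsProp G x c) {D₁ D₂ : Derivation k Ω Ω}
    (hind : IndepVar G x c D₁ D₂) :
    ∃ (z : ι → k) (α β : Ω), β ≠ 0 ∧ ext Ω z = α • x + β • c := by
  have hr := bil_dv_eq_zero hG hx hcx hP hind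
  have hmin (D D' : Derivation k Ω Ω) (h : IndepVar G x c D D') : ∃ μ : Ω, ∀ u, bil G x u = 0 →
      bil G c u = 0 → bil G (dv D c) u = μ * bil G (dv D x) u ∧
        bil G (dv D' c) u = μ * bil G (dv D' x) u := by
    obtain ⟨a, ha⟩ := hP D D'
    obtain rfl := minor_coeff_eq_zero hG hx hcx hr h ha
    have ha' : ∀ u, bil G x u = 0 → bil G c u = 0 →
      bil G (dv D x) u * bil G (dv D' c) u - bil G (dv D' x) u * bil G (dv D c) u = 0 := by
      simpa using ha
    exact exists_smul_of_minors_eq_zero hG h ha'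
  obtain ⟨μ, hμ⟩ := hmin D₁ D₂ hind
  have hμ' (D D' : Derivation k Ω Ω) (h : IndepVar G x c D₁ D) : ∀ u, bil G x u = 0 →
      bil G c u = 0 → bil G (dv D c) u = μ * bil G (dv D x) u := by
    obtain ⟨μ', h'⟩ := hmin D₁ D h
    have : μ' - μ = 0 := (h (μ' - μ) 0 fun u hxu hcu => by
      linear_combination (hμ u hxu hcu).1 - (h' u hxu hcu).1).1
    rw [sub_eq_zero] at this
    exact fun u hxu hcu => this ▸ (h' u hxu hcu).2
  have hall (D : Derivation k Ω Ω) (u) (hxu : bil G x u = 0) (hcu : bil G c u = 0) :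
      bil G (dv D c) u = μ * bil G (dv D x) u := by
    rcases hind.or_add D with h | h
    · exact hμ' D D h u hxu hcu
    · have e1 := hμ' _ D h u hxu hcu
      have e2 := (hμ u hxu hcu).2
      rw [add_dv, add_dv, bil_add_left, bil_add_left] at e1
      linear_combination e1 - e2
  -- The multiple of x is removed so that every Dh becomes orthogonal to {x, c}^⊥, hence lies in ⟨x,
  -- c⟩ = ⟨x, h⟩.
  obtain ⟨h, hh⟩ : ∃ h, h = c - μ • x := ⟨_, rfl⟩
  have hbh (D : Derivation k Ω Ω) (u) (hxu : bil G x u = 0) (hcu : bil G c u = 0) :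
      bil G (dv D h) u = 0 := by
    rw [hh, dv_sub, dv_smul, bil_sub_left, bil_add_left, bil_smul_left, bil_smul_left, hxu,
      hall D u hxu hcu]
    ring
  have hdecomp (D : Derivation k Ω Ω) : ∃ ρ σ : Ω, dv D h = ρ • x + σ • h := by
    obtain ⟨a, ha⟩ := eq_sum_of_perp hG hdet (L := ![x, c]) (v := dv D h) fun y hy => by
      rw [mem_perp] at hy
      exact hbh D y (hy 0) (hy 1)
    refine ⟨a 0 + a 1 * μ, a 1, ?_⟩
    rw [ha, hh, Fin.sum_univ_two]
    simp only [Matrix.cons_val_zero, Matrix.cons_val_one]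
    module
  choose ρ σ hρσ using hdecomp
  -- Integrability: expanding the bracket of D and D' applied to h, with Dh = ρ(D)x + σ(D)h, gives a
  -- relation between Dx and D'x modulo ⟨x, c⟩, which forces ρ = 0.
  have hbr (D D' : Derivation k Ω Ω) (u) (hxu : bil G x u = 0) (hcu : bil G c u = 0) :
      ρ D' * bil G (dv D x) u - ρ D * bil G (dv D' x) u = 0 := by
    have h1 := hbh ⁅D, D'⁆ u hxu hcu
    have hhu : bil G h u = 0 := by rw [hh, bil_sub_left, bil_smul_left, hxu, hcu]; ring
    have e (D D' : Derivation k Ω Ω) : bil G (dv D (dv D' h)) u = ρ D' * bil G (dv D x) u := by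
      rw [hρσ D', dv_add, dv_smul, dv_smul]
      simp only [bil_add_left, bil_smul_left, hxu, hhu, hbh D u hxu hcu]
      ring
    rw [lie_dv, bil_sub_left, e, e] at h1
    exact h1
  have hρ1 : ρ D₁ = 0 := by
    have := hind (ρ D₂) (-ρ D₁) fun u hxu hcu => by linear_combination hbr D₁ D₂ u hxu hcu
    exact neg_eq_zero.mp this.2
  have hρ (D : Derivation k Ω Ω) : ρ D = 0 := by
    refine (hind (ρ D) 0 fun u hxu hcu => ?_).1
    have := hbr D₁ D u hxu hcu
    rw [hρ1] at this
    linear_combination this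
  have hh0 : h ≠ 0 := by
    intro h0
    rw [h0] at hh
    exact hc (Submodule.mem_span_singleton.mpr ⟨μ, (sub_eq_zero.mp hh.symm).symm⟩)
  obtain ⟨j, hj⟩ := Function.ne_iff.mp hh0
  rw [Pi.zero_apply] at hj
  -- Now Dh = σ(D)h, so the ratios of the coordinates of h are killed by all derivations and belong
  -- to `k`.
  have hz (i : ι) : ∃ b : k, algebraMap k Ω b = (h j)⁻¹ * h i := by
    refine hconst _ fun D => ?_
    have e (i) : D (h i) = σ D * h i := by
      have := congrFun (hρσ D) i
      rw [hρ] at this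
      simpa [dv] using this
    rw [Derivation.leibniz, Derivation.leibniz_inv, e, e]
    simp only [smul_eq_mul]
    field_simp
    ring
  choose z hz using hz
  refine ⟨z, -(h j)⁻¹ * μ, (h j)⁻¹, inv_ne_zero hj, ?_⟩
  funext i
  simp only [ext, hz, hh, Pi.sub_apply, Pi.smul_apply, smul_eq_mul, Pi.add_apply]
  ring

end MovingPlane

/-! ### Arcs on the quadric through a moving point -/

section Arcs

set_option linter.unusedSectionVars false

variable {k ι Ω : Type*} [Field k] [Fintype ι] [Field Ω] [CharZero Ω] [Algebra k Ω]

/-- For `r` orthogonal to `x`, the branch at `x` of the conic cut out on the quadric by the plane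
spanned by `x`, `r` and `w`. -/
def arc {R : Type*} [CommRing R] [Algebra k R] (G : Matrix ι ι k) (x r w : ι → R) :
    ι → Polynomial R := psi G (constVec x) (lineVec r w)

/-- Arcs are compatible with extensions of scalars. -/
lemma map_aeval_arc {R S : Type*} [CommRing R] [Algebra k R] [CommRing S] [Algebra k S]
    (G : Matrix ι ι k) (φ : R →ₐ[k] S) (x r w : ι → R) (f : MvPolynomial ι k) :
    (aeval (arc G x r w) f).map (φ : R →+* S) =
      aeval (arc G (fun j => φ (x j)) (fun j => φ (r j)) fun j => φ (w j)) f := by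
  have h1 := map_aeval_apply (Polynomial.mapAlgHom φ) (arc G x r w) f
  have h2 : (fun j => Polynomial.mapAlgHom φ (arc G x r w j)) =
      arc G (fun j => φ (x j)) (fun j => φ (r j)) fun j => φ (w j) := by
    funext j
    simp only [arc, psi, Pi.sub_apply, Pi.smul_apply, smul_eq_mul, map_sub, map_mul, map_ofNat,
      map_bil]
    unfold lineVec constVec
    simp
  rw [h2] at h1
  exact h1

lemma coeff_aeval_arc {R S : Type*} [CommRing R] [Algebra k R] [CommRing S] [Algebra k S]
    (G : Matrix ι ι k) (φ : R →ₐ[k] S) (x r w : ι → R) (f : MvPolynomial ι k) (e : ℕ) :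
    φ ((aeval (arc G x r w) f).coeff e) =
      (aeval (arc G (fun j => φ (x j)) (fun j => φ (r j)) fun j => φ (w j)) f).coeff e := by
  rw [← map_aeval_arc, Polynomial.coeff_map]
  rfl

lemma bil_const_const (G : Matrix ι ι k) (x y : ι → Ω) :
    bil G (constVec x) (constVec y) = Polynomial.C (bil G x y) := by
  simpa using! (map_bil (G := G) (Algebra.ofId Ω (Polynomial Ω) |>.restrictScalars k) x y).symm

lemma lineVec_eq (r w : ι → Ω) :
    lineVec r w = constVec r + (Polynomial.X : Polynomial Ω) • constVec w := by
  funext j; simp [lineVec, constVec]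

/-- On an arc tangent to an isotropic direction, the parameter can be cancelled. -/
lemma arc_of_isotropic {G : Matrix ι ι k} (hG : G.IsSymm) {x r : ι → Ω} (hxr : bil G x r = 0)
    (hr : bil G r r = 0) (w : ι → Ω) : arc G x r w = (Polynomial.X : Polynomial Ω) •
      ((2 * Polynomial.C (bil G x w)) • lineVec r w -
        (2 * Polynomial.C (bil G r w) + Polynomial.X * Polynomial.C (bil G w w)) • constVec x) := by
  funext j
  simp only [arc, psi, lineVec_eq, bil_add_right, bil_add_left, bil_smul_right, bil_smul_left,
    bil_const_const, hxr, hr, bil_comm hG w r, Pi.sub_apply, Pi.smul_apply, Pi.add_apply,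
    smul_eq_mul, map_zero]
  ring

/-- The arc starts at the point x when r is anisotropic; for isotropic r this value is zero and a
factor t splits off. -/
lemma eval_arc_zero {G : Matrix ι ι k} {x r : ι → Ω} (hxr : bil G x r = 0) (w : ι → Ω) :
    (fun j => (arc G x r w j).eval 0) = (-bil G r r) • x := by
  have h : (fun j => (arc G x r w j).eval 0) = psi G x r := by
    simp only [arc, eval_psi, eval_constVec, eval_lineVec, zero_smul, add_zero]
  rw [h, psi, hxr]
  simp

/-- Contact of order exactly two with the section z^⊥ when the coefficient is nonzero: removing one
copy of the section costs 2 in order and 1 in degree. -/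
lemma bil_arc {G : Matrix ι ι k} {x r z : ι → Ω} (hxr : bil G x r = 0)
    (hzr : bil G z r = 0) (hzx : bil G z x = 0) (w : ι → Ω) :
    bil G (constVec z) (arc G x r w) =
      Polynomial.C (2 * bil G x w * bil G z w) * Polynomial.X ^ 2 := by
  simp only [arc, psi, lineVec_eq, bil_add_right, bil_sub_right, bil_smul_right,
    bil_const_const, hxr, hzr, hzx, map_zero, map_mul]
  simp only [Polynomial.C_ofNat]
  ring

variable {G : Matrix ι ι k} {x c : ι → Ω}

lemma mem_span_of_orthogonal [DecidableEq ι] (hG : G.IsSymm)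
    (hdet : IsUnit (G.map (algebraMap k Ω)).det) {v : ι → Ω}
    (h : ∀ y, bil G x y = 0 → bil G c y = 0 → bil G v y = 0) : v ∈ Submodule.span Ω {x, c} := by
  obtain ⟨a, ha⟩ := eq_sum_of_perp hG hdet (L := ![x, c]) (v := v) fun y hy => by
    rw [mem_perp] at hy
    exact h y (hy 0) (hy 1)
  rw [Submodule.mem_span_pair]
  exact ⟨a 0, a 1, by rw [ha, Fin.sum_univ_two]; rfl⟩

lemma finrank_span_pair_le (x c : ι → Ω) : Module.finrank Ω (Submodule.span Ω {x, c}) ≤ 2 := by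
  classical
  have := finrank_span_le_card (R := Ω) ({x, c} : Set (ι → Ω))
  refine this.trans ?_
  rw [Set.toFinset_insert, Set.toFinset_singleton]
  exact (Finset.card_insert_le _ _).trans (by simp)

lemma exists_bil_ne_zero₂ (hx : ∃ w, bil G x w ≠ 0) (hc : ∃ w, bil G c w ≠ 0) :
    ∃ w, bil G x w ≠ 0 ∧ bil G c w ≠ 0 := by
  obtain ⟨w₁, h₁⟩ := hx
  obtain ⟨w₂, h₂⟩ := hc
  by_cases e1 : bil G c w₁ = 0
  · by_cases e2 : bil G x w₂ = 0
    · exact ⟨w₁ + w₂, by rwa [bil_add_right, e2, add_zero], by rwa [bil_add_right, e1, zero_add]⟩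
    · exact ⟨w₂, e2, h₂⟩
  · exact ⟨w₁, h₁, e1⟩

/-- The order of vanishing condition of a form `g` along the arcs at `x`. -/
def ArcOrder (G : Matrix ι ι k) (x c : ι → Ω) (g : MvPolynomial ι k) (e : ℕ) : Prop :=
  ∀ r w, bil G x r = 0 → bil G c r = 0 → bil G x w ≠ 0 → bil G c w ≠ 0 →
    (Polynomial.X : Polynomial Ω) ^ e ∣ aeval (arc G x r w) g

/-- A form vanishing at `x` to an order exceeding its degree vanishes on the cone. -/
lemma aeval_eq_zero_of_arcOrder [DecidableEq ι] (hG : G.IsSymm)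
    (hdet : IsUnit (G.map (algebraMap k Ω)).det) (hx0 : x ≠ 0) (hc0 : c ≠ 0)
    {g : MvPolynomial ι k} {l e : ℕ} (hg : g.IsHomogeneous l) (hle : l < e)
    (h : ArcOrder G x c g e) {r u : ι → Ω} (hr : InCone G x c r) (hu : InCone G x c u)
    (hru : bil G r u ≠ 0) : aeval u g = 0 := by
  -- The vector w must be orthogonal to u, so that the arc divided by t starts at a multiple of u,
  -- but not to x or c. This is possible since x and c, being orthogonal to r while u is not, are
  -- not multiples of u.
  have key {y : ι → Ω} (hy : y ≠ 0) (hyr : bil G y r = 0) :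
      ∃ w, bil G u w = 0 ∧ bil G y w ≠ 0 := by
    by_contra! hc
    obtain ⟨a, ha⟩ := eq_sum_of_perp hG hdet (L := ![u]) (v := y) fun w hw =>
      hc w (mem_perp.mp hw 0)
    simp at ha
    rw [ha, bil_smul_left, bil_comm hG u] at hyr
    have ha0 := (mul_eq_zero.mp hyr).resolve_right hru
    exact hy (by rw [ha, ha0, zero_smul])
  obtain ⟨w, huw, hxw, hcw⟩ : ∃ w, bil G u w = 0 ∧ bil G x w ≠ 0 ∧ bil G c w ≠ 0 := by
    obtain ⟨w₁, a1, h1⟩ := key hx0 hr.left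
    obtain ⟨w₂, a2, h2⟩ := key hc0 hr.right
    by_cases e1 : bil G c w₁ = 0
    · by_cases e2 : bil G x w₂ = 0
      · exact ⟨w₁ + w₂, by rw [bil_add_right, a1, a2, add_zero],
          by rwa [bil_add_right, e2, add_zero], by rwa [bil_add_right, e1, zero_add]⟩
      · exact ⟨w₂, a2, e2, h2⟩
    · exact ⟨w₁, a1, h1, e1⟩
  have h1 := h u w hu.left hu.right hxw hcw
  rw [arc_of_isotropic hG hu.left hu.self, aeval_smul_of_isHomogeneous hg] at h1
  -- The form takes out exactly t to the power `l`; a positive power of t is left to divide its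
  -- value on the remaining curve.
  obtain ⟨s, rfl⟩ := Nat.exists_eq_add_of_lt hle
  rw [add_assoc, pow_add] at h1
  have h2 := (dvd_pow_self (Polynomial.X : Polynomial Ω) (Nat.succ_ne_zero s)).trans
    ((mul_dvd_mul_iff_left (pow_ne_zero l Polynomial.X_ne_zero)).mp h1)
  rw [Polynomial.X_dvd_iff, Polynomial.coeff_zero_eq_eval_zero, eval_aeval] at h2
  have h3 : (fun j => Polynomial.eval 0 (((2 * Polynomial.C (bil G x w)) • lineVec u w -
        (2 * Polynomial.C (bil G u w) + Polynomial.X * Polynomial.C (bil G w w)) •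
          constVec x) j)) = (2 * bil G x w) • u := by
    funext j
    simp [lineVec, constVec, huw]
  rw [h3, aeval_smul_of_isHomogeneous hg] at h2
  exact (mul_eq_zero.mp h2).resolve_left (pow_ne_zero _ (mul_ne_zero two_ne_zero hxw))

/-- If {x, c}^⊥ were totally isotropic it would be contained in ⟨x, c⟩, but its dimension is at
least three. -/
lemma exists_anisotropic [DecidableEq ι] (hG : G.IsSymm)
    (hdet : IsUnit (G.map (algebraMap k Ω)).det) (hcard : 5 ≤ Fintype.card ι) (x c : ι → Ω) :
    ∃ r, bil G x r = 0 ∧ bil G c r = 0 ∧ bil G r r ≠ 0 := by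
  by_contra! hcon
  have hle : perp G ![x, c] ≤ Submodule.span Ω {x, c} := by
    intro v hv
    have hv' := mem_perp.mp hv
    have hxv : bil G x v = 0 := hv' 0
    have hcv : bil G c v = 0 := hv' 1
    refine mem_span_of_orthogonal hG hdet fun y hxy hcy => ?_
    have := hcon (v + y) (by rw [bil_add_right, hxv, hxy, add_zero])
      (by rw [bil_add_right, hcv, hcy, add_zero])
    simp only [bil_add_left, bil_add_right, hcon v hxv hcv, hcon y hxy hcy,
      bil_comm hG y v] at this
    have h2 : (2 : Ω) * bil G v y = 0 := by linear_combination this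
    exact (mul_eq_zero.mp h2).resolve_left two_ne_zero
  have h1 := Submodule.finrank_mono hle
  have h2 := card_le_finrank_perp G ![x, c]
  have h3 := finrank_span_pair_le x c
  omega

lemma aeval_self_eq_zero_of_arcOrder [DecidableEq ι] (hG : G.IsSymm)
    (hdet : IsUnit (G.map (algebraMap k Ω)).det) (hcard : 5 ≤ Fintype.card ι) (hx0 : x ≠ 0)
    (hc0 : c ≠ 0) {g : MvPolynomial ι k} {l e : ℕ} (hg : g.IsHomogeneous l) (he : 0 < e)
    (h : ArcOrder G x c g e) : aeval x g = 0 := by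
  obtain ⟨r, hxr, hcr, hrr⟩ := exists_anisotropic hG hdet hcard x c
  have hne {y : ι → Ω} (hy : y ≠ 0) : ∃ w, bil G y w ≠ 0 := by
    by_contra! hcon
    exact hy (eq_zero_of_bil_eq_zero hG hdet hcon)
  obtain ⟨w, hxw, hcw⟩ := exists_bil_ne_zero₂ (hne hx0) (hne hc0)
  have h1 := (dvd_pow_self _ he.ne').trans (h r w hxr hcr hxw hcw)
  rw [Polynomial.X_dvd_iff, Polynomial.coeff_zero_eq_eval_zero, eval_aeval, eval_arc_zero hxr,
    aeval_smul_of_isHomogeneous hg] at h1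
  exact (mul_eq_zero.mp h1).resolve_left (pow_ne_zero _ (neg_ne_zero.mpr hrr))

/-- A hyperbolic pair orthogonal to `x` and `c`. -/
lemma exists_hyperbolic_pair_perp [IsAlgClosed Ω] [DecidableEq ι] (hG : G.IsSymm)
    (hdet : IsUnit (G.map (algebraMap k Ω)).det) (hcard : 6 ≤ Fintype.card ι) (x c : ι → Ω) :
    ∃ e ∈ perp G ![x, c], ∃ f ∈ perp G ![x, c],
      bil G e e = 0 ∧ bil G f f = 0 ∧ bil G e f = 1 := by
  refine exists_hyperbolic_pair hG (R := Submodule.span Ω {x, c}) (fun v _ h =>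
    mem_span_of_orthogonal hG hdet fun y hxy hcy => h y (mem_perp.mpr ?_)) ?_
  · simp [Fin.forall_fin_two, hxy, hcy]
  -- With six variables the complement has dimension at least four, while its radical lies in ⟨x,
  -- c⟩, of dimension at most two.
  · have h2 := card_le_finrank_perp G ![x, c]
    have h3 := finrank_span_pair_le x c
    omega

/-- Derivations form an Ω-vector space, so every vector of the four-dimensional span is of the form
Dx; modulo the plane ⟨x, c⟩ at least two dimensions remain. -/
lemma exists_indepVar [DecidableEq ι] (hG : G.IsSymm)
    (hdet : IsUnit (G.map (algebraMap k Ω)).det) {d : Fin 4 → Derivation k Ω Ω}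
    (hd : LinearIndependent Ω fun i => dv (d i) x) : ∃ D₁ D₂, IndepVar G x c D₁ D₂ := by
  set S := Submodule.span Ω (Set.range fun i => dv (d i) x) with hS
  have hSD (s) (hs : s ∈ S) : ∃ D : Derivation k Ω Ω, dv D x = s := by
    induction hs using Submodule.span_induction with
    | mem s hs => obtain ⟨i, rfl⟩ := hs; exact ⟨_, rfl⟩
    | zero => exact ⟨0, by funext j; simp [dv]⟩
    | add s s' _ _ h h' =>
      obtain ⟨D, rfl⟩ := h
      obtain ⟨D', rfl⟩ := h'
      exact ⟨D + D', add_dv _ _ _⟩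
    | smul a s _ h =>
      obtain ⟨D, rfl⟩ := h
      exact ⟨a • D, smul_dv _ _ _⟩
  have hS4 : Module.finrank Ω S = 4 := by rw [hS, finrank_span_eq_card hd, Fintype.card_fin]
  have hL := finrank_span_pair_le x c
  obtain ⟨s₁, hs₁, h₁⟩ := exists_mem_notMem_of_finrank_lt (U := S) (R := Submodule.span Ω {x, c})
    (by omega)
  obtain ⟨s₂, hs₂, h₂⟩ := exists_mem_notMem_of_finrank_lt (U := S)
    (R := Submodule.span Ω {x, c} ⊔ Submodule.span Ω {s₁}) (by
      have h4 := Submodule.finrank_add_le_finrank_add_finrank (Submodule.span Ω {x, c})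
        (Submodule.span Ω {s₁})
      have h5 : Module.finrank Ω (Submodule.span Ω {s₁}) ≤ 1 :=
        (finrank_span_le_card ({s₁} : Set (ι → Ω))).trans (by simp)
      omega)
  obtain ⟨D₁, rfl⟩ := hSD s₁ hs₁
  obtain ⟨D₂, rfl⟩ := hSD s₂ hs₂
  refine ⟨D₁, D₂, fun a b hab => ?_⟩
  have hmem : a • dv D₁ x + b • dv D₂ x ∈ Submodule.span Ω {x, c} := by
    refine mem_span_of_orthogonal hG hdet fun y hxy hcy => ?_
    rw [bil_add_left, bil_smul_left, bil_smul_left, hab y hxy hcy]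
  have hb : b = 0 := by
    by_contra hb
    apply h₂
    have : dv D₂ x = b⁻¹ • (a • dv D₁ x + b • dv D₂ x) - (b⁻¹ * a) • dv D₁ x := by
      rw [smul_add, smul_smul, smul_smul, inv_mul_cancel₀ hb, one_smul]; abel
    rw [this]
    exact Submodule.sub_mem _ (Submodule.mem_sup_left (Submodule.smul_mem _ _ hmem))
      (Submodule.mem_sup_right (Submodule.smul_mem _ _ (Submodule.mem_span_singleton_self _)))
  refine ⟨?_, hb⟩
  by_contra ha
  apply h₁
  rw [hb, zero_smul, add_zero] at hmem
  simpa [smul_smul, ha] using Submodule.smul_mem _ a⁻¹ hmem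

variable [CharZero k] [IsAlgClosed k] [IsAlgClosed Ω] [DecidableEq ι]

/-- A form vanishing to a high order along the arcs tangent to the moving hyperplane `c` at a
moving point `x` of the quadric forces `c` to be cut out by a fixed hyperplane. -/
theorem exists_hyperplane_of_arcOrder (hG : G.IsSymm) (hdet : IsUnit G.det)
    (hcard : 5 ≤ Fintype.card ι) (hx : bil G x x = 0) (hcx : bil G c x = 0)
    (hc : c ∉ Submodule.span Ω {x})
    (hconst : ∀ a : Ω, (∀ D : Derivation k Ω Ω, D a = 0) → ∃ b : k, algebraMap k Ω b = a)
    {d : Fin 4 → Derivation k Ω Ω} (hd : LinearIndependent Ω fun i => dv (d i) x)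
    {f : MvPolynomial ι k} {l e : ℕ} (hf : f.IsHomogeneous l) (hle : l < e)
    (hord : ArcOrder G x c f e) (hne : ∃ v : ι → k, bil G v v = 0 ∧ eval v f ≠ 0) :
    6 ≤ Fintype.card ι ∧ ∃ (z : ι → k) (α β : Ω), β ≠ 0 ∧ ext Ω z = α • x + β • c := by
  have hdetΩ : IsUnit (G.map (algebraMap k Ω)).det := by
    rw [← RingHom.mapMatrix_apply, ← RingHom.map_det]; exact hdet.map _
  have hx0 : x ≠ 0 := by
    rintro rfl
    exact hd.ne_zero 0 (by funext j; simp [dv])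
  have hc0 : c ≠ 0 := by
    rintro rfl
    exact hc (Submodule.zero_mem _)
  have h6 : 6 ≤ Fintype.card ι := six_le_card hG hdet hcard hx hf
    (aeval_self_eq_zero_of_arcOrder hG hdetΩ hcard hx0 hc0 hf (by omega) hord) hne hd
  refine ⟨h6, ?_⟩
  obtain ⟨e₁, he₁, f₁, hf₁, hee, hff, hef⟩ := exists_hyperbolic_pair_perp hG hdetΩ h6 x c
  have memU {y : ι → Ω} : y ∈ perp G ![x, c] ↔ bil G x y = 0 ∧ bil G c y = 0 := by
    simp [mem_perp, Fin.forall_fin_two]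
  -- The minors vanish on the isotropic vectors of {x, c}^⊥ that are not orthogonal to some
  -- isotropic vector there; the hyperbolic pair turns this into proportionality to q.
  have hP : MinorsProp G x c := by
    intro D₁ D₂
    obtain ⟨a, ha⟩ := exists_minor_eq_mul hG he₁ hf₁ hee hff hef (bilLin G (dv D₁ x))
      (bilLin G (dv D₂ x)) (bilLin G (dv D₁ c)) (bilLin G (dv D₂ c)) (by
        rintro u hu huu ⟨r, hr, hrr, hru⟩
        rw [memU] at hu hr
        exact minor_eq_zero hG hdet hcard hf (fun r u hr hu hru =>
          aeval_eq_zero_of_arcOrder hG hdetΩ hx0 hc0 hf hle hord hr hu hru) hne D₁ D₂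
          ⟨hr.1, hr.2, hrr⟩ ⟨hu.1, hu.2, huu⟩ hru)
    exact ⟨a, fun u hxu hcu => ha u (memU.mpr ⟨hxu, hcu⟩)⟩
  obtain ⟨D₁, D₂, hind⟩ := exists_indepVar (c := c) hG hdetΩ hd
  exact exists_constant_vector hG hx hcx hdetΩ hconst hc hP hind

/-- A form vanishing to a high order along the arcs in a fixed hyperplane section of the quadric
vanishes on this section. -/
theorem eval_eq_zero_of_arcOrder (hG : G.IsSymm) (hdet : IsUnit G.det)
    (hcard : 6 ≤ Fintype.card ι) {z : ι → k} (hz : z ≠ 0)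
    {d : Fin 4 → Derivation k Ω Ω} (hd : LinearIndependent Ω fun i => dv (d i) x)
    {f : MvPolynomial ι k} {l e : ℕ} (hf : f.IsHomogeneous l) (hle : l < e)
    (hord : ArcOrder G x (ext Ω z) f e) {v : ι → k} (hqv : bil G v v = 0) (hzv : bil G z v = 0) :
    eval v f = 0 := by
  have hdetΩ : IsUnit (G.map (algebraMap k Ω)).det := by
    rw [← RingHom.mapMatrix_apply, ← RingHom.map_det]; exact hdet.map _
  have hx0 : x ≠ 0 := by
    rintro rfl
    exact hd.ne_zero 0 (by funext j; simp [dv])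
  have hz0 : ext Ω z ≠ 0 := by
    intro h0
    apply hz
    funext j
    have := congrFun h0 j
    simpa [ext] using this
  obtain ⟨e₁, he₁, f₁, hf₁, hee, hff, hef⟩ :=
    exists_hyperbolic_pair_perp hG hdetΩ hcard x (ext Ω z)
  have memU {y : ι → Ω} : y ∈ perp G ![x, ext Ω z] ↔
      bil G x y = 0 ∧ bil G (ext Ω z) y = 0 := by
    simp [mem_perp, Fin.forall_fin_two]
  obtain ⟨D₁, D₂, hind⟩ := exists_indepVar (c := ext Ω z) hG hdetΩ hd
  obtain ⟨h, hh, hDh⟩ : ∃ h ∈ perp G ![x, ext Ω z], bilLin G (dv D₁ x) h ≠ 0 := by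
    by_contra! hcon
    refine one_ne_zero (hind 1 0 fun u hxu hcu => ?_).1
    rw [one_mul, zero_mul, add_zero]
    exact hcon u (memU.mpr ⟨hxu, hcu⟩)
  obtain ⟨u, hu, huu, hDu, r, hr, hrr, hru⟩ :=
    exists_isotropic_apply_ne_zero hG he₁ hf₁ hee hff hef (bilLin G (dv D₁ x)) hh hDh
  rw [memU] at hu hr
  have hr' : InCone G x (ext Ω z) r := ⟨hr.1, hr.2, hrr⟩
  have hu' : InCone G x (ext Ω z) u := ⟨hu.1, hu.2, huu⟩
  have hDz : dv D₁ (ext Ω z) = 0 := by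
    funext j
    simp [dv, ext]
  -- As z is constant, the first-variation relation reduces to α b(D₁x, u) = 0, so α = 0 at general
  -- points of the cone. The β-term is harmless, because only rotations preserving z are used.
  have words (F) (hF : IsWord G z f F) :
      ∀ u, InCone G x (ext Ω z) u → bil G r u ≠ 0 → aeval u F = 0 := by
    induction hF with
    | base => exact fun u hu hru =>
        aeval_eq_zero_of_arcOrder hG hdetΩ hx0 hz0 hf hle hord hr' hu hru
    | step a a' F hza hza' hF ih =>
      intro u₁ hu₁ hru₁
      have hE (u : ι → Ω) : eval u (bil G (fun j => C (dv D₁ x j)) X : MvPolynomial ι Ω) =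
          bil G (dv D₁ x) u := by
        have := map_bil (G := G) ((aeval u : MvPolynomial ι Ω →ₐ[Ω] Ω).restrictScalars k)
          (fun j => C (dv D₁ x j)) X
        simpa [aeval_eq_eval] using this
      have hEhom : (bil G (fun j => C (dv D₁ x j)) X : MvPolynomial ι Ω).IsHomogeneous 1 := by
        refine IsHomogeneous.sum _ _ _ fun j _ => IsHomogeneous.sum _ _ _ fun i _ => ?_
        rw [IsScalarTower.algebraMap_apply k Ω (MvPolynomial ι Ω), algebraMap_eq, ← C_mul]
        exact isHomogeneous_C_mul_X _ _
      refine aeval_eq_zero_of_dichotomy hG hr' (soD_isHomogeneous G a a' (hF.isHomogeneous hf)) ?_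
        ⟨u, hu', hru, by rwa [hE]⟩ hEhom hu₁ hru₁
      intro u hu hru hmin
      rw [hE] at hmin
      obtain ⟨α, β, γ, hgrad⟩ := exists_grad_eq hG hr' (hF.isHomogeneous hf) ih hu hru
      have e₁ := grad_relation hG (ih u hu hru) hu hgrad D₁
      rw [hDz, bil_zero_left, mul_zero, add_zero] at e₁
      have hα : α = 0 := (mul_eq_zero.mp e₁).resolve_right hmin
      have h1 : bil G (ext Ω z) (ext Ω a) = 0 := by rw [bil_ext, hza, map_zero]
      have h2 : bil G (ext Ω z) (ext Ω a') = 0 := by rw [bil_ext, hza', map_zero]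
      rw [aeval_soD, hgrad, hα, bil_rotation_self hG, bil_sub_right G (ext Ω z), bil_smul_right,
        bil_smul_right, h1, h2]
      ring
  exact eval_eq_zero_of_words hG hdet (by omega) hf (fun F hF => words F hF u hu' hru) huu hu.2
    hr.2 hru hqv hzv

end Arcs

/-! ### Derivations of fields of characteristic zero -/

section FieldDerivations

/-- Derivations extend uniquely along formally étale extensions. -/
lemma exists_derivation_extending {k S T : Type*} [CommRing k] [CommRing S] [CommRing T]
    [Algebra k S] [Algebra k T] [Algebra S T] [IsScalarTower k S T] [Algebra.FormallyEtale S T]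
    (d : Derivation k S T) : ∃ D : Derivation k T T, ∀ s, D (algebraMap S T s) = d s := by
  let e := KaehlerDifferential.tensorKaehlerEquivOfFormallyEtale k S T
  refine ⟨(d.liftKaehlerDifferential.liftBaseChange T ∘ₗ
    e.symm.toLinearMap).compDer (KaehlerDifferential.D k T), fun s => ?_⟩
  have h := KaehlerDifferential.tensorKaehlerEquivOfFormallyEtale_symm_D_algebraMap k S T s
  simp [e, h]

lemma derivation_sum_apply {k Ω σ : Type*} [CommRing k] [CommRing Ω] [Algebra k Ω]
    (s : Finset σ) (D : σ → Derivation k Ω Ω) (a : Ω) : (∑ i ∈ s, D i) a = ∑ i ∈ s, D i a := by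
  classical
  induction s using Finset.induction_on with
  | empty => simp
  | insert i s hi ih => rw [Finset.sum_insert hi, Finset.sum_insert hi, Derivation.add_apply, ih]

/-- Derivations of a field of characteristic zero take arbitrary values on algebraically
independent elements. -/
lemma exists_derivation_apply_eq {k Ω σ : Type*} [Field k] [CharZero k] [Field Ω] [Algebra k Ω]
    {y : σ → Ω} (hy : AlgebraicIndependent k y) (a : σ → Ω) :
    ∃ D : Derivation k Ω Ω, ∀ i, D (y i) = a i := by
  classical
  -- Over a transcendence basis containing `y`, the field Ω is separable algebraic over a rational
  -- function field, hence formally étale over the polynomial ring; so derivations with prescribed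
  -- values on the variables extend. The value 0 on the other basis elements is arbitrary.
  obtain ⟨s, hs, htr⟩ := exists_isTranscendenceBasis_superset hy.coe_range
  let v : s → Ω := (↑)
  have hv : AlgebraicIndependent k v := htr.1
  let _ : Algebra (MvPolynomial s k) Ω := (aeval v).toRingHom.toAlgebra
  have hmap (p : MvPolynomial s k) : algebraMap (MvPolynomial s k) Ω p = aeval v p := rfl
  have : IsScalarTower k (MvPolynomial s k) Ω :=
    IsScalarTower.of_algebraMap_eq fun r => by rw [hmap, algebraMap_eq, aeval_C]
  have : FaithfulSMul (MvPolynomial s k) Ω :=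
    (faithfulSMul_iff_algebraMap_injective _ _).mpr hv
  let _ : Algebra (FractionRing (MvPolynomial s k)) Ω := FractionRing.liftAlgebra _ _
  have := FractionRing.isScalarTower_liftAlgebra (MvPolynomial s k) Ω
  have : Algebra.IsAlgebraic (MvPolynomial s k) Ω := by
    have := htr.isAlgebraic
    refine Algebra.IsAlgebraic.ringHom_of_comp_eq (R := Algebra.adjoin k (Set.range v)) (A := Ω)
      (hv.aevalEquiv.symm : _ →+* _) (RingHom.id Ω) hv.aevalEquiv.symm.injective
      Function.surjective_id ?_
    ext p
    obtain ⟨p, rfl⟩ := hv.aevalEquiv.surjective p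
    simp [hmap]
  have : Algebra.IsAlgebraic (FractionRing (MvPolynomial s k)) Ω :=
    (IsFractionRing.comap_isAlgebraic_iff (A := MvPolynomial s k)).mp inferInstance
  have : CharZero (FractionRing (MvPolynomial s k)) :=
    charZero_of_injective_algebraMap (algebraMap k _).injective
  have : Algebra.FormallyEtale (FractionRing (MvPolynomial s k)) Ω :=
    Algebra.FormallyEtale.of_isSeparable _ _
  have : Algebra.FormallyEtale (MvPolynomial s k) (FractionRing (MvPolynomial s k)) :=
    Algebra.FormallyEtale.of_isLocalization (nonZeroDivisors (MvPolynomial s k))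
  have : Algebra.FormallyEtale (MvPolynomial s k) Ω :=
    Algebra.FormallyEtale.comp _ (FractionRing (MvPolynomial s k)) _
  have hinj := hy.injective
  obtain ⟨D, hD⟩ := exists_derivation_extending (k := k) (T := Ω)
    (mkDerivation k fun i : s => if h : ∃ j, y j = i then a h.choose else 0)
  refine ⟨D, fun i => ?_⟩
  have := hD (X ⟨y i, hs ⟨i, rfl⟩⟩)
  rw [hmap, aeval_X, mkDerivation_X] at this
  rw [show y i = v ⟨y i, hs ⟨i, rfl⟩⟩ from rfl, this]
  have hex : ∃ j, y j = y i := ⟨i, rfl⟩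
  rw [dif_pos hex]
  exact congrArg a (hinj hex.choose_spec)

/-- The constants of all derivations are algebraic over the base field. -/
lemma mem_range_of_forall_derivation_eq_zero {k Ω : Type*} [Field k] [CharZero k] [IsAlgClosed k]
    [Field Ω] [Algebra k Ω] (a : Ω) (h : ∀ D : Derivation k Ω Ω, D a = 0) :
    ∃ b : k, algebraMap k Ω b = a := by
  -- Algebraic elements already lie in the algebraically closed field `k`; a transcendental one has
  -- derivative 1 under some derivation.
  by_cases ha : IsAlgebraic k a
  · have : Algebra.IsIntegral k (IntermediateField.adjoin k {a}) :=
      (IntermediateField.isAlgebraic_adjoin_simple ha.isIntegral).isIntegral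
    obtain ⟨b, hb⟩ := (IsAlgClosed.algebraMap_bijective_of_isIntegral (k := k)).2
      (IntermediateField.AdjoinSimple.gen k a)
    exact ⟨b, congrArg Subtype.val hb⟩
  · have hind : AlgebraicIndependent k fun _ : Unit => a := by
      rw [algebraicIndependent_unique_type_iff]
      exact ha
    obtain ⟨D, hD⟩ := exists_derivation_apply_eq hind fun _ => 1
    have := hD ()
    rw [h] at this
    exact absurd this zero_ne_one

/-- By incomparability, contraction along an integral homomorphism is strictly monotone on primes.
-/
lemma le_card_of_isIntegral {k R : Type*} [Field k] [CommRing R] {s : ℕ}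
    (g : MvPolynomial (Fin s) k →+* R) (hg : g.IsIntegral) : ringKrullDim R ≤ s := by
  let _ := g.toAlgebra
  have : Algebra.IsIntegral (MvPolynomial (Fin s) k) R := ⟨hg⟩
  have h1 : ringKrullDim R ≤ ringKrullDim (MvPolynomial (Fin s) k) := by
    refine Order.krullDim_le_of_strictMono (PrimeSpectrum.comap (algebraMap _ R)) fun p q hpq => ?_
    exact Ideal.IsIntegral.comap_lt_comap (show p.asIdeal < q.asIdeal from hpq)
  rw [MvPolynomial.ringKrullDim_of_isNoetherianRing, ringKrullDim_eq_zero_of_field] at h1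
  simpa using h1

/-- The generic point of a subvariety of an affine space moves in as many independent directions
as the dimension. -/
lemma exists_independent_derivations {k Ω : Type*} [Field k] [CharZero k] [Field Ω] [Algebra k Ω]
    {N m : ℕ} {I : Ideal (MvPolynomial (Fin N) k)} (hI : I ≠ ⊤)
    (hdim : (m : WithBot ℕ∞) ≤ ringKrullDim (MvPolynomial (Fin N) k ⧸ I))
    {x : Fin N → Ω} (hx : ∀ f, aeval x f = 0 ↔ f ∈ I) :
    ∃ d : Fin m → Derivation k Ω Ω, LinearIndependent Ω fun i => dv (d i) x := by
  classical
  obtain ⟨s, -, g, hg, hint⟩ := exists_integral_inj_algHom_of_quotient I hI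
  have hms : m ≤ s := by
    have := hdim.trans (le_card_of_isIntegral g.toRingHom hint)
    exact_mod_cast this
  let φ : (MvPolynomial (Fin N) k ⧸ I) →ₐ[k] Ω :=
    Ideal.Quotient.liftₐ I (aeval x) fun f hf => (hx f).mpr hf
  have hφ : Function.Injective φ := by
    rw [injective_iff_map_eq_zero]
    intro f
    obtain ⟨f, rfl⟩ := Ideal.Quotient.mk_surjective f
    intro h
    exact Ideal.Quotient.eq_zero_iff_mem.mpr ((hx f).mp h)
  let y : Fin s → Ω := fun i => φ (g (X i))
  have hy : AlgebraicIndependent k y := by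
    have h : (aeval y : MvPolynomial (Fin s) k →ₐ[k] Ω) = φ.comp g := by
      ext i; simp [y]
    rw [AlgebraicIndependent, h]
    exact hφ.comp hg
  choose D hD using fun i : Fin s => exists_derivation_apply_eq hy (Pi.single i 1)
  refine ⟨fun i => D (Fin.castLE hms i), ?_⟩
  rw [Fintype.linearIndependent_iff]
  intro a ha i
  -- A combination of these derivations that kills the coordinates of x kills every polynomial in
  -- them, in particular each `y i`, and so reveals its coefficients.
  obtain ⟨E, hE⟩ : ∃ E, E = ∑ i, a i • D (Fin.castLE hms i) := ⟨_, rfl⟩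
  have hEx (j) : E (x j) = 0 := by
    have := congrFun ha j
    simpa [hE, dv, derivation_sum_apply] using this
  have hEy : E (y (Fin.castLE hms i)) = 0 := by
    obtain ⟨p, hp⟩ := Ideal.Quotient.mk_surjective (g (X (Fin.castLE hms i)))
    have : y (Fin.castLE hms i) = aeval x p := by
      simp only [y, ← hp]; rfl
    rw [this, derivation_aeval]
    simp [hEx]
  rw [hE] at hEy
  simp only [derivation_sum_apply, Derivation.coe_smul, Pi.smul_apply, y, hD] at hEy
  simp only [Pi.single_apply, smul_eq_mul, (Fin.castLE_injective hms).eq_iff] at hEy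
  simpa using hEy

end FieldDerivations

/-! ### Ideals of hyperplane sections and multiplicity of a section in a divisor -/

section Sections

variable {k ι : Type*} [Field k]

lemma eval_add_of_totalDegree_le_one {p : MvPolynomial ι k} (hp : p.totalDegree ≤ 1) (u v : ι → k) :
    eval (u + v) p + eval 0 p = eval u p + eval v p := by
  classical
  have key (d : ι →₀ ℕ) (hd : d.degree ≤ 1) (a : k) : eval (u + v) (monomial d a) +
      eval 0 (monomial d a) = eval u (monomial d a) + eval v (monomial d a) := by
    by_cases h0 : d = 0
    · subst h0; simp
    · obtain ⟨i, hi⟩ := Finsupp.ne_iff.mp h0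
      obtain ⟨d', rfl⟩ : ∃ d', d = Finsupp.single i 1 + d' :=
        ⟨d - Finsupp.single i 1, (add_tsub_cancel_of_le (by
          rw [Finsupp.single_le_iff]; exact Nat.one_le_iff_ne_zero.mpr hi)).symm⟩
      have hd' : d' = 0 := by
        rw [map_add, Finsupp.degree_single] at hd
        exact (Finsupp.degree_eq_zero_iff d').mp (by omega)
      subst hd'
      have hc : constantCoeff (monomial (Finsupp.single i 1) a) = 0 := by
        rw [constantCoeff_eq, coeff_monomial, if_neg (by simp)]
      simp [eval_monomial, hc]
      ring
  rw [p.as_sum]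
  simp only [map_sum, ← Finset.sum_add_distrib]
  refine Finset.sum_congr rfl fun d hd => key d ?_ _
  exact (le_totalDegree hd).trans hp

/-- A quadratic form of rank at least two has no multiple factors. -/
lemma squarefree_of_isHomogeneous_two {E : MvPolynomial ι k} (hE : E.IsHomogeneous 2) {u v : ι → k}
    (hu : eval u E = 0) (hv : eval v E = 0) (huv : eval (u + v) E ≠ 0) : Squarefree E := by
  have hE0 : E ≠ 0 := by rintro rfl; simp at huv
  rintro p ⟨r, hr⟩
  have hp0 : p ≠ 0 := by rintro rfl; simp at hr; exact hE0 hr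
  have hr0 : r ≠ 0 := by rintro rfl; simp at hr; exact hE0 hr
  have hdeg : 2 = p.totalDegree + p.totalDegree + r.totalDegree := by
    rw [← hE.totalDegree hE0, hr, totalDegree_mul_of_isDomain (mul_ne_zero hp0 hp0) hr0,
      totalDegree_mul_of_isDomain hp0 hp0]
  by_cases h0 : p.totalDegree = 0
  · rw [totalDegree_eq_zero_iff_eq_C] at h0
    rw [h0]
    refine (IsUnit.mk0 (coeff 0 p) fun h => hp0 ?_).map C
    rw [h0, h, C_0]
  -- A nonconstant square factor is of degree one with constant cofactor, so the zero set of `E`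
  -- would be an affine space through 0, closed under addition.
  · exfalso
    have hr1 : r = C (coeff 0 r) := totalDegree_eq_zero_iff_eq_C.mp (by omega)
    have hc : coeff 0 r ≠ 0 := fun h => hr0 (by rw [hr1, h, C_0])
    have hev (w : ι → k) : eval w E = eval w p * eval w p * coeff 0 r := by
      rw [hr, hr1]; simp
    have hz (w : ι → k) (hw : eval w E = 0) : eval w p = 0 := by
      rw [hev] at hw
      simpa [hc] using hw
    have hzero : eval 0 E = 0 := by
      rw [eval_zero, constantCoeff_eq]
      exact hE.coeff_eq_zero (by simp)
    have := eval_add_of_totalDegree_le_one (p := p) (by omega) u v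
    rw [hz u hu, hz v hv, hz 0 hzero, add_zero, add_zero] at this
    exact huv (by rw [hev, this]; ring)

/-- The Nullstellensatz for a principal ideal, which is radical because its generator is squarefree.
-/
lemma dvd_of_forall_eval_eq_zero [IsAlgClosed k] [Finite ι] {E F : MvPolynomial ι k}
    (hE : Squarefree E) (h : ∀ v, eval v E = 0 → eval v F = 0) : E ∣ F := by
  have hE0 : E ≠ 0 := hE.ne_zero
  have hrad : (Ideal.span {E}).IsRadical :=
    isRadical_iff_span_singleton.mp ((isRadical_iff_squarefree_of_ne_zero hE0).mpr hE)
  rw [← Ideal.mem_span_singleton, ← hrad.radical, ← vanishingIdeal_zeroLocus_eq_radical (K := k),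
    mem_vanishingIdeal_iff]
  intro v hv
  rw [mem_zeroLocus_iff] at hv
  exact h v (hv E (Ideal.mem_span_singleton_self E))

lemma homogeneousComponent_mul_of_isHomogeneous {φ : MvPolynomial ι k} {i : ℕ}
    (hφ : φ.IsHomogeneous i) (n : ℕ) (A : MvPolynomial ι k) :
    homogeneousComponent (n + i) (φ * A) = φ * homogeneousComponent n A := by
  conv_lhs => rw [← sum_homogeneousComponent A, Finset.mul_sum, map_sum]
  have h (j : ℕ) : homogeneousComponent (n + i) (φ * homogeneousComponent j A) =
      if j = n then φ * homogeneousComponent j A else 0 := by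
    have := hφ.mul (homogeneousComponent_isHomogeneous j A)
    rw [homogeneousComponent_of_mem this]
    congr 1
    rw [eq_iff_iff]; omega
  simp only [h, Finset.sum_ite_eq', Finset.mem_range]
  split_ifs with hn
  · rfl
  · rw [homogeneousComponent_eq_zero _ _ (by omega), mul_zero]

lemma homogeneousComponent_mul_of_lt {φ : MvPolynomial ι k} {i n : ℕ}
    (hφ : φ.IsHomogeneous i) (hn : n < i) (A : MvPolynomial ι k) :
    homogeneousComponent n (φ * A) = 0 := by
  conv_lhs => rw [← sum_homogeneousComponent A, Finset.mul_sum, map_sum]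
  refine Finset.sum_eq_zero fun j _ => ?_
  rw [homogeneousComponent_of_mem (hφ.mul (homogeneousComponent_isHomogeneous j A)),
    if_neg (by omega)]

variable [Fintype ι]

/-- The quadratic form with Gram matrix `G`, as a polynomial. -/
def quadPoly (G : Matrix ι ι k) : MvPolynomial ι k := bil G X X

/-- The linear form `v ↦ b(z, v)`, as a polynomial. -/
def linPoly (G : Matrix ι ι k) (z : ι → k) : MvPolynomial ι k := bil G (ext _ z) X

lemma aeval_quadPoly {A : Type*} [CommRing A] [Algebra k A] (G : Matrix ι ι k) (v : ι → A) :
    aeval v (quadPoly G) = bil G v v := by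
  rw [quadPoly, map_bil]; simp

lemma aeval_linPoly {A : Type*} [CommRing A] [Algebra k A] (G : Matrix ι ι k) (z : ι → k)
    (v : ι → A) : aeval v (linPoly G z) = bil G (ext A z) v := by
  rw [linPoly, map_bil]
  congr 1
  · funext j; simp [ext]
  · funext j; simp

lemma eval_quadPoly (G : Matrix ι ι k) (v : ι → k) : eval v (quadPoly G) = bil G v v := by
  rw [← aeval_quadPoly, aeval_eq_eval]

lemma eval_linPoly (G : Matrix ι ι k) (z v : ι → k) : eval v (linPoly G z) = bil G z v := by
  rw [← aeval_eq_eval, aeval_linPoly]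
  rfl

lemma linPoly_isHomogeneous (G : Matrix ι ι k) (z : ι → k) : (linPoly G z).IsHomogeneous 1 := by
  refine IsHomogeneous.sum _ _ _ fun j _ => IsHomogeneous.sum _ _ _ fun i _ => ?_
  rw [ext, algebraMap_eq, ← C_mul]
  exact isHomogeneous_C_mul_X _ _

lemma quadPoly_isHomogeneous (G : Matrix ι ι k) : (quadPoly G).IsHomogeneous 2 := by
  refine IsHomogeneous.sum _ _ _ fun j _ => IsHomogeneous.sum _ _ _ fun i _ => ?_
  rw [algebraMap_eq]
  exact (isHomogeneous_C_mul_X _ _).mul (isHomogeneous_X _ _)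

variable [DecidableEq ι] [CharZero k] [IsAlgClosed k] {G : Matrix ι ι k}

lemma exists_hyperbolic_pair_orthogonal (hG : G.IsSymm) (hdet : IsUnit G.det)
    (hcard : 4 ≤ Fintype.card ι) (z : ι → k) : ∃ e f : ι → k, bil G z e = 0 ∧ bil G z f = 0 ∧
      bil G e e = 0 ∧ bil G f f = 0 ∧ bil G e f = 1 := by
  have hdet' : IsUnit (G.map (algebraMap k k)).det := by simpa using hdet
  have memU {y : ι → k} : y ∈ perp G ![z] ↔ bil G z y = 0 := by simp [mem_perp]
  obtain ⟨e, he, f, hf, h⟩ := exists_hyperbolic_pair hG (U := perp G ![z])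
    (R := Submodule.span k {z}) (fun v _ h => by
      obtain ⟨a, ha⟩ := eq_sum_of_perp hG hdet' (L := ![z]) (v := v) h
      rw [Submodule.mem_span_singleton]
      exact ⟨a 0, by rw [ha]; simp⟩) (by
      have h1 := card_le_finrank_perp G (Ω := k) ![z]
      have h2 : Module.finrank k (Submodule.span k {z}) ≤ 1 :=
        (finrank_span_le_card ({z} : Set (ι → k))).trans (by simp)
      omega)
  exact ⟨e, f, memU.mp he, memU.mp hf, h⟩

lemma exists_eval_ne_zero_of_not_dvd (hG : G.IsSymm) (hdet : IsUnit G.det)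
    (hcard : 4 ≤ Fintype.card ι) {f : MvPolynomial ι k} (hf : ¬ quadPoly G ∣ f) :
    ∃ v : ι → k, bil G v v = 0 ∧ eval v f ≠ 0 := by
  by_contra! h
  obtain ⟨e, e', -, -, hee, hee', h1⟩ := exists_hyperbolic_pair_orthogonal hG hdet hcard 0
  refine hf (dvd_of_forall_eval_eq_zero (squarefree_of_isHomogeneous_two
    (quadPoly_isHomogeneous G) (u := e) (v := e') ?_ ?_ ?_) fun v hv => h v ?_)
  · rw [eval_quadPoly, hee]
  · rw [eval_quadPoly, hee']
  · rw [eval_quadPoly]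
    simp only [bil_add_left, bil_add_right, hee, hee', bil_comm hG e' e, h1]
    norm_num
  · rwa [eval_quadPoly] at hv

/-- A polynomial vanishing on a hyperplane section of the quadric lies in its ideal. -/
lemma exists_eq_of_vanishing_on_section (hG : G.IsSymm) (hdet : IsUnit G.det)
    (hcard : 4 ≤ Fintype.card ι) {z : ι → k} (hz : z ≠ 0) {f : MvPolynomial ι k}
    (h : ∀ v, bil G v v = 0 → bil G z v = 0 → eval v f = 0) :
    ∃ A B, f = quadPoly G * A + linPoly G z * B := by
  have hdet' : IsUnit (G.map (algebraMap k k)).det := by simpa using hdet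
  obtain ⟨y, hy⟩ : ∃ y, bil G z y = 1 := by
    obtain ⟨y, hy⟩ : ∃ y, bil G z y ≠ 0 := by
      by_contra! hcon
      exact hz (eq_zero_of_bil_eq_zero hG hdet' hcon)
    exact ⟨(bil G z y)⁻¹ • y, by rw [bil_smul_right, inv_mul_cancel₀ hy]⟩
  -- The projection v ↦ v - b(z, v)y onto z^⊥ as a substitution. It is the identity modulo the
  -- linear form, so only divisibility by the restricted quadratic form is left, and that form is
  -- squarefree thanks to a hyperbolic pair in z^⊥.
  let s : ι → MvPolynomial ι k := fun j => X j - linPoly G z * C (y j)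
  have hs (v : ι → k) : (fun j => eval v (s j)) = v - bil G z v • y := by
    funext j; simp [s, eval_linPoly]
  have hev (F : MvPolynomial ι k) (v) : eval v (aeval s F) = eval (v - bil G z v • y) F := by
    have := map_aeval_apply (aeval v : MvPolynomial ι k →ₐ[k] k) s F
    simp only [aeval_eq_eval, hs] at this
    exact this
  have hmod (F : MvPolynomial ι k) : linPoly G z ∣ F - aeval s F := by
    induction F using MvPolynomial.induction_on with
    | C a => simp
    | add p q hp hq =>
      rw [map_add, add_sub_add_comm]; exact dvd_add hp hq
    | mul_X p i hp =>
      rw [map_mul, aeval_X]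
      have : p * X i - aeval s p * s i = (p - aeval s p) * X i + aeval s p * (X i - s i) := by ring
      rw [this]
      refine dvd_add (hp.mul_right _) ((Dvd.intro (C (y i)) ?_).mul_left _)
      simp [s]
  obtain ⟨e, e', he, he', hee, hee', h1⟩ := exists_hyperbolic_pair_orthogonal hG hdet hcard z
  have hEhom : (aeval s (quadPoly G)).IsHomogeneous 2 := by
    have hs1 (j) : (s j).IsHomogeneous 1 :=
      (isHomogeneous_X _ _).sub ((linPoly_isHomogeneous G z).mul (isHomogeneous_C _ _))
    rw [aeval_quadPoly]
    refine IsHomogeneous.sum _ _ _ fun j _ => IsHomogeneous.sum _ _ _ fun i _ => ?_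
    rw [algebraMap_eq]
    have := ((isHomogeneous_C _ (G j i)).mul (hs1 j)).mul (hs1 i)
    simpa using this
  have hdvd : aeval s (quadPoly G) ∣ aeval s f := by
    refine dvd_of_forall_eval_eq_zero (squarefree_of_isHomogeneous_two hEhom
      (u := e) (v := e') ?_ ?_ ?_) fun v hv => ?_
    · rw [hev, he, zero_smul, sub_zero, eval_quadPoly, hee]
    · rw [hev, he', zero_smul, sub_zero, eval_quadPoly, hee']
    · rw [hev, bil_add_right, he, he', add_zero, zero_smul, sub_zero, eval_quadPoly]
      simp only [bil_add_left, bil_add_right, hee, hee', bil_comm hG e' e, h1]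
      norm_num
    · rw [hev] at hv ⊢
      rw [eval_quadPoly] at hv
      refine h _ hv ?_
      rw [bil_sub_right, bil_smul_right, hy]
      ring
  obtain ⟨S, hS⟩ := hdvd
  obtain ⟨B₁, hB₁⟩ := hmod f
  obtain ⟨B₂, hB₂⟩ := hmod (quadPoly G)
  exact ⟨S, B₁ - B₂ * S, by linear_combination hB₁ + hS - S * hB₂⟩

/-- The maximal multiplicity of a hyperplane section in a divisor on the quadric. -/
lemma exists_decomposition (hG : G.IsSymm) (hdet : IsUnit G.det)
    (hcard : 4 ≤ Fintype.card ι) {z : ι → k} (hz : z ≠ 0) (l : ℕ) {f : MvPolynomial ι k}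
    (hf : f.IsHomogeneous l) (hfq : ¬ quadPoly G ∣ f) :
    ∃ (a l' : ℕ) (g : MvPolynomial ι k), a + l' = l ∧ g.IsHomogeneous l' ∧
      quadPoly G ∣ f - linPoly G z ^ a * g ∧
      ∃ v, bil G v v = 0 ∧ bil G z v = 0 ∧ eval v g ≠ 0 := by
  induction l generalizing f with
  | zero =>
    obtain ⟨c, rfl⟩ : ∃ c, f = C c :=
      ⟨_, totalDegree_eq_zero_iff_eq_C.mp (by simpa using hf.totalDegree_le)⟩
    refine ⟨0, 0, C c, rfl, hf, by simp, 0, bil_zero_left G 0, bil_zero_right G z, ?_⟩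
    rw [eval_C]
    rintro rfl
    exact hfq (by simp)
  | succ l ih =>
    by_cases hv : ∃ v, bil G v v = 0 ∧ bil G z v = 0 ∧ eval v f ≠ 0
    · exact ⟨0, l + 1, f, by omega, hf, by simp, hv⟩
    push Not at hv
    obtain ⟨A, B, hAB⟩ := exists_eq_of_vanishing_on_section hG hdet hcard hz hv
    -- Taking components of degree `l + 1` makes the cofactor of the linear form homogeneous of
    -- degree `l`, ready for induction. For `l = 0` the quadratic term has no component in degree
    -- one.
    have hB : quadPoly G ∣ f - linPoly G z * homogeneousComponent l B := by
      have h1 := congrArg (homogeneousComponent (l + 1)) hAB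
      rw [homogeneousComponent_eq_self hf, map_add,
        homogeneousComponent_mul_of_isHomogeneous (linPoly_isHomogeneous G z)] at h1
      rw [h1, add_sub_cancel_right]
      rcases Nat.eq_zero_or_pos l with rfl | hl
      · rw [homogeneousComponent_mul_of_lt (quadPoly_isHomogeneous G) (by omega)]
        exact dvd_zero _
      · obtain ⟨m, rfl⟩ : ∃ m, l = m + 1 := ⟨l - 1, by omega⟩
        rw [show m + 1 + 1 = m + 2 from rfl,
          homogeneousComponent_mul_of_isHomogeneous (quadPoly_isHomogeneous G)]
        exact dvd_mul_right _ _
    obtain ⟨a, l', g, hal, hg, hdvd, hne⟩ := ih (homogeneousComponent_isHomogeneous l B)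
      fun hd => hfq ((dvd_sub_left (hd.mul_left _)).mp hB)
    refine ⟨a + 1, l', g, by omega, hg, ?_, hne⟩
    have : f - linPoly G z ^ (a + 1) * g = (f - linPoly G z * homogeneousComponent l B) +
        linPoly G z * (homogeneousComponent l B - linPoly G z ^ a * g) := by ring
    rw [this]
    exact dvd_add hB (hdvd.mul_left _)

end Sections

/-! ### Leading forms at a point -/

section LeadingForms

variable {k A ι : Type*} [Field k] [CommRing A] [Algebra k A]

/-- `Y` is a leading form of `y ∈ m ^ d` with respect to the generators `δ` of `m`. -/
def IsLeadingForm (δ : ι → A) (d : ℕ) (y : A) (Y : MvPolynomial ι k) : Prop :=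
  Y.IsHomogeneous d ∧ y - aeval δ Y ∈ Ideal.span (Set.range δ) ^ (d + 1)

lemma aeval_mem_span_pow (δ : ι → A) {d : ℕ} {Y : MvPolynomial ι k} (hY : Y.IsHomogeneous d) :
    aeval δ Y ∈ Ideal.span (Set.range δ) ^ d := by
  rw [aeval_def, eval₂_eq]
  refine Ideal.sum_mem _ fun s hs => Ideal.mul_mem_left _ _ ?_
  have hdeg : ∑ i ∈ s.support, s i = d := by
    simpa [Finsupp.weight_apply, Finsupp.sum] using hY (mem_support_iff.mp hs)
  rw [← hdeg, ← Finset.prod_pow_eq_pow_sum]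
  exact Ideal.prod_mem_prod fun i _ =>
    Ideal.pow_mem_pow (Ideal.subset_span (Set.mem_range_self i)) _

lemma IsLeadingForm.mem {δ : ι → A} {d : ℕ} {y : A} {Y : MvPolynomial ι k}
    (h : IsLeadingForm δ d y Y) : y ∈ Ideal.span (Set.range δ) ^ d := by
  rw [← sub_add_cancel y (aeval δ Y)]
  exact Ideal.add_mem _ (Ideal.pow_le_pow_right (Nat.le_succ d) h.2) (aeval_mem_span_pow δ h.1)

lemma IsLeadingForm.add {δ : ι → A} {d : ℕ} {y y' : A} {Y Y' : MvPolynomial ι k}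
    (h : IsLeadingForm δ d y Y) (h' : IsLeadingForm δ d y' Y') :
    IsLeadingForm δ d (y + y') (Y + Y') :=
  ⟨h.1.add h'.1, by rw [map_add, add_sub_add_comm]; exact Ideal.add_mem _ h.2 h'.2⟩

lemma IsLeadingForm.mul {δ : ι → A} {d d' : ℕ} {y y' : A} {Y Y' : MvPolynomial ι k}
    (h : IsLeadingForm δ d y Y) (h' : IsLeadingForm δ d' y' Y') :
    IsLeadingForm δ (d + d') (y * y') (Y * Y') := by
  refine ⟨h.1.mul h'.1, ?_⟩
  have e : y * y' - aeval δ (Y * Y') =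
      (y - aeval δ Y) * y' + aeval δ Y * (y' - aeval δ Y') := by rw [map_mul]; ring
  rw [e]
  refine Ideal.add_mem _ ?_ ?_
  · have := Ideal.mul_mem_mul h.2 h'.mem
    rwa [← pow_add, show d + 1 + d' = d + d' + 1 by ring] at this
  · have := Ideal.mul_mem_mul (aeval_mem_span_pow δ h.1) h'.2
    rwa [← pow_add] at this

/-- Forms of degree d in the generators surject onto m^d/m^(d+1), since the residue field is `k` by
`hgen`. Leading forms need not be unique. -/
lemma exists_isLeadingForm {δ : ι → A}
    (hgen : ∀ a : A, ∃ z : k, a - algebraMap k A z ∈ Ideal.span (Set.range δ)) (d : ℕ) {y : A}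
    (hy : y ∈ Ideal.span (Set.range δ) ^ d) : ∃ Y : MvPolynomial ι k, IsLeadingForm δ d y Y := by
  have h0 (a : A) : ∃ Y : MvPolynomial ι k, IsLeadingForm δ 0 a Y := by
    obtain ⟨z, hz⟩ := hgen a
    exact ⟨C z, isHomogeneous_C _ _, by simpa using hz⟩
  have h1 (b : A) (hb : b ∈ Ideal.span (Set.range δ)) :
      ∃ Y : MvPolynomial ι k, IsLeadingForm δ 1 b Y := by
    induction hb using Submodule.span_induction with
    | mem b hb =>
      obtain ⟨j, rfl⟩ := hb
      exact ⟨X j, isHomogeneous_X _ _, by simp⟩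
    | zero => exact ⟨0, isHomogeneous_zero _ _ _, by simp⟩
    | add b b' _ _ h h' =>
      obtain ⟨Y, h⟩ := h
      obtain ⟨Y', h'⟩ := h'
      exact ⟨_, h.add h'⟩
    | smul a b _ h =>
      obtain ⟨Y, h⟩ := h
      obtain ⟨Y', h'⟩ := h0 a
      refine ⟨Y' * Y, ?_⟩
      have := h'.mul h
      rwa [zero_add] at this
  induction d generalizing y with
  | zero => exact h0 y
  | succ d ih =>
    rw [pow_succ] at hy
    induction hy using Submodule.mul_induction_on' with
    | mem_mul_mem a ha b hb =>
      obtain ⟨Y, h⟩ := ih ha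
      obtain ⟨Y', h'⟩ := h1 b hb
      exact ⟨_, h.mul h'⟩
    | add y _ y' _ h h' =>
      obtain ⟨Y, h⟩ := h
      obtain ⟨Y', h'⟩ := h'
      exact ⟨_, h.add h'⟩

/-- The leading coefficient of `y ∈ m ^ d` along an arc is the value of its leading form at the
direction of the arc. -/
lemma IsLeadingForm.exists_eq [Fintype ι] {δ : ι → A} {d : ℕ} {y : A} {Y : MvPolynomial ι k}
    (h : IsLeadingForm δ d y Y) (φ : A →ₐ[k] PowerSeries k) (g : ι → PowerSeries k)
    (hφ : ∀ j, φ (δ j) = PowerSeries.X * g j) :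
    ∃ p, φ y = PowerSeries.X ^ d * p ∧
      PowerSeries.constantCoeff p = eval (fun j => PowerSeries.constantCoeff (g j)) Y := by
  have hm (e : ℕ) (a : A) (ha : a ∈ Ideal.span (Set.range δ) ^ e) :
      φ a ∈ Ideal.span {(PowerSeries.X : PowerSeries k) ^ e} := by
    have hle : Ideal.span (Set.range δ) ≤
        (Ideal.span {(PowerSeries.X : PowerSeries k)}).comap φ := by
      rw [Ideal.span_le]
      rintro _ ⟨j, rfl⟩
      exact Ideal.mem_span_singleton.mpr ⟨g j, hφ j⟩
    have := Ideal.le_comap_pow φ e (Ideal.pow_right_mono hle e ha)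
    rwa [Ideal.mem_comap, Ideal.span_singleton_pow] at this
  obtain ⟨p, hp⟩ := Ideal.mem_span_singleton.mp (hm _ _ h.2)
  refine ⟨aeval g Y + PowerSeries.X * p, ?_, ?_⟩
  · have e1 : φ (aeval δ Y) = PowerSeries.X ^ d * aeval g Y := by
      have e2 : (fun j => φ (δ j)) = (PowerSeries.X : PowerSeries k) • g := by
        funext j; exact hφ j
      rw [map_aeval_apply, e2, aeval_smul_of_isHomogeneous h.1]
    rw [map_sub, e1] at hp
    linear_combination hp
  · rw [map_add, map_mul, PowerSeries.constantCoeff_X, zero_mul, add_zero,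
      aeval_def, hom_eval₂]
    have : (PowerSeries.constantCoeff (R := k)).comp (algebraMap k (PowerSeries k)) =
        RingHom.id k := by
      ext a; simp
    rw [this]
    rfl

end LeadingForms

/-! ### Elements of a blow-up chart as fractions -/

section Charts

variable {A : Type*} [CommRing A] (m : Ideal A) (u : A)

variable {m u}

lemma blowupChart_mul_right_cancel (k : ℕ) {z z' : blowupChart m u}
    (h : z * algebraMap A _ u ^ k = z' * algebraMap A _ u ^ k) : z = z' := by
  apply Subtype.ext
  have h1 := congrArg Subtype.val h
  have hu : IsUnit (algebraMap A (Localization.Away u) u ^ k) :=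
    (IsLocalization.Away.algebraMap_isUnit u).pow k
  exact hu.mul_right_cancel h1

lemma exists_blowupChart_mul_eq {y : A} (hy : y ∈ m) :
    ∃ z : blowupChart m u, z * algebraMap A _ u = algebraMap A _ y := by
  have hu : IsUnit (algebraMap A (Localization.Away u) u) :=
    IsLocalization.Away.algebraMap_isUnit u
  obtain ⟨v, hv⟩ := hu.exists_left_inv
  have h : algebraMap A (Localization.Away u) y * v * algebraMap A (Localization.Away u) u =
      algebraMap A (Localization.Away u) y := by rw [mul_assoc, hv, mul_one]
  exact ⟨⟨_, Algebra.subset_adjoin ⟨y, hy, h⟩⟩, Subtype.ext h⟩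

lemma exists_blowupChart_mul_pow_eq {k : ℕ} {y : A} (hy : y ∈ m ^ k) :
    ∃ z : blowupChart m u, z * algebraMap A _ u ^ k = algebraMap A _ y := by
  induction k generalizing y with
  | zero => exact ⟨algebraMap A _ y, by simp⟩
  | succ k ih =>
    rw [pow_succ] at hy
    induction hy using Submodule.mul_induction_on' with
    | mem_mul_mem a ha b hb =>
      obtain ⟨z, hz⟩ := ih ha
      obtain ⟨z', hz'⟩ := exists_blowupChart_mul_eq (u := u) hb
      exact ⟨z * z', by rw [map_mul, ← hz, ← hz']; ring⟩
    | add y _ y' _ h h' =>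
      obtain ⟨z, hz⟩ := h
      obtain ⟨z', hz'⟩ := h'
      exact ⟨z + z', by rw [map_add, ← hz, ← hz']; ring⟩

/-- Every element of the chart is a fraction y/u^k with y in m^k, so membership in ideals of the
chart can be tested through powers of m. -/
lemma exists_pow_blowupChart (hu : u ∈ m) (z : blowupChart m u) :
    ∃ k, ∃ y ∈ m ^ k, z * algebraMap A _ u ^ k = algebraMap A _ y := by
  suffices h : ∀ z ∈ blowupChart m u, ∃ k, ∃ y ∈ m ^ k,
      z * algebraMap A (Localization.Away u) u ^ k = algebraMap A _ y by
    obtain ⟨k, y, hy, h⟩ := h z z.2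
    exact ⟨k, y, hy, Subtype.ext h⟩
  intro z hz
  induction hz using Algebra.adjoin_induction with
  | mem z hz =>
    obtain ⟨y, hy, h⟩ := hz
    exact ⟨1, y, by rwa [pow_one], by rwa [pow_one]⟩
  | algebraMap a => exact ⟨0, a, by simp, by simp⟩
  | add z z' _ _ h h' =>
    obtain ⟨k, y, hy, h⟩ := h
    obtain ⟨k', y', hy', h'⟩ := h'
    refine ⟨k + k', y * u ^ k' + y' * u ^ k, Ideal.add_mem _ ?_ ?_, ?_⟩
    · rw [pow_add]; exact Ideal.mul_mem_mul hy (Ideal.pow_mem_pow hu _)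
    · rw [add_comm, pow_add]; exact Ideal.mul_mem_mul hy' (Ideal.pow_mem_pow hu _)
    · simp only [map_add, map_mul, map_pow, ← h, ← h']; ring
  | mul z z' _ _ h h' =>
    obtain ⟨k, y, hy, h⟩ := h
    obtain ⟨k', y', hy', h'⟩ := h'
    refine ⟨k + k', y * y', ?_, ?_⟩
    · rw [pow_add]; exact Ideal.mul_mem_mul hy hy'
    · simp only [map_mul, ← h, ← h']; ring

/-- Functions vanishing to an excessive order give elements of the exceptional ideal. -/
lemma mem_exceptionalIdeal_of_pow {k : ℕ} {y : A} (hy : y ∈ m ^ (k + 1)) {z : blowupChart m u}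
    (hz : z * algebraMap A _ u ^ k = algebraMap A _ y) : z ∈ exceptionalIdeal m u := by
  obtain ⟨z', hz', h⟩ : ∃ z' ∈ exceptionalIdeal m u, z' * algebraMap A _ u ^ k = algebraMap A _ y := by
    clear hz
    rw [pow_succ] at hy
    induction hy using Submodule.mul_induction_on' with
    | mem_mul_mem a ha b hb =>
      obtain ⟨z, hz⟩ := exists_blowupChart_mul_pow_eq (u := u) ha
      exact ⟨z * algebraMap A _ b, Ideal.mul_mem_left _ _ (Ideal.mem_map_of_mem _ hb),
        by rw [map_mul, ← hz]; ring⟩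
    | add y _ y' _ h h' =>
      obtain ⟨z, hz, h⟩ := h
      obtain ⟨z', hz', h'⟩ := h'
      exact ⟨z + z', Ideal.add_mem _ hz hz', by rw [map_add, ← h, ← h']; ring⟩
  rwa [blowupChart_mul_right_cancel k (hz.trans h.symm)]

/-- A morphism along which `m` becomes generated by the image of `u` extends to the chart. -/
lemma exists_blowupChart_hom {R : Type*} [CommRing R] [IsDomain R] (φ : A →+* R) (hu : φ u ≠ 0)
    (h : ∀ y ∈ m, φ u ∣ φ y) :
    ∃ Φ : blowupChart m u →+* R, ∀ a, Φ (algebraMap A _ a) = φ a := by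
  let K := FractionRing R
  have hinj : Function.Injective (algebraMap R K) := IsFractionRing.injective R K
  have hunit : IsUnit (((algebraMap R K).comp φ) u) := by
    rw [isUnit_iff_ne_zero, RingHom.comp_apply, Ne, map_eq_zero_iff _ hinj]
    exact hu
  let ψ : Localization.Away u →+* K := IsLocalization.Away.lift u hunit
  have hψ (a : A) : ψ (algebraMap A _ a) = algebraMap R K (φ a) :=
    IsLocalization.Away.lift_eq u hunit a
  -- The induced map to the fraction field sends a generator y/u to φ(y)/φ(u), which lies in R by
  -- the divisibility hypothesis.
  have hrange : ∀ z ∈ blowupChart m u, ψ z ∈ (algebraMap R K).range := by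
    intro z hz
    induction hz using Algebra.adjoin_induction with
    | mem z hz =>
      obtain ⟨y, hy, h1⟩ := hz
      obtain ⟨r, hr⟩ := h y hy
      refine ⟨r, ?_⟩
      have h2 := congrArg ψ h1
      rw [map_mul, hψ, hψ, hr, map_mul, mul_comm] at h2
      exact (mul_left_cancel₀ (fun h0 => hu ((map_eq_zero_iff _ hinj).mp h0)) h2).symm
    | algebraMap a => exact ⟨φ a, (hψ a).symm⟩
    | add z z' _ _ h h' => rw [map_add]; exact Subring.add_mem _ h h'
    | mul z z' _ _ h h' => rw [map_mul]; exact Subring.mul_mem _ h h'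
  let e : R ≃+* (algebraMap R K).range := RingEquiv.ofBijective (algebraMap R K).rangeRestrict
    ⟨fun a b hab => hinj (congrArg Subtype.val hab), (algebraMap R K).rangeRestrict_surjective⟩
  let g : blowupChart m u →+* (algebraMap R K).range :=
    (ψ.comp (blowupChart m u).val.toRingHom).codRestrict _ fun z => hrange z z.2
  refine ⟨e.symm.toRingHom.comp g, fun a => ?_⟩
  have : g (algebraMap A _ a) = e (φ a) := Subtype.ext (hψ a)
  simp [this]

end Charts

/-! ### Forms vanishing on linear subspaces -/

section LinearForms

variable {k ι : Type*} [Field k] [Fintype ι]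

/-- The linear form with coefficients `c`, as a polynomial. -/
def dotPoly (c : ι → k) : MvPolynomial ι k := ∑ j, C (c j) * X j

lemma eval_dotPoly (c v : ι → k) : eval v (dotPoly c) = ∑ j, c j * v j := by simp [dotPoly]

lemma aeval_dotPoly {A : Type*} [CommRing A] [Algebra k A] (c : ι → k) (v : ι → A) :
    aeval v (dotPoly c) = ∑ j, algebraMap k A (c j) * v j := by simp [dotPoly]

lemma dotPoly_isHomogeneous (c : ι → k) : (dotPoly c).IsHomogeneous 1 :=
  IsHomogeneous.sum _ _ _ fun _ _ => isHomogeneous_C_mul_X _ _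

lemma exists_comp_comp_eq {V W : Type*} [AddCommGroup V] [Module k V] [AddCommGroup W] [Module k W]
    (f : V →ₗ[k] W) : ∃ g : W →ₗ[k] V, ∀ v, f (g (f v)) = f v := by
  obtain ⟨g, hg⟩ := LinearMap.exists_rightInverse_of_surjective f.rangeRestrict
    (LinearMap.range_rangeRestrict f)
  obtain ⟨g', hg'⟩ := LinearMap.exists_extend g
  refine ⟨g', fun v => ?_⟩
  have h1 : g' (f v) = g (f.rangeRestrict v) := LinearMap.congr_fun hg' (f.rangeRestrict v)
  rw [h1]
  exact congrArg Subtype.val (LinearMap.congr_fun hg (f.rangeRestrict v))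

/-- A form vanishing on a linear subspace lies in the ideal of the equations of the subspace. -/
lemma exists_eq_sum_of_vanishing [Infinite k] {s : ℕ} (ℓ : Fin s → ι → k) {d : ℕ}
    {Y : MvPolynomial ι k} (hY : Y.IsHomogeneous (d + 1))
    (h : ∀ v : ι → k, (∀ a, ∑ j, ℓ a j * v j = 0) → eval v Y = 0) :
    ∃ B : Fin s → MvPolynomial ι k, (∀ a, (B a).IsHomogeneous d) ∧
      Y = ∑ a, dotPoly (ℓ a) * B a := by
  classical
  let f : (ι → k) →ₗ[k] (Fin s → k) := (Matrix.of ℓ).mulVecLin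
  have hf (v a) : f v a = ∑ j, ℓ a j * v j := rfl
  obtain ⟨g, hg⟩ := exists_comp_comp_eq f
  let y : Fin s → ι → k := fun a => g (Pi.single a 1)
  have hgy (w : Fin s → k) : g w = ∑ a, w a • y a := by
    conv_lhs => rw [pi_eq_sum_univ' w]
    simp [y]
  -- With `g` a generalized inverse of `f`, the substitution v ↦ v - g(f v) is a projection onto the
  -- common zeros of the ℓ's and is the identity modulo them.
  let σ : ι → MvPolynomial ι k := fun j => X j - ∑ a, dotPoly (ℓ a) * C (y a j)
  have hσ (v : ι → k) : (fun j => eval v (σ j)) = v - g (f v) := by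
    funext j
    rw [hgy]
    simp [σ, eval_dotPoly, hf]
  have hzero : aeval σ Y = 0 := by
    refine MvPolynomial.funext fun v => ?_
    have := map_aeval_apply (aeval v : MvPolynomial ι k →ₐ[k] k) σ Y
    simp only [aeval_eq_eval, hσ] at this
    rw [map_zero]
    refine this.trans (h _ fun a => ?_)
    rw [← hf, map_sub, hg, sub_self]
    rfl
  have hmem (F : MvPolynomial ι k) :
      F - aeval σ F ∈ Ideal.span (Set.range fun a => dotPoly (ℓ a)) := by
    induction F using MvPolynomial.induction_on with
    | C a => simp
    | add p q hp hq => rw [map_add, add_sub_add_comm]; exact Ideal.add_mem _ hp hq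
    | mul_X p i hp =>
      have : p * X i - aeval σ (p * X i) =
          X i * (p - aeval σ p) + aeval σ p * (X i - σ i) := by rw [map_mul, aeval_X]; ring
      rw [this]
      refine Ideal.add_mem _ (Ideal.mul_mem_left _ _ hp) (Ideal.mul_mem_left _ _ ?_)
      simp only [σ, sub_sub_cancel]
      exact Ideal.sum_mem _ fun a _ => Ideal.mul_mem_right _ _ (Ideal.subset_span ⟨a, rfl⟩)
  have hYmem := hmem Y
  rw [hzero, sub_zero] at hYmem
  obtain ⟨B, hB⟩ := (Ideal.mem_span_range_iff_exists_fun).mp hYmem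
  refine ⟨fun a => homogeneousComponent d (B a), fun a => homogeneousComponent_isHomogeneous _ _, ?_⟩
  have := congrArg (homogeneousComponent (d + 1)) hB
  rw [homogeneousComponent_eq_self hY, map_sum] at this
  rw [← this]
  exact Finset.sum_congr rfl fun a _ => by
    rw [mul_comm, homogeneousComponent_mul_of_isHomogeneous (dotPoly_isHomogeneous _)]

end LinearForms

/-! ### From multiplicities on the blow-up to order along arcs -/

section Multiplicity

variable {k A ι : Type*} [Field k] [CommRing A] [Algebra k A] [Fintype ι]

lemma isUnit_of_notMem_span {δ : ι → A}
    (hgen : ∀ a : A, ∃ z : k, a - algebraMap k A z ∈ Ideal.span (Set.range δ))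
    {φ : A →ₐ[k] PowerSeries k} {g : ι → PowerSeries k}
    (hφ : ∀ j, φ (δ j) = PowerSeries.X * g j) {s : A} (hs : s ∉ Ideal.span (Set.range δ)) :
    IsUnit (φ s) := by
  obtain ⟨z, hz⟩ := hgen s
  have hz0 : z ≠ 0 := by
    rintro rfl
    exact hs (by simpa using hz)
  have h0 : IsLeadingForm δ 0 s (C z) := ⟨isHomogeneous_C _ _, by simpa using hz⟩
  obtain ⟨p, hp, hp0⟩ := h0.exists_eq φ g hφ
  rw [PowerSeries.isUnit_iff_constantCoeff, hp, pow_zero, one_mul, hp0, eval_C]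
  exact hz0.isUnit

/-- The order of vanishing along an arc is at least the multiplicity. -/
lemma X_pow_dvd_of_mul_mem {δ : ι → A}
    (hgen : ∀ a : A, ∃ z : k, a - algebraMap k A z ∈ Ideal.span (Set.range δ))
    {φ : A →ₐ[k] PowerSeries k} {g : ι → PowerSeries k}
    (hφ : ∀ j, φ (δ j) = PowerSeries.X * g j) {s f : A} {d : ℕ}
    (hs : s ∉ Ideal.span (Set.range δ)) (hsf : s * f ∈ Ideal.span (Set.range δ) ^ d) :
    PowerSeries.X ^ d ∣ φ f := by
  obtain ⟨Y, hY⟩ := exists_isLeadingForm hgen d hsf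
  obtain ⟨p, hp, -⟩ := hY.exists_eq φ g hφ
  rw [map_mul] at hp
  exact ((isUnit_of_notMem_span hgen hφ hs).dvd_mul_left).mp ⟨p, hp⟩

/-- The order of vanishing of a divisor along a general arc tangent to a hyperplane of the
exceptional divisor is at least the multiplicity of the divisor at the point plus that of
its strict transform along the hyperplane. -/
lemma exists_form_X_pow_dvd {δ : ι → A}
    (hgen : ∀ a : A, ∃ z : k, a - algebraMap k A z ∈ Ideal.span (Set.range δ)) {t : A}
    (ht : t ∈ Ideal.span (Set.range δ)) {W : Set (ι → k)}
    (hW : ∀ d (Y : MvPolynomial ι k), Y.IsHomogeneous (d + 1) → (∀ ρ ∈ W, eval ρ Y = 0) →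
      ∃ B : MvPolynomial ι k, B.IsHomogeneous d ∧
        aeval δ Y - t * aeval δ B ∈ Ideal.span (Set.range δ) ^ (d + 2))
    {s₁ f : A} {k₁ k₂ : ℕ} (hs₁ : s₁ ∉ Ideal.span (Set.range δ))
    (hsf : s₁ * f ∈ Ideal.span (Set.range δ) ^ k₁) {u : A} (hu : u ∈ Ideal.span (Set.range δ))
    (h : ∀ b ∈ strictTransformIdeal (Ideal.span (Set.range δ)) u f,
      ∃ s, s ∉ exceptionalHyperplaneIdeal (Ideal.span (Set.range δ)) u t ∧
        s * b ∈ exceptionalHyperplaneIdeal (Ideal.span (Set.range δ)) u t ^ k₂) :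
    ∃ N : MvPolynomial ι k, (∃ d, N.IsHomogeneous d) ∧ (∃ ρ ∈ W, eval ρ N ≠ 0) ∧
      ∀ (φ : A →ₐ[k] PowerSeries k) (g : ι → PowerSeries k),
        (∀ j, φ (δ j) = PowerSeries.X * g j) → PowerSeries.X ^ 2 ∣ φ t →
        eval (fun j => PowerSeries.constantCoeff (g j)) N ≠ 0 →
        PowerSeries.X ^ (k₁ + k₂) ∣ φ f := by
  set m := Ideal.span (Set.range δ) with hm
  -- The quotient b = s₁f/u^(k₁) is an equation in the strict transform.
  obtain ⟨b, hb⟩ := exists_blowupChart_mul_pow_eq (u := u) hsf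
  have hbJ : b ∈ strictTransformIdeal m u f := by
    rw [strictTransformIdeal, Ideal.mem_comap, Ideal.mem_span_singleton]
    have hunit : IsUnit (algebraMap A (Localization.Away u) u ^ k₁) :=
      (IsLocalization.Away.algebraMap_isUnit u).pow k₁
    refine hunit.dvd_mul_right.mp ⟨algebraMap A _ s₁, ?_⟩
    have := congrArg Subtype.val hb
    rw [map_mul] at this
    exact this.trans (mul_comm _ _)
  obtain ⟨s, hs, hsb⟩ := h b hbJ
  obtain ⟨d, y, hy, hsy⟩ := exists_pow_blowupChart hu s
  -- Here s = y/u^d. Taking the leading form of yu rather than y ensures that where N is nonzero,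
  -- both s is a unit along the lifted arc and the arc lifts to this chart.
  obtain ⟨N, hN⟩ := exists_isLeadingForm hgen (d + 1) (y := y * u) (by
    rw [pow_succ]; exact Ideal.mul_mem_mul hy hu)
  refine ⟨N, ⟨_, hN.1⟩, ?_, ?_⟩
  -- If N vanished on W, then by `hW` its value at the generators of m would be a multiple of t
  -- modulo a higher power of m, placing s in the ideal of the exceptional hyperplane.
  · by_contra! hcon
    obtain ⟨B, hB, hmem⟩ := hW d N hN.1 hcon
    obtain ⟨zt, hzt⟩ := exists_blowupChart_mul_eq (u := u) ht
    obtain ⟨zb, hzb⟩ := exists_blowupChart_mul_pow_eq (u := u) (aeval_mem_span_pow δ hB)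
    apply hs
    have h1 : s - zt * zb ∈ exceptionalIdeal m u := by
      refine mem_exceptionalIdeal_of_pow (k := d + 1) (y := y * u - t * aeval δ B) ?_ ?_
      · have := Ideal.add_mem _ hN.2 hmem
        rwa [sub_add_sub_cancel] at this
      · rw [map_sub, map_mul, map_mul, ← hsy, ← hzt, ← hzb]
        ring
    rw [← sub_add_cancel s (zt * zb)]
    refine Ideal.add_mem _ (Ideal.mem_sup_left h1) (Ideal.mul_mem_right _ _ ?_)
    exact Ideal.mem_sup_right (Ideal.subset_span (congrArg Subtype.val hzt))
  · intro φ g hφ hφt hne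
    obtain ⟨p, hp, hp0⟩ := hN.exists_eq φ g hφ
    obtain ⟨Yu, hYu⟩ := exists_isLeadingForm (k := k) hgen 1 (y := u) (by rwa [pow_one])
    obtain ⟨p₁, hp₁, -⟩ := hYu.exists_eq φ g hφ
    obtain ⟨Yy, hYy⟩ := exists_isLeadingForm (k := k) hgen d hy
    obtain ⟨p₂, hp₂, -⟩ := hYy.exists_eq φ g hφ
    rw [pow_one] at hp₁
    have hX : (PowerSeries.X : PowerSeries k) ≠ 0 := PowerSeries.X_ne_zero
    have hpu : IsUnit (p₂ * p₁) := by
      have : PowerSeries.X ^ (d + 1) * (p₂ * p₁) = PowerSeries.X ^ (d + 1) * p := by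
        rw [← hp, map_mul, hp₁, hp₂]; ring
      rw [mul_left_cancel₀ (pow_ne_zero _ hX) this, PowerSeries.isUnit_iff_constantCoeff, hp0]
      exact hne.isUnit
    have hu₁ : IsUnit p₁ := isUnit_of_mul_isUnit_right hpu
    have hu₂ : IsUnit p₂ := isUnit_of_mul_isUnit_left hpu
    have hXm (a : A) (ha : a ∈ m) : PowerSeries.X ∣ φ a := by
      obtain ⟨Y, hY⟩ := exists_isLeadingForm (k := k) hgen 1 (y := a) (by rwa [pow_one])
      obtain ⟨p, hp, -⟩ := hY.exists_eq φ g hφ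
      exact ⟨p, by rw [hp, pow_one]⟩
    -- The lift of the arc to the chart, available because φ(u) has order exactly one.
    obtain ⟨Φ, hΦ⟩ := exists_blowupChart_hom (m := m) (u := u) (φ : A →+* PowerSeries k)
      (by
        change φ u ≠ 0
        rw [hp₁]
        exact mul_ne_zero hX hu₁.ne_zero) (fun a ha => by
        change φ u ∣ φ a
        rw [hp₁, hu₁.mul_right_dvd]
        exact hXm a ha)
    replace hΦ (a : A) : Φ (algebraMap A _ a) = φ a := hΦ a
    have hP : exceptionalHyperplaneIdeal m u t ≤ (Ideal.span {PowerSeries.X}).comap Φ := by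
      refine sup_le (Ideal.map_le_iff_le_comap.mpr fun a ha => ?_) (Ideal.span_le.mpr fun z hz => ?_)
      · rw [Ideal.mem_comap, Ideal.mem_comap, hΦ, Ideal.mem_span_singleton]
        exact hXm a ha
      · have hz' : z * algebraMap A _ u = algebraMap A _ t := Subtype.ext hz
        have h1 := congrArg Φ hz'
        rw [map_mul, hΦ, hΦ, hp₁] at h1
        obtain ⟨r, hr⟩ := hφt
        rw [SetLike.mem_coe, Ideal.mem_comap, Ideal.mem_span_singleton]
        refine hu₁.dvd_mul_right.mp ⟨r, mul_left_cancel₀ hX ?_⟩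
        rw [hr] at h1
        linear_combination h1
    have hs' : IsUnit (Φ s) := by
      have h1 := congrArg Φ hsy
      rw [map_mul, map_pow, hΦ, hΦ, hp₁, hp₂] at h1
      have h2 : Φ s * p₁ ^ d = p₂ := mul_left_cancel₀ (pow_ne_zero d hX) (by
        rw [← h1, mul_pow]; ring)
      exact isUnit_of_mul_isUnit_left (h2 ▸ hu₂)
    have hb' : PowerSeries.X ^ k₂ ∣ Φ b := by
      have h1 := Ideal.le_comap_pow Φ k₂ (Ideal.pow_right_mono hP k₂ hsb)
      rw [Ideal.mem_comap, Ideal.span_singleton_pow, Ideal.mem_span_singleton, map_mul] at h1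
      exact hs'.dvd_mul_left.mp h1
    -- Comparing both sides of b u^(k₁) = s₁f along the lift: the strict transform contributes `k₂`,
    -- the powers of u contribute `k₁`, and s₁ is a unit.
    have h1 := congrArg Φ hb
    rw [map_mul, map_pow, hΦ, hΦ, hp₁, map_mul] at h1
    refine (isUnit_of_notMem_span hgen hφ hs₁).dvd_mul_left.mp ?_
    rw [← h1, add_comm, pow_add, mul_pow, ← mul_assoc]
    exact (mul_dvd_mul hb' (dvd_refl _)).mul_right _

lemma exists_lt_of_lt_iSup {S : Set ℕ} {n : ℕ} (h : (n : ℕ∞) < ⨆ k ∈ S, (k : ℕ∞)) :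
    ∃ k ∈ S, n < k := by
  obtain ⟨k, hk⟩ := lt_iSup_iff.mp h
  obtain ⟨hkS, hk⟩ := lt_iSup_iff.mp hk
  exact ⟨k, hkS, by exact_mod_cast hk⟩

/-- The bounds are stated with `k₁ - 1` and `k₂ - 1` because a supremum strictly above k - 1
provides an admissible exponent at least k. An infinite multiplicity alone supplies `n + 1`. -/
lemma exists_le_add_of_lt_add {a b : ℕ∞} {n : ℕ} (h : (n : ℕ∞) < a + b) :
    ∃ k₁ k₂ : ℕ, n < k₁ + k₂ ∧ (k₁ = 0 ∨ ((k₁ - 1 : ℕ) : ℕ∞) < a) ∧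
      (k₂ = 0 ∨ ((k₂ - 1 : ℕ) : ℕ∞) < b) := by
  by_cases ha : a = ⊤
  · exact ⟨n + 1, 0, by omega, Or.inr (by rw [ha]; exact ENat.natCast_lt_top _), Or.inl rfl⟩
  by_cases hb : b = ⊤
  · exact ⟨0, n + 1, by omega, Or.inl rfl, Or.inr (by rw [hb]; exact ENat.natCast_lt_top _)⟩
  lift a to ℕ using ha
  lift b to ℕ using hb
  refine ⟨a, b, by exact_mod_cast h, ?_, ?_⟩
  · rcases Nat.eq_zero_or_pos a with h | h
    · exact Or.inl h
    · exact Or.inr (by exact_mod_cast Nat.sub_lt h one_pos)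
  · rcases Nat.eq_zero_or_pos b with h | h
    · exact Or.inl h
    · exact Or.inr (by exact_mod_cast Nat.sub_lt h one_pos)

/-- When the strict transform is not needed, the multiplicity at the point suffices and N = 1
imposes no condition. -/
lemma exists_form_of_lt_mult {δ : ι → A}
    (hgen : ∀ a : A, ∃ z : k, a - algebraMap k A z ∈ Ideal.span (Set.range δ))
    (hm : Ideal.span (Set.range δ) ≠ ⊤) {t : A} (ht : t ∈ Ideal.span (Set.range δ))
    {W : Set (ι → k)} (hW0 : W.Nonempty)
    (hW : ∀ d (Y : MvPolynomial ι k), Y.IsHomogeneous (d + 1) → (∀ ρ ∈ W, eval ρ Y = 0) →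
      ∃ B : MvPolynomial ι k, B.IsHomogeneous d ∧
        aeval δ Y - t * aeval δ B ∈ Ideal.span (Set.range δ) ^ (d + 2))
    {f : A} {n : ℕ} (h : (n : ℕ∞) < multAlong (Ideal.span (Set.range δ)) (Ideal.span {f}) +
      multStrictTransform (Ideal.span (Set.range δ)) f t) :
    ∃ N : MvPolynomial ι k, (∃ d, N.IsHomogeneous d) ∧ (∃ ρ ∈ W, eval ρ N ≠ 0) ∧
      ∀ (φ : A →ₐ[k] PowerSeries k) (g : ι → PowerSeries k),
        (∀ j, φ (δ j) = PowerSeries.X * g j) → PowerSeries.X ^ 2 ∣ φ t →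
        eval (fun j => PowerSeries.constantCoeff (g j)) N ≠ 0 →
        PowerSeries.X ^ (n + 1) ∣ φ f := by
  obtain ⟨k₁, k₂, hk, h₁, h₂⟩ := exists_le_add_of_lt_add h
  obtain ⟨s₁, hs₁, hsf⟩ : ∃ s₁, s₁ ∉ Ideal.span (Set.range δ) ∧
      s₁ * f ∈ Ideal.span (Set.range δ) ^ k₁ := by
    rcases h₁ with rfl | h₁
    · exact ⟨1, (Ideal.ne_top_iff_one _).mp hm, by simp⟩
    · obtain ⟨e, he, hlt⟩ := exists_lt_of_lt_iSup h₁
      obtain ⟨s, hs, hsf⟩ := he f (Ideal.mem_span_singleton_self f)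
      exact ⟨s, hs, Ideal.pow_le_pow_right (by omega) hsf⟩
  rcases h₂ with rfl | h₂
  · obtain ⟨ρ, hρ⟩ := hW0
    refine ⟨1, ⟨0, isHomogeneous_one _ _⟩, ⟨ρ, hρ, by simp⟩, fun φ g hφ _ _ => ?_⟩
    exact (pow_dvd_pow _ (by omega)).trans (X_pow_dvd_of_mul_mem hgen hφ hs₁ hsf)
  · obtain ⟨u, hu⟩ := lt_iSup_iff.mp h₂
    obtain ⟨⟨hum, -⟩, hu⟩ := lt_iSup_iff.mp hu
    obtain ⟨e, he, hlt⟩ := exists_lt_of_lt_iSup hu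
    obtain ⟨N, hN, hN', hNφ⟩ := exists_form_X_pow_dvd hgen ht hW hs₁ hsf hum he
    refine ⟨N, hN, hN', fun φ g h1 h2 h3 => (pow_dvd_pow _ ?_).trans (hNφ φ g h1 h2 h3)⟩
    omega

end Multiplicity

/-! ### The vector dual to a linear form -/

section DualVector

variable {k ι : Type*} [Field k] [Fintype ι] [DecidableEq ι]

/-- The vector representing the linear form with coefficients `c`. -/
def dualVec (G : Matrix ι ι k) {R : Type*} [CommRing R] [Algebra k R] (c : ι → R) : ι → R :=
  fun j => ∑ l, algebraMap k R (G⁻¹ j l) * c l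

lemma bil_dualVec {G : Matrix ι ι k} (hG : G.IsSymm) (hdet : IsUnit G.det) {R : Type*}
    [CommRing R] [Algebra k R] (c v : ι → R) : bil G (dualVec G c) v = ∑ l, c l * v l := by
  rw [bil_eq_dotProduct]
  refine Finset.sum_congr rfl fun l _ => ?_
  congr 1
  have h (m : ι) : ∑ j, G j l * G⁻¹ j m = if l = m then 1 else 0 := by
    have := congrFun (congrFun (Matrix.mul_nonsing_inv G hdet) l) m
    rw [Matrix.mul_apply, Matrix.one_apply] at this
    rw [← this]
    exact Finset.sum_congr rfl fun j _ => by rw [hG.apply]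
  simp only [dualVec, Finset.mul_sum, ← mul_assoc, ← map_mul]
  rw [Finset.sum_comm]
  simp only [← Finset.sum_mul, ← map_sum, h]
  simp

end DualVector

lemma mul_mem_pow_add {A : Type*} [CommRing A] {m : Ideal A} {s t : ℕ} {a b : A}
    (ha : a ∈ m ^ s) (hb : b ∈ m ^ t) : a * b ∈ m ^ (s + t) := by
  rw [pow_add]
  exact Ideal.mul_mem_mul ha hb

/-! ### The local ring of the quadric in an affine chart -/

section ChartRing

variable {M : ℕ} {G : Matrix (Fin (M + 1)) (Fin (M + 1)) ℂ}

lemma quadric_eq_quadPoly (G : Matrix (Fin (M + 1)) (Fin (M + 1)) ℂ) : quadric G = quadPoly G := rfl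

/-- Morphisms out of the coordinate ring of a chart of the quadric. -/
def chartLift {R : Type*} [CommRing R] [Algebra ℂ R] (i : Fin (M + 1)) (v : Fin (M + 1) → R)
    (hv : bil G v v = 0) (hi : v i = 1) : ChartRing G i →ₐ[ℂ] R :=
  Ideal.Quotient.liftₐ _ (aeval v) fun a ha => by
    have hle : Ideal.span {quadric G, X i - 1} ≤ RingHom.ker (aeval v : _ →ₐ[ℂ] R) := by
      rw [Ideal.span_le]
      rintro f (rfl | rfl)
      · rw [SetLike.mem_coe, RingHom.mem_ker, quadric_eq_quadPoly, aeval_quadPoly, hv]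
      · simp [hi]
    exact hle ha

lemma chartLift_chartEquation {R : Type*} [CommRing R] [Algebra ℂ R] (i : Fin (M + 1))
    (v : Fin (M + 1) → R) (hv : bil G v v = 0) (hi : v i = 1) (f : MvPolynomial (Fin (M + 1)) ℂ) :
    chartLift i v hv hi (chartEquation G i f) = aeval v f := rfl

/-- The generators of the maximal ideal of a point. -/
def chartGen (G : Matrix (Fin (M + 1)) (Fin (M + 1)) ℂ) (i : Fin (M + 1)) (x : Fin (M + 1) → ℂ)
    (j : Fin (M + 1)) : ChartRing G i := chartEquation G i (X j - C (x j / x i))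

lemma pointIdeal_eq (G : Matrix (Fin (M + 1)) (Fin (M + 1)) ℂ) (i : Fin (M + 1))
    (x : Fin (M + 1) → ℂ) : pointIdeal G i x = Ideal.span (Set.range (chartGen G i x)) := rfl

lemma chartEquation_eq_aeval (i : Fin (M + 1)) (f : MvPolynomial (Fin (M + 1)) ℂ) :
    chartEquation G i f = aeval (fun j => chartEquation G i (X j)) f := by
  have := map_aeval_apply (Ideal.Quotient.mkₐ ℂ (Ideal.span {quadric G, X i - 1})) X f
  rw [aeval_X_left_apply] at this
  exact this

lemma chartEquation_X (i : Fin (M + 1)) (x : Fin (M + 1) → ℂ) (j : Fin (M + 1)) :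
    chartEquation G i (X j) = chartGen G i x j + algebraMap ℂ _ (x j / x i) := by
  have h : (X j : MvPolynomial (Fin (M + 1)) ℂ) = (X j - C (x j / x i)) + C (x j / x i) := by ring
  conv_lhs => rw [h]
  exact map_add (Ideal.Quotient.mk _) _ _

lemma chartEquation_X_self (i : Fin (M + 1)) : chartEquation G i (X i) = 1 := by
  have : (Ideal.Quotient.mk (Ideal.span {quadric G, X i - 1})) (X i - 1) = 0 :=
    Ideal.Quotient.eq_zero_iff_mem.mpr (Ideal.subset_span (by simp))
  rw [map_sub, map_one, sub_eq_zero] at this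
  exact this

lemma bil_chartEquation_X (i : Fin (M + 1)) :
    bil G (fun j => chartEquation G i (X j)) (fun j => chartEquation G i (X j)) = 0 := by
  have h0 : chartEquation G i (quadric G) = 0 :=
    Ideal.Quotient.eq_zero_iff_mem.mpr (Ideal.subset_span (by simp))
  rw [chartEquation_eq_aeval] at h0
  exact (aeval_quadPoly G fun j => chartEquation G i (X j)).symm.trans h0

lemma exists_sub_algebraMap_mem (i : Fin (M + 1)) (x : Fin (M + 1) → ℂ) (a : ChartRing G i) :
    ∃ z : ℂ, a - algebraMap ℂ _ z ∈ Ideal.span (Set.range (chartGen G i x)) := by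
  obtain ⟨p, rfl⟩ := Ideal.Quotient.mk_surjective a
  change ∃ z : ℂ, chartEquation G i p - algebraMap ℂ _ z ∈ _
  induction p using MvPolynomial.induction_on with
  | C a =>
    refine ⟨a, ?_⟩
    have : chartEquation G i (C a) = algebraMap ℂ _ a := rfl
    rw [this, sub_self]
    exact Ideal.zero_mem _
  | add p q hp hq =>
    obtain ⟨z, hz⟩ := hp
    obtain ⟨z', hz'⟩ := hq
    refine ⟨z + z', ?_⟩
    have : chartEquation G i (p + q) = chartEquation G i p + chartEquation G i q :=
      map_add (Ideal.Quotient.mk _) _ _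
    rw [this, map_add, add_sub_add_comm]
    exact Ideal.add_mem _ hz hz'
  | mul_X p j hp =>
    obtain ⟨z, hz⟩ := hp
    refine ⟨z * (x j / x i), ?_⟩
    have h1 : chartEquation G i (p * X j) = chartEquation G i p * chartEquation G i (X j) :=
      map_mul (Ideal.Quotient.mk _) _ _
    have h2 : chartEquation G i p * chartEquation G i (X j) - algebraMap ℂ _ (z * (x j / x i)) =
        chartEquation G i p * chartGen G i x j +
          algebraMap ℂ _ (x j / x i) * (chartEquation G i p - algebraMap ℂ _ z) := by
      rw [chartEquation_X i x j, map_mul]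
      ring
    rw [h1, h2]
    exact Ideal.add_mem _ (Ideal.mul_mem_left _ _ (Ideal.subset_span ⟨j, rfl⟩))
      (Ideal.mul_mem_left _ _ hz)

variable {i : Fin (M + 1)} {x : Fin (M + 1) → ℂ}

lemma span_chartGen_ne_top (hx : bil G x x = 0) (hi : x i ≠ 0) :
    Ideal.span (Set.range (chartGen G i x)) ≠ ⊤ := by
  have hv : bil G ((x i)⁻¹ • x) ((x i)⁻¹ • x) = 0 := by
    rw [bil_smul_left, bil_smul_right, hx, mul_zero, mul_zero]
  let φ := chartLift (G := G) i ((x i)⁻¹ • x) hv (by simp [hi])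
  have hle : Ideal.span (Set.range (chartGen G i x)) ≤ RingHom.ker φ := by
    rw [Ideal.span_le]
    rintro _ ⟨j, rfl⟩
    rw [SetLike.mem_coe, RingHom.mem_ker]
    change aeval _ (X j - C (x j / x i)) = (0 : ℂ)
    simp [div_eq_inv_mul]
  intro h
  rw [h, top_le_iff] at hle
  exact RingHom.ker_ne_top φ hle

lemma chartGen_self (hi : x i ≠ 0) : chartGen G i x i = 0 := by
  have := chartEquation_X (G := G) i x i
  rw [chartEquation_X_self, div_self hi, map_one] at this
  linear_combination -this

/-- The tangent hyperplane of the quadric is singular at the point of tangency. -/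
lemma bil_chartGen_mem (hG : G.IsSymm) (hx : bil G x x = 0) (hi : x i ≠ 0) :
    bil G (ext _ x) (chartGen G i x) ∈ Ideal.span (Set.range (chartGen G i x)) ^ 2 := by
  -- The coordinates are x/x_i plus the generators δ of m. Expanding the equation of Q gives (2/x_i)
  -- b(x, δ) = -q(δ), which lies in m².
  have h1 : (fun j => chartEquation G i (X j)) =
      chartGen G i x + algebraMap ℂ (ChartRing G i) (x i)⁻¹ • ext _ x := by
    funext j
    rw [chartEquation_X i x j, Pi.add_apply, Pi.smul_apply, ext, smul_eq_mul, ← map_mul,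
      div_eq_inv_mul]
  have h2 := bil_chartEquation_X (G := G) i
  rw [h1] at h2
  simp only [bil_add_left, bil_add_right, bil_smul_left, bil_smul_right, bil_ext, hx, map_zero,
    mul_zero, add_zero, bil_comm hG (chartGen G i x) (ext _ x)] at h2
  have h3 : bil G (chartGen G i x) (chartGen G i x) ∈
      Ideal.span (Set.range (chartGen G i x)) ^ 2 := by
    rw [← aeval_quadPoly]
    exact aeval_mem_span_pow _ (quadPoly_isHomogeneous G)
  have h4 : bil G (ext _ x) (chartGen G i x) =
      algebraMap ℂ (ChartRing G i) (-(x i) / 2) * bil G (chartGen G i x) (chartGen G i x) := by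
    have h5 : algebraMap ℂ (ChartRing G i) (-(x i) / 2) * algebraMap ℂ (ChartRing G i) (x i)⁻¹ * 2 =
        -1 := by
      have : algebraMap ℂ (ChartRing G i) 2 = 2 := map_ofNat _ _
      rw [← this, ← map_mul, ← map_mul, ← map_one (algebraMap ℂ (ChartRing G i)), ← map_neg]
      congr 1
      field_simp
    linear_combination bil G (ext _ x) (chartGen G i x) * h5 -
      algebraMap ℂ (ChartRing G i) (-(x i) / 2) * h2
  rw [h4]
  exact Ideal.mul_mem_left _ _ h3

lemma sum_mul_chartGen {c : Fin (M + 1) → ℂ} (hc : ∑ j, c j * x j = 0) :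
    ∑ j, algebraMap ℂ _ (c j) * chartGen G i x j = chartEquation G i (linearForm c) := by
  have h1 : chartEquation G i (linearForm c) =
      ∑ j, algebraMap ℂ _ (c j) * chartEquation G i (X j) := by
    rw [chartEquation_eq_aeval, linearForm]
    simp
  rw [h1]
  simp only [chartEquation_X i x, mul_add, Finset.sum_add_distrib]
  have : ∑ j, algebraMap ℂ (ChartRing G i) (c j) * algebraMap ℂ _ (x j / x i) = 0 := by
    simp only [← map_mul, ← map_sum]
    rw [← map_zero (algebraMap ℂ (ChartRing G i))]
    congr 1
    simp only [div_eq_mul_inv, ← mul_assoc, ← Finset.sum_mul, hc, zero_mul]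
  rw [this, add_zero]

/-- The tangent directions of the hyperplane `c` at the point `x`. -/
def tangentDirections (G : Matrix (Fin (M + 1)) (Fin (M + 1)) ℂ) (i : Fin (M + 1))
    (x c : Fin (M + 1) → ℂ) : Set (Fin (M + 1) → ℂ) :=
  {ρ | ρ i = 0 ∧ bil G x ρ = 0 ∧ ∑ j, c j * ρ j = 0}

/-- The directions are cut out by three linear forms. On the generators of m, the i-th coordinate is
zero and b(x, ·) lies in m², so modulo m^(d+2) only the multiple of c survives. This supplies the
hypothesis `hW` of `exists_form_of_lt_mult`. -/
lemma exists_form_of_vanishing_on_tangentDirections (hG : G.IsSymm) (hx : bil G x x = 0)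
    (hi : x i ≠ 0) {c : Fin (M + 1) → ℂ} (hc : ∑ j, c j * x j = 0) (d : ℕ)
    (Y : MvPolynomial (Fin (M + 1)) ℂ) (hY : Y.IsHomogeneous (d + 1))
    (h : ∀ ρ ∈ tangentDirections G i x c, eval ρ Y = 0) :
    ∃ B : MvPolynomial (Fin (M + 1)) ℂ, B.IsHomogeneous d ∧ aeval (chartGen G i x) Y -
      chartEquation G i (linearForm c) * aeval (chartGen G i x) B ∈
        Ideal.span (Set.range (chartGen G i x)) ^ (d + 2) := by
  obtain ⟨B, hB, hYB⟩ := exists_eq_sum_of_vanishing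
    ![Pi.single i 1, fun l => ∑ j, G j l * x j, c] hY fun v hv => by
      refine h v ⟨?_, ?_, hv 2⟩
      · have := hv 0
        simpa [Pi.single_apply] using this
      · have := hv 1
        rw [bil_eq_dotProduct]
        simpa using this
  refine ⟨B 2, hB 2, ?_⟩
  rw [hYB, Fin.sum_univ_three, map_add, map_add, map_mul, map_mul, map_mul]
  simp only [aeval_dotPoly, Matrix.cons_val_zero, Matrix.cons_val_one, Matrix.cons_val_two,
    Matrix.tail_cons, Matrix.head_cons, sum_mul_chartGen hc]
  have h1 : ∑ j, algebraMap ℂ (ChartRing G i) ((Pi.single i 1 : Fin (M + 1) → ℂ) j) *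
      chartGen G i x j = 0 := by
    rw [Finset.sum_eq_single i, chartGen_self hi, mul_zero]
    · intro j _ hj
      simp [hj]
    · simp
  have h2 : ∑ l, algebraMap ℂ (ChartRing G i) (∑ j, G j l * x j) * chartGen G i x l =
      bil G (ext _ x) (chartGen G i x) := by
    rw [bil_eq_dotProduct]
    simp [ext]
  rw [h1, h2, zero_mul, zero_add, add_sub_cancel_right, add_comm d 2]
  exact mul_mem_pow_add (bil_chartGen_mem hG hx hi) (aeval_mem_span_pow _ (hB 1))

end ChartRing

/-! ### Arcs of the quadric read in an affine chart -/

section LocalArcs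

variable {M : ℕ} {G : Matrix (Fin (M + 1)) (Fin (M + 1)) ℂ} {i : Fin (M + 1)}
  {x : Fin (M + 1) → ℂ}

lemma X_pow_dvd_coe_iff {p : Polynomial ℂ} {n : ℕ} :
    PowerSeries.X ^ n ∣ (p : PowerSeries ℂ) ↔ Polynomial.X ^ n ∣ p := by
  simp [PowerSeries.X_pow_dvd_iff, Polynomial.X_pow_dvd_iff]

lemma bil_arc_self {k ι : Type*} [Field k] [Fintype ι] {R : Type*} [CommRing R] [Algebra k R]
    {G : Matrix ι ι k} (hG : G.IsSymm) {x : ι → R} (hx : bil G x x = 0) (r w : ι → R) :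
    bil G (arc G x r w) (arc G x r w) = 0 := by
  refine bil_psi_self hG ?_ _
  have h := map_bil (G := G) ((Algebra.ofId R (Polynomial R)).restrictScalars k) x x
  rw [hx, map_zero] at h
  exact h.symm

/-- Divisibility of the equation along an arc of the quadric, from divisibility along the
corresponding arc in a chart. -/
lemma X_pow_dvd_aeval_arc (hG : G.IsSymm) (hx : bil G x x = 0) (hi : x i ≠ 0)
    {c : Fin (M + 1) → ℂ} (hc : ∑ j, c j * x j = 0) {r w : Fin (M + 1) → ℂ}
    (hxr : bil G x r = 0) (hcr : ∑ j, c j * r j = 0) (hrr : bil G r r ≠ 0)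
    (hxw : bil G x w ≠ 0) {N : MvPolynomial (Fin (M + 1)) ℂ} {d : ℕ} (hN : N.IsHomogeneous d)
    (hNr : eval (fun j => r j - x j / x i * r i) N ≠ 0)
    {f : MvPolynomial (Fin (M + 1)) ℂ} {l e : ℕ} (hf : f.IsHomogeneous l)
    (h : ∀ (φ : ChartRing G i →ₐ[ℂ] PowerSeries ℂ) (g : Fin (M + 1) → PowerSeries ℂ),
      (∀ j, φ (chartGen G i x j) = PowerSeries.X * g j) →
      PowerSeries.X ^ 2 ∣ φ (chartEquation G i (linearForm c)) →
      eval (fun j => PowerSeries.constantCoeff (g j)) N ≠ 0 →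
      PowerSeries.X ^ e ∣ φ (chartEquation G i f)) :
    Polynomial.X ^ e ∣ aeval (arc G x r w) f := by
  -- The arc starts at the nonzero multiple -q(r)x, so its i-th coordinate is an invertible power
  -- series; dividing by it puts the arc in the chart.
  let γ : Fin (M + 1) → PowerSeries ℂ := fun j => (arc G x r w j : PowerSeries ℂ)
  have hγ0 (j) : PowerSeries.constantCoeff (γ j) = -bil G r r * x j := by
    have := congrFun (eval_arc_zero (G := G) hxr w) j
    simp only [Pi.smul_apply, smul_eq_mul] at this
    rw [← this, ← Polynomial.coeff_zero_eq_eval_zero]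
    simp [γ]
  have hγi : PowerSeries.constantCoeff (γ i) ≠ 0 := by
    rw [hγ0]
    exact mul_ne_zero (neg_ne_zero.mpr hrr) hi
  have hinv : γ i * (γ i)⁻¹ = 1 := PowerSeries.mul_inv_cancel _ hγi
  have hγγ : bil G γ γ = 0 := by
    have := map_bil (G := G) (Polynomial.coeToPowerSeries.algHom (R := ℂ) ℂ) (arc G x r w)
      (arc G x r w)
    rw [bil_arc_self hG hx, map_zero] at this
    simpa using this.symm
  have hv : bil G ((γ i)⁻¹ • γ) ((γ i)⁻¹ • γ) = 0 := by
    rw [bil_smul_left, bil_smul_right, hγγ, mul_zero, mul_zero]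
  let φ := chartLift (G := G) i ((γ i)⁻¹ • γ) hv (by
    rw [Pi.smul_apply, smul_eq_mul, mul_comm, hinv])
  let b : PowerSeries ℂ := PowerSeries.C (2 * bil G x w)
  let p : Fin (M + 1) → PowerSeries ℂ := fun j => PowerSeries.C (r j - x j / x i * r i) +
    PowerSeries.X * PowerSeries.C (w j - x j / x i * w i)
  -- The initial direction is r corrected by a multiple of x so that its i-th coordinate vanishes,
  -- up to the factor 2b(x, w).
  have hγp (j) : γ j - PowerSeries.C (x j / x i) * γ i = PowerSeries.X * (b * p j) := by
    have hxx : PowerSeries.C (x j) = PowerSeries.C (x j / x i) * PowerSeries.C (x i) := by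
      rw [← map_mul, div_mul_cancel₀ _ hi]
    simp only [γ, arc, psi, lineVec_eq, bil_add_right, bil_smul_right, bil_const_const, hxr,
      Pi.sub_apply, Pi.smul_apply, Pi.add_apply, smul_eq_mul, map_zero, zero_add, constVec]
    simp only [Polynomial.coe_sub, Polynomial.coe_mul, Polynomial.coe_add, Polynomial.coe_X,
      Polynomial.coe_C, b, p, map_sub, map_mul, hxx]
    have h2 : ((2 : Polynomial ℂ) : PowerSeries ℂ) = 2 := by
      exact map_ofNat Polynomial.coeToPowerSeries.ringHom 2
    have h2' : PowerSeries.C (2 : ℂ) = 2 := map_ofNat _ _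
    rw [h2, h2']
    ring
  have hφ (j) : φ (chartGen G i x j) = PowerSeries.X * (b * p j * (γ i)⁻¹) := by
    have h1 : φ (chartGen G i x j) = aeval ((γ i)⁻¹ • γ) (X j - C (x j / x i)) := rfl
    rw [h1, map_sub, aeval_X, aeval_C, Pi.smul_apply, smul_eq_mul]
    have h2 : algebraMap ℂ (PowerSeries ℂ) (x j / x i) = PowerSeries.C (x j / x i) := rfl
    rw [h2]
    linear_combination (γ i)⁻¹ * hγp j + PowerSeries.C (x j / x i) * hinv
  have hsum : ∑ j, c j * (r j - x j / x i * r i) = 0 := by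
    have : ∑ j, c j * (r j - x j / x i * r i) = ∑ j, c j * r j - (∑ j, c j * x j) * (r i / x i) := by
      rw [Finset.sum_mul, ← Finset.sum_sub_distrib]
      exact Finset.sum_congr rfl fun j _ => by field_simp
    rw [this, hc, hcr]; ring
  have key := h φ (fun j => b * p j * (γ i)⁻¹) hφ ?_ ?_
  · rw [chartLift_chartEquation, aeval_smul_of_isHomogeneous hf] at key
    have hunit : IsUnit ((γ i)⁻¹ ^ l) := (IsUnit.of_mul_eq_one _ (by rw [mul_comm]; exact hinv)).pow l
    rw [hunit.dvd_mul_left] at key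
    have h1 := map_aeval_apply (Polynomial.coeToPowerSeries.algHom (R := ℂ) ℂ) (arc G x r w) f
    rw [← X_pow_dvd_coe_iff]
    have h2 : ((aeval (arc G x r w) f : Polynomial ℂ) : PowerSeries ℂ) = aeval γ f := by
      simpa using h1
    rwa [h2]
  -- Since c kills x and r, the linear equation vanishes to order two along the arc.
  · rw [← sum_mul_chartGen hc, map_sum]
    have h1 : ∑ j, φ (algebraMap ℂ _ (c j) * chartGen G i x j) =
        PowerSeries.X * (b * (γ i)⁻¹ * ∑ j, PowerSeries.C (c j) * p j) := by
      simp only [map_mul, hφ, Finset.mul_sum, AlgHom.commutes]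
      exact Finset.sum_congr rfl fun j _ => by
        change PowerSeries.C (c j) * _ = _
        ring
    have h2 : ∑ j, PowerSeries.C (c j) * p j =
        PowerSeries.X * ∑ j, PowerSeries.C (c j) * PowerSeries.C (w j - x j / x i * w i) := by
      have h3 := congrArg (PowerSeries.C (R := ℂ)) hsum
      rw [map_sum, map_zero] at h3
      simp only [p, mul_add, Finset.sum_add_distrib, Finset.mul_sum]
      simp only [map_mul] at h3
      rw [h3, zero_add]
      exact Finset.sum_congr rfl fun j _ => by ring
    rw [h1, h2]
    exact ⟨b * (γ i)⁻¹ * ∑ j, PowerSeries.C (c j) * PowerSeries.C (w j - x j / x i * w i), by ring⟩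
  · have h1 : (fun j => PowerSeries.constantCoeff (b * p j * (γ i)⁻¹)) =
        (2 * bil G x w * (PowerSeries.constantCoeff (γ i))⁻¹) • fun j => r j - x j / x i * r i := by
      funext j
      simp [b, p]
      ring
    rw [h1, ← aeval_eq_eval, aeval_smul_of_isHomogeneous hN]
    exact mul_ne_zero (pow_ne_zero _ (mul_ne_zero (mul_ne_zero two_ne_zero hxw)
      (inv_ne_zero hγi))) hNr

end LocalArcs

/-! ### Extension of the order bound to all arcs -/

section Density

variable {k ι : Type*} [Field k] [Fintype ι] [CharZero k]

/-- The divisibility along the arcs is a closed condition on the arcs. -/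
lemma X_pow_dvd_aeval_arc_of_dense {G : Matrix ι ι k} {x c : ι → k} {f : MvPolynomial ι k} {e : ℕ}
    {P : (ι → k) → Prop} {r₀ w₀ : ι → k}
    (h : ∀ r w, bil G x r = 0 → ∑ j, c j * r j = 0 → P r → bil G x w ≠ 0 →
      Polynomial.X ^ e ∣ aeval (arc G x r w) f)
    (hxr₀ : bil G x r₀ = 0) (hcr₀ : ∑ j, c j * r₀ j = 0) (hxw₀ : bil G x w₀ ≠ 0)
    (hP : ∀ r, ∃ d : Polynomial k, d ≠ 0 ∧ ∀ s, d.eval s ≠ 0 → P (r + s • (r₀ - r)))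
    {r : ι → k} (w : ι → k) (hxr : bil G x r = 0) (hcr : ∑ j, c j * r j = 0) :
    Polynomial.X ^ e ∣ aeval (arc G x r w) f := by
  rw [Polynomial.X_pow_dvd_iff]
  intro m hm
  obtain ⟨d, hd, hdP⟩ := hP r
  -- The m-th coefficient of f on arcs whose parameters move from (r, w) towards (r₀, w₀). It
  -- vanishes for almost all s, hence at s = 0.
  set p : Polynomial k := (aeval (arc G (constVec x) (lineVec r (r₀ - r))
    (lineVec w (w₀ - w))) f).coeff m with hp
  have hpe (s : k) : p.eval s = (aeval (arc G x (r + s • (r₀ - r)) (w + s • (w₀ - w))) f).coeff m := by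
    have := coeff_aeval_arc G (evalHom k s) (constVec x) (lineVec r (r₀ - r))
      (lineVec w (w₀ - w)) f m
    simp only [evalHom_apply, eval_constVec, eval_lineVec] at this
    exact this
  have hw : bil G (constVec x) (lineVec w (w₀ - w)) ≠ 0 := by
    intro h0
    have := eval_bil G (constVec x) (lineVec w (w₀ - w)) 1
    rw [h0, eval_constVec, eval_lineVec, one_smul, add_sub_cancel] at this
    exact hxw₀ (by simpa using this.symm)
  have hp0 : p = 0 := by
    refine polynomial_eq_zero_of_forall_eval (mul_ne_zero hd hw) fun s hs => ?_
    rw [Polynomial.eval_mul, eval_bil, eval_constVec, eval_lineVec] at hs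
    rw [hpe]
    refine Polynomial.X_pow_dvd_iff.mp (h _ _ ?_ ?_ (hdP s (left_ne_zero_of_mul hs))
      (right_ne_zero_of_mul hs)) m hm
    · simp [bil_add_right, bil_smul_right, bil_sub_right, hxr, hxr₀]
    · have : ∑ j, c j * (r + s • (r₀ - r)) j =
          (1 - s) * ∑ j, c j * r j + s * ∑ j, c j * r₀ j := by
        rw [Finset.mul_sum, Finset.mul_sum, ← Finset.sum_add_distrib]
        refine Finset.sum_congr rfl fun j _ => ?_
        simp only [Pi.add_apply, Pi.smul_apply, Pi.sub_apply, smul_eq_mul]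
        ring
      rw [this, hcr, hcr₀]; ring
  have := hpe 0
  rw [hp0, zero_smul, zero_smul, add_zero, add_zero] at this
  simpa using this.symm

end Density

/-! ### Order along arcs at a closed point -/

section LocalTheorem

variable {M : ℕ} {G : Matrix (Fin (M + 1)) (Fin (M + 1)) ℂ}

/-- The product of the quadratic form and of `N` along the line through `a` in direction `b`. -/
def directionPoly (G : Matrix (Fin (M + 1)) (Fin (M + 1)) ℂ) (i : Fin (M + 1))
    (x : Fin (M + 1) → ℂ) (N : MvPolynomial (Fin (M + 1)) ℂ) (a b : Fin (M + 1) → ℂ) :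
    Polynomial ℂ :=
  bil G (lineVec a b) (lineVec a b) *
    aeval (fun j => lineVec a b j - Polynomial.C (x j / x i) * lineVec a b i) N

lemma eval_directionPoly (i : Fin (M + 1)) (x : Fin (M + 1) → ℂ)
    (N : MvPolynomial (Fin (M + 1)) ℂ) (a b : Fin (M + 1) → ℂ) (s : ℂ) :
    (directionPoly G i x N a b).eval s = bil G (a + s • b) (a + s • b) *
      eval (fun j => (a + s • b) j - x j / x i * (a + s • b) i) N := by
  rw [directionPoly, Polynomial.eval_mul, eval_bil, eval_lineVec, eval_aeval, aeval_eq_eval]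
  congr 2
  have h1 (j) := congrFun (eval_lineVec a b s) j
  simp only [Polynomial.eval_sub, Polynomial.eval_mul, Polynomial.eval_C, h1]

/-- A form not vanishing on the tangent directions of a hyperplane does not vanish at some
anisotropic tangent direction. -/
lemma exists_anisotropic_eval_ne_zero (hG : G.IsSymm) (hdet : IsUnit G.det) (hM : 5 ≤ M + 1)
    {i : Fin (M + 1)} {x c ρ : Fin (M + 1) → ℂ} {N : MvPolynomial (Fin (M + 1)) ℂ}
    (hρ : ρ ∈ tangentDirections G i x c) (hNρ : eval ρ N ≠ 0) :
    ∃ r, bil G x r = 0 ∧ ∑ j, c j * r j = 0 ∧ bil G r r ≠ 0 ∧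
      eval (fun j => r j - x j / x i * r i) N ≠ 0 := by
  obtain ⟨hρi, hxρ, hcρ⟩ := hρ
  have hdet' : IsUnit (G.map (algebraMap ℂ ℂ)).det := by simpa using hdet
  obtain ⟨r₁, hxr₁, hcr₁, hrr₁⟩ := exists_anisotropic hG hdet' (by simpa using hM) x
    (dualVec G c)
  rw [bil_dualVec hG hdet] at hcr₁
  -- On the line from r₁ to ρ, the quadratic factor is nonzero at parameter 0 and the N-factor at
  -- parameter 1.
  have hne : directionPoly G i x N r₁ (ρ - r₁) ≠ 0 := by
    refine mul_ne_zero (fun h0 => ?_) fun h0 => ?_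
    · have := eval_bil G (lineVec r₁ (ρ - r₁)) (lineVec r₁ (ρ - r₁)) 0
      rw [h0, eval_lineVec, zero_smul, add_zero] at this
      exact hrr₁ (by simpa using this.symm)
    · have := eval_aeval (fun j => lineVec r₁ (ρ - r₁) j -
        Polynomial.C (x j / x i) * lineVec r₁ (ρ - r₁) i) N 1
      rw [h0, aeval_eq_eval] at this
      have h1 (j) := congrFun (eval_lineVec r₁ (ρ - r₁) 1) j
      simp only [one_smul, add_sub_cancel] at h1
      simp only [Polynomial.eval_sub, Polynomial.eval_mul, Polynomial.eval_C, h1, hρi, mul_zero,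
        sub_zero, Polynomial.eval_zero] at this
      exact hNρ this.symm
  obtain ⟨s, hs⟩ := exists_algebraMap_eval_ne_zero (k := ℂ) hne
  rw [Algebra.algebraMap_self_apply, eval_directionPoly] at hs
  refine ⟨_, ?_, ?_, left_ne_zero_of_mul hs, right_ne_zero_of_mul hs⟩
  · simp [bil_add_right, bil_smul_right, bil_sub_right, hxr₁, hxρ]
  · have : ∑ j, c j * (r₁ + s • (ρ - r₁)) j =
        (1 - s) * ∑ j, c j * r₁ j + s * ∑ j, c j * ρ j := by
      rw [Finset.mul_sum, Finset.mul_sum, ← Finset.sum_add_distrib]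
      refine Finset.sum_congr rfl fun j _ => ?_
      simp only [Pi.add_apply, Pi.smul_apply, Pi.sub_apply, smul_eq_mul]
      ring
    rw [this, hcr₁, hcρ]; ring

/-- The multiplicities of a divisor at a point and of its strict transform along a hyperplane of
the exceptional divisor bound the order of vanishing along arcs tangent to this hyperplane. -/
theorem X_pow_dvd_of_lt_mult (hG : G.IsSymm) (hdet : IsUnit G.det) (hM : 5 ≤ M + 1)
    {i : Fin (M + 1)} {x : Fin (M + 1) → ℂ} (hx : bil G x x = 0) (hi : x i ≠ 0)
    {c : Fin (M + 1) → ℂ} (hc : ∑ j, c j * x j = 0) {f : MvPolynomial (Fin (M + 1)) ℂ} {l n : ℕ}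
    (hf : f.IsHomogeneous l)
    (h : (n : ℕ∞) < multAlong (pointIdeal G i x) (Ideal.span {chartEquation G i f}) +
      multStrictTransform (pointIdeal G i x) (chartEquation G i f)
        (chartEquation G i (linearForm c)))
    {r : Fin (M + 1) → ℂ} (w : Fin (M + 1) → ℂ) (hxr : bil G x r = 0)
    (hcr : ∑ j, c j * r j = 0) :
    Polynomial.X ^ (n + 1) ∣ aeval (arc G x r w) f := by
  have hdet' : IsUnit (G.map (algebraMap ℂ ℂ)).det := by simpa using hdet
  rw [pointIdeal_eq] at h
  obtain ⟨N, ⟨d, hN⟩, ⟨ρ, hρ, hNρ⟩, hφ⟩ := exists_form_of_lt_mult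
    (exists_sub_algebraMap_mem i x) (span_chartGen_ne_top hx hi)
    (t := chartEquation G i (linearForm c))
    (by
      rw [← sum_mul_chartGen hc]
      exact Ideal.sum_mem _ fun j _ => Ideal.mul_mem_left _ _ (Ideal.subset_span ⟨j, rfl⟩))
    (W := tangentDirections G i x c) ⟨0, rfl, bil_zero_right G x, by simp⟩
    (exists_form_of_vanishing_on_tangentDirections hG hx hi hc) h
  obtain ⟨w₀, hw₀⟩ : ∃ w, bil G x w ≠ 0 := by
    by_contra! hcon
    exact hi (by rw [eq_zero_of_bil_eq_zero hG hdet' hcon]; rfl)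
  obtain ⟨r₀, hxr₀, hcr₀, hrr₀, hNr₀⟩ := exists_anisotropic_eval_ne_zero hG hdet hM hρ hNρ
  refine X_pow_dvd_aeval_arc_of_dense (c := c) (P := fun r => bil G r r ≠ 0 ∧
    eval (fun j => r j - x j / x i * r i) N ≠ 0) (r₀ := r₀) (w₀ := w₀)
    (fun r w hxr hcr hr hxw => X_pow_dvd_aeval_arc hG hx hi hc hxr hcr hr.1 hxw hN hr.2 hf hφ)
    hxr₀ hcr₀ hw₀ (fun r => ⟨directionPoly G i x N r (r₀ - r), fun h0 => ?_, fun s hs => ?_⟩) w hxr hcr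
  · have := eval_directionPoly (G := G) i x N r (r₀ - r) 1
    rw [h0, one_smul, add_sub_cancel, Polynomial.eval_zero] at this
    exact mul_ne_zero hrr₀ hNr₀ this.symm
  · rw [eval_directionPoly] at hs
    exact ⟨left_ne_zero_of_mul hs, right_ne_zero_of_mul hs⟩

end LocalTheorem

/-! ### Polynomials vanishing at general points -/

section GeneralPoints

variable {k ι : Type*} [Field k] [IsAlgClosed k] [Finite ι] {I : Ideal (MvPolynomial ι k)}
  [I.IsPrime] {h : MvPolynomial ι k}

/-- A polynomial vanishing at the general points of an irreducible variety vanishes on it. -/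
lemma mem_of_forall_general (hh : h ∉ I) (hX : ∃ j, X j ∉ I) {P : MvPolynomial ι k}
    (H : ∀ x : ι → k, x ≠ 0 → (∀ f ∈ I, eval x f = 0) → eval x h ≠ 0 → eval x P = 0) : P ∈ I := by
  obtain ⟨j, hj⟩ := hX
  -- The factors X_j and h force vanishing at the points excluded by the hypothesis; the
  -- Nullstellensatz applies to the product, and primality removes them.
  have hmem : X j * h * P ∈ I := by
    rw [← IsPrime.vanishingIdeal_zeroLocus (K := k) I, mem_vanishingIdeal_iff]
    intro x hx
    rw [mem_zeroLocus_iff] at hx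
    simp only [aeval_eq_eval] at hx ⊢
    rw [map_mul, map_mul, eval_X]
    by_cases hxj : x j = 0
    · rw [hxj, zero_mul, zero_mul]
    by_cases hhx : eval x h = 0
    · rw [hhx, mul_zero, zero_mul]
    · rw [H x (fun h0 => hxj (by rw [h0]; rfl)) hx hhx, mul_zero]
  exact (‹I.IsPrime›.mem_or_mem hmem).resolve_left
    fun h1 => (‹I.IsPrime›.mem_or_mem h1).elim hj hh

lemma exists_general (hh : h ∉ I) (hX : ∃ j, X j ∉ I) :
    ∃ x : ι → k, x ≠ 0 ∧ (∀ f ∈ I, eval x f = 0) ∧ eval x h ≠ 0 := by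
  by_contra! hcon
  exact hh (mem_of_forall_general hh hX fun x hx0 hx _ => hcon x hx0 hx)

end GeneralPoints

/-! ### A denominator-free projection to the tangent hyperplane -/

section TangentProjection

variable {k ι : Type*} [Field k] [Fintype ι]

/-- A projection onto the common kernel of `b(x, ·)` and `c`, without denominators. -/
def tangentProj {R : Type*} [CommRing R] [Algebra k R] (G : Matrix ι ι k) (x c : ι → R)
    (e₁ e₂ : ι → k) (v : ι → R) : ι → R :=
  (bil G x (ext R e₁) * ∑ j, c j * ext R e₂ j - bil G x (ext R e₂) * ∑ j, c j * ext R e₁ j) • v -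
    (bil G x v * (∑ j, c j * ext R e₂ j) - (∑ j, c j * v j) * bil G x (ext R e₂)) • ext R e₁ -
    (bil G x (ext R e₁) * (∑ j, c j * v j) - (∑ j, c j * ext R e₁ j) * bil G x v) • ext R e₂

lemma bil_tangentProj {R : Type*} [CommRing R] [Algebra k R] (G : Matrix ι ι k) (x c : ι → R)
    (e₁ e₂ : ι → k) (v : ι → R) : bil G x (tangentProj G x c e₁ e₂ v) = 0 := by
  simp only [tangentProj, bil_sub_right, bil_smul_right]
  ring

lemma sum_mul_tangentProj {R : Type*} [CommRing R] [Algebra k R] (G : Matrix ι ι k) (x c : ι → R)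
    (e₁ e₂ : ι → k) (v : ι → R) : ∑ j, c j * tangentProj G x c e₁ e₂ v j = 0 := by
  have h (a₀ a₁ a₂ : R) (v₀ v₁ v₂ : ι → R) : ∑ j, c j * (a₀ • v₀ - a₁ • v₁ - a₂ • v₂) j =
      a₀ * ∑ j, c j * v₀ j - a₁ * ∑ j, c j * v₁ j - a₂ * ∑ j, c j * v₂ j := by
    simp only [Finset.mul_sum, ← Finset.sum_sub_distrib]
    refine Finset.sum_congr rfl fun j _ => ?_
    simp only [Pi.sub_apply, Pi.smul_apply, smul_eq_mul]
    ring
  rw [tangentProj, h]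
  ring

lemma map_tangentProj {R S : Type*} [CommRing R] [Algebra k R] [CommRing S] [Algebra k S]
    (φ : R →ₐ[k] S) (G : Matrix ι ι k) (x c : ι → R) (e₁ e₂ : ι → k) (v : ι → R) :
    (fun j => φ (tangentProj G x c e₁ e₂ v j)) =
      tangentProj G (fun j => φ (x j)) (fun j => φ (c j)) e₁ e₂ (fun j => φ (v j)) := by
  have he (e : ι → k) : (fun j => φ (ext R e j)) = ext S e := by
    funext j; simp [ext]
  have he' (e : ι → k) (j) : φ (ext R e j) = ext S e j := congrFun (he e) j
  funext j
  simp only [tangentProj, Pi.sub_apply, Pi.smul_apply, smul_eq_mul, map_sub, map_mul, map_sum,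
    map_bil, he']

end TangentProjection

/-! ### From general points to the generic point -/

section Transfer

/-- The coefficients of `f` along the arcs at a point tangent to the hyperplane with coefficients
`C'`, as polynomials in the coordinates of the point and the parameters of the arc. -/
def arcCoeff {k ι : Type*} [Field k] [Fintype ι] (G : Matrix ι ι k) (C' : ι → MvPolynomial ι k)
    (f : MvPolynomial ι k) (e₁ e₂ : ι → k) (m : ℕ) : MvPolynomial (ι ⊕ ι) (MvPolynomial ι k) :=
  (aeval (arc G (fun j => (C (X j) : MvPolynomial (ι ⊕ ι) (MvPolynomial ι k)))
    (tangentProj G (fun j => C (X j)) (fun j => C (C' j)) e₁ e₂ fun j => X (Sum.inl j))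
    fun j => X (Sum.inr j)) f).coeff m

lemma eval₂_arcCoeff {k ι T : Type*} [Field k] [Fintype ι] (G : Matrix ι ι k)
    (C' : ι → MvPolynomial ι k) (f : MvPolynomial ι k) (e₁ e₂ : ι → k) (m : ℕ) [CommRing T]
    [Algebra k T] (y v w : ι → T) :
    eval₂ (aeval y : MvPolynomial ι k →ₐ[k] T).toRingHom (Sum.elim v w)
      (arcCoeff G C' f e₁ e₂ m) =
        (aeval (arc G y (tangentProj G y (fun j => aeval y (C' j)) e₁ e₂ v) w) f).coeff m := by
  have h1 := coeff_aeval_arc G (aevalTower (aeval y : MvPolynomial ι k →ₐ[k] T) (Sum.elim v w))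
    (fun j => (C (X j) : MvPolynomial (ι ⊕ ι) (MvPolynomial ι k))) (tangentProj G (fun j => C (X j))
      (fun j => C (C' j)) e₁ e₂ fun j => X (Sum.inl j)) (fun j => X (Sum.inr j)) f m
  simp only [map_tangentProj, aevalTower_C, aevalTower_X, aeval_X, Sum.elim_inl, Sum.elim_inr] at h1
  exact h1

variable {k ι Ω : Type*} [Field k] [IsAlgClosed k] [Fintype ι] {I : Ideal (MvPolynomial ι k)}
  [I.IsPrime] {h : MvPolynomial ι k} [Field Ω] [Algebra k Ω]

/-- The order of vanishing along arcs at the general points carries over to the generic point. -/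
lemma X_pow_dvd_generic (hh : h ∉ I) (hX : ∃ j, X j ∉ I) {G : Matrix ι ι k}
    {C' : ι → MvPolynomial ι k} {f : MvPolynomial ι k} {e : ℕ}
    (H : ∀ x : ι → k, x ≠ 0 → (∀ f ∈ I, eval x f = 0) → eval x h ≠ 0 → ∀ r w, bil G x r = 0 →
      ∑ j, eval x (C' j) * r j = 0 → Polynomial.X ^ e ∣ aeval (arc G x r w) f)
    {x : ι → Ω} (hx : ∀ f, aeval x f = 0 ↔ f ∈ I) {e₁ e₂ : ι → k}
    (hΔ : bil G x (ext Ω e₁) * ∑ j, aeval x (C' j) * ext Ω e₂ j -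
      bil G x (ext Ω e₂) * ∑ j, aeval x (C' j) * ext Ω e₁ j ≠ 0)
    {r : ι → Ω} (w : ι → Ω) (hxr : bil G x r = 0) (hcr : ∑ j, aeval x (C' j) * r j = 0) :
    Polynomial.X ^ e ∣ aeval (arc G x r w) f := by
  rw [Polynomial.X_pow_dvd_iff]
  intro m hm
  set P := arcCoeff G C' f e₁ e₂ m with hPdef
  -- At a general point the polynomial P vanishes for all arc parameters, so each of its
  -- coefficients lies in the ideal and vanishes at the generic point.
  have hcoeff (d) : coeff d P ∈ I := by
    refine mem_of_forall_general hh hX fun y hy0 hy hhy => ?_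
    have hmap : map (aeval y : MvPolynomial ι k →ₐ[k] k).toRingHom P = 0 := by
      refine MvPolynomial.funext fun vw => ?_
      rw [map_zero, eval_map]
      have h1 := eval₂_arcCoeff G C' f e₁ e₂ m y (vw ∘ Sum.inl) (vw ∘ Sum.inr)
      rw [Sum.elim_comp_inl_inr] at h1
      rw [hPdef, h1]
      refine Polynomial.X_pow_dvd_iff.mp (H y hy0 hy hhy _ _ (bil_tangentProj _ _ _ _ _ _) ?_) m hm
      exact sum_mul_tangentProj G y (fun j => eval y (C' j)) e₁ e₂ _
    have := congrArg (coeff d) hmap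
    rw [coeff_map, coeff_zero] at this
    exact this
  have hmap : map (aeval x : MvPolynomial ι k →ₐ[k] Ω).toRingHom P = 0 := by
    ext d
    rw [coeff_map, coeff_zero]
    exact (hx _).mpr (hcoeff d)
  obtain ⟨Δ, hΔ'⟩ : ∃ Δ, Δ = bil G x (ext Ω e₁) * ∑ j, aeval x (C' j) * ext Ω e₂ j -
      bil G x (ext Ω e₂) * ∑ j, aeval x (C' j) * ext Ω e₁ j := ⟨_, rfl⟩
  -- On a vector already in the kernel the projection is multiplication by Δ, so Δ⁻¹r is a preimage
  -- of r.
  have hr : tangentProj G x (fun j => aeval x (C' j)) e₁ e₂ (Δ⁻¹ • r) = r := by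
    have h1 : ∑ j, aeval x (C' j) * (Δ⁻¹ • r) j = 0 := by
      have : ∑ j, aeval x (C' j) * (Δ⁻¹ • r) j = Δ⁻¹ * ∑ j, aeval x (C' j) * r j := by
        rw [Finset.mul_sum]
        exact Finset.sum_congr rfl fun j _ => by rw [Pi.smul_apply, smul_eq_mul]; ring
      rw [this, hcr, mul_zero]
    rw [tangentProj, h1, bil_smul_right, hxr, ← hΔ', smul_smul,
      mul_inv_cancel₀ (by rwa [hΔ'])]
    simp
  have h1 := eval₂_arcCoeff G C' f e₁ e₂ m x (Δ⁻¹ • r) w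
  rw [hr, ← eval_map, ← hPdef, hmap, map_zero] at h1
  exact h1.symm

end Transfer

/-! ### The strict transform of a hyperplane section on the exceptional divisor -/

section StrictTransform

/-- Elements of the strict transform, as fractions. -/
lemma exists_of_mem_strictTransformIdeal {A : Type*} [CommRing A] {m : Ideal A} {u g : A}
    (hu : u ∈ m) {s : blowupChart m u} (hs : s ∈ strictTransformIdeal m u g) :
    ∃ K, ∃ a : A, g * a ∈ m ^ (K + 1) ∧
      s * algebraMap A _ u ^ (K + 1) = algebraMap A _ (g * a) := by
  obtain ⟨d, y, hy, hsy⟩ := exists_pow_blowupChart hu s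
  rw [strictTransformIdeal, Ideal.mem_comap, Ideal.mem_span_singleton] at hs
  obtain ⟨b, hb⟩ := hs
  obtain ⟨n, a, ha⟩ := IsLocalization.Away.surj u b
  have hsy' : (s : Localization.Away u) * algebraMap A _ u ^ d = algebraMap A _ y :=
    congrArg Subtype.val hsy
  have hb' : (s : Localization.Away u) = algebraMap A _ g * b := hb
  have h1 : algebraMap A (Localization.Away u) (y * u ^ n) =
      algebraMap A (Localization.Away u) (g * a * u ^ d) := by
    rw [map_mul, map_pow, ← hsy', hb', map_mul, map_mul, map_pow, ← ha]
    ring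
  obtain ⟨⟨_, N, rfl⟩, hN⟩ := (IsLocalization.eq_iff_exists (Submonoid.powers u) _).mp h1
  replace hN : u ^ N * (y * u ^ n) = u ^ N * (g * a * u ^ d) := hN
  refine ⟨N + n + d, u ^ (N + d + 1) * a, ?_, ?_⟩
  · have : g * (u ^ (N + d + 1) * a) = y * u ^ (N + n + 1) := by
      linear_combination (-u) * hN
    rw [this, show N + n + d + 1 = d + (N + n + 1) by ring, pow_add]
    exact Ideal.mul_mem_mul hy (Ideal.pow_mem_pow hu _)
  · have : g * (u ^ (N + d + 1) * a) = y * u ^ (N + n + 1) := by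
      linear_combination (-u) * hN
    rw [this, map_mul, ← hsy, map_pow]
    ring

variable {M : ℕ} {G : Matrix (Fin (M + 1)) (Fin (M + 1)) ℂ} {i : Fin (M + 1)}
  {x : Fin (M + 1) → ℂ}

/-- There are arcs in the chart in the tangent directions of the quadric. -/
lemma exists_arc_eval_ne_zero (hG : G.IsSymm) (hdet : IsUnit G.det) (hM : 5 ≤ M + 1)
    (hx : bil G x x = 0) (hi : x i ≠ 0) {ρ : Fin (M + 1) → ℂ}
    (hρ : ρ ∈ tangentDirections G i x 0) {N : MvPolynomial (Fin (M + 1)) ℂ} {d : ℕ}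
    (hN : N.IsHomogeneous d) (hNρ : eval ρ N ≠ 0) :
    ∃ (φ : ChartRing G i →ₐ[ℂ] PowerSeries ℂ) (g : Fin (M + 1) → PowerSeries ℂ),
      (∀ j, φ (chartGen G i x j) = PowerSeries.X * g j) ∧
      eval (fun j => PowerSeries.constantCoeff (g j)) N ≠ 0 := by
  by_contra! hcon
  have hdet' : IsUnit (G.map (algebraMap ℂ ℂ)).det := by simpa using hdet
  obtain ⟨r, hxr, hcr, hrr, hNr⟩ := exists_anisotropic_eval_ne_zero hG hdet hM hρ hNρ
  obtain ⟨w, hxw⟩ : ∃ w, bil G x w ≠ 0 := by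
    by_contra! hcon
    exact hi (by rw [eq_zero_of_bil_eq_zero hG hdet' hcon]; rfl)
  -- Were there no such arc, the hypothesis on arcs would hold vacuously for f = 1, and t would
  -- divide 1.
  have := X_pow_dvd_aeval_arc (e := 1) (f := 1) hG hx hi (c := 0) (by simp) hxr hcr hrr hxw hN hNr
    (isHomogeneous_one _ _) fun φ g hφ _ hne => absurd (hcon φ g hφ) hne
  rw [map_one, pow_one] at this
  exact Polynomial.not_isUnit_X (isUnit_of_dvd_one this)

/-- Subtracting a multiple of x brings any vector of x^⊥ into these directions without changing its
pairing with c. If all pairings vanished, c would kill x^⊥ and be a multiple of Gx. -/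
lemma exists_tangent_sum_mul_ne_zero (hG : G.IsSymm) (hdet : IsUnit G.det)
    (hx : bil G x x = 0) (hi : x i ≠ 0) {c : Fin (M + 1) → ℂ} (hc : ∑ j, c j * x j = 0)
    (hc' : c ∉ Submodule.span ℂ {G.mulVec x}) :
    ∃ ρ ∈ tangentDirections G i x 0, ∑ j, c j * ρ j ≠ 0 := by
  by_contra! hcon
  have hdet' : IsUnit (G.map (algebraMap ℂ ℂ)).det := by simpa using hdet
  obtain ⟨a, ha⟩ := eq_sum_of_perp hG hdet' (L := ![x]) (v := dualVec G c) fun v hv => by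
    have hxv : bil G x v = 0 := mem_perp.mp hv 0
    rw [bil_dualVec hG hdet]
    have h1 := hcon (v - (v i / x i) • x) ⟨by simp [hi], by
      rw [bil_sub_right, bil_smul_right, hxv, hx]; ring, by simp⟩
    have h2 : ∑ j, c j * (v - (v i / x i) • x) j =
        ∑ j, c j * v j - v i / x i * ∑ j, c j * x j := by
      rw [Finset.mul_sum, ← Finset.sum_sub_distrib]
      refine Finset.sum_congr rfl fun j _ => ?_
      simp only [Pi.sub_apply, Pi.smul_apply, smul_eq_mul]
      ring
    rw [h2, hc] at h1
    linear_combination h1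
  apply hc'
  rw [Submodule.mem_span_singleton]
  refine ⟨a 0, ?_⟩
  funext l
  have h1 := bil_dualVec hG hdet c (Pi.single l 1)
  rw [ha, bil_eq_dotProduct] at h1
  simp only [Finset.univ_unique, Fin.default_eq_zero, Finset.sum_singleton, Matrix.cons_val_zero,
    Pi.single_apply, mul_ite, mul_one, mul_zero, Finset.sum_ite_eq', Finset.mem_univ,
    if_true, Algebra.algebraMap_self_apply] at h1
  rw [← h1, Pi.smul_apply, smul_eq_mul, Matrix.mulVec, dotProduct, Finset.mul_sum]
  refine Finset.sum_congr rfl fun j _ => ?_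
  rw [hG.apply, Pi.smul_apply, smul_eq_mul]
  ring

/-- A form whose product with a linear form not vanishing on a subspace vanishes on the subspace
vanishes on this subspace. -/
lemma eval_eq_zero_of_mul_dotPoly {ι k : Type*} [Fintype ι] [Field k] [CharZero k]
    {T : Submodule k (ι → k)} {c : ι → k} {Y : MvPolynomial ι k}
    (h : ∀ ρ ∈ T, eval ρ (dotPoly c * Y) = 0) {ρ₀ : ι → k} (hρ₀ : ρ₀ ∈ T)
    (hc : ∑ j, c j * ρ₀ j ≠ 0) {ρ : ι → k} (hρ : ρ ∈ T) : eval ρ Y = 0 := by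
  have hp : aeval (lineVec ρ (ρ₀ - ρ)) Y = (0 : Polynomial k) := by
    refine polynomial_eq_zero_of_forall_eval (d := aeval (lineVec ρ (ρ₀ - ρ)) (dotPoly c)) ?_ ?_
    · intro h0
      have := eval_aeval (lineVec ρ (ρ₀ - ρ)) (dotPoly c) 1
      rw [h0, eval_lineVec, one_smul, add_sub_cancel, aeval_eq_eval, Polynomial.eval_zero,
        eval_dotPoly] at this
      exact hc this.symm
    · intro s hs
      rw [eval_aeval, eval_lineVec, aeval_eq_eval] at hs ⊢
      have := h (ρ + s • (ρ₀ - ρ)) (T.add_mem hρ (T.smul_mem s (T.sub_mem hρ₀ hρ)))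
      rw [map_mul] at this
      exact (mul_eq_zero.mp this).resolve_left hs
  have := eval_aeval (lineVec ρ (ρ₀ - ρ)) Y 0
  rw [hp, eval_lineVec, zero_smul, add_zero, aeval_eq_eval, Polynomial.eval_zero] at this
  exact this.symm

lemma mem_pow_zero {A : Type*} [CommRing A] (m : Ideal A) (a : A) : a ∈ m ^ 0 := by
  simp

/-- The equation of a hyperplane transversal to the quadric is not a zero divisor modulo powers of
the maximal ideal of the point. -/
lemma mem_pow_of_mul_mem (hG : G.IsSymm) (hdet : IsUnit G.det) (hM : 5 ≤ M + 1)
    (hx : bil G x x = 0) (hi : x i ≠ 0) {c : Fin (M + 1) → ℂ} (hc : ∑ j, c j * x j = 0)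
    (hc' : c ∉ Submodule.span ℂ {G.mulVec x}) {a : ChartRing G i} {K : ℕ}
    (h : chartEquation G i (linearForm c) * a ∈ Ideal.span (Set.range (chartGen G i x)) ^ (K + 1)) :
    a ∈ Ideal.span (Set.range (chartGen G i x)) ^ K := by
  -- Induction on the order of a. The product of c and a leading form Y of a must vanish on the
  -- tangent space, or some arc would show too small an order; as c is not zero there, Y vanishes
  -- there, and so a lies in the next power.
  suffices hj : ∀ j ≤ K, a ∈ Ideal.span (Set.range (chartGen G i x)) ^ j from hj K le_rfl
  intro j
  induction j with
  | zero => intro _; exact mem_pow_zero _ _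
  | succ j ih =>
    intro hjK
    obtain ⟨Y, hY⟩ := exists_isLeadingForm (exists_sub_algebraMap_mem i x) j (ih (by omega))
    have hc1 : IsLeadingForm (chartGen G i x) 1 (chartEquation G i (linearForm c)) (dotPoly c) := by
      refine ⟨dotPoly_isHomogeneous c, ?_⟩
      rw [aeval_dotPoly, sum_mul_chartGen hc, sub_self]
      exact Ideal.zero_mem _
    have hprod := hc1.mul hY
    let T : Submodule ℂ (Fin (M + 1) → ℂ) :=
      LinearMap.ker (LinearMap.proj i : (Fin (M + 1) → ℂ) →ₗ[ℂ] ℂ) ⊓ LinearMap.ker (bilLin G x)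
    have hT (ρ) : ρ ∈ T ↔ ρ ∈ tangentDirections G i x 0 := by
      simp [T, tangentDirections]
    have hvan (ρ) (hρ : ρ ∈ T) : eval ρ (dotPoly c * Y) = 0 := by
      by_contra hne
      obtain ⟨φ, g, hφ, hg⟩ := exists_arc_eval_ne_zero hG hdet hM hx hi ((hT ρ).mp hρ) hprod.1 hne
      obtain ⟨p, hp, hp0⟩ := hprod.exists_eq φ g hφ
      have hmem : chartEquation G i (linearForm c) * a ∈
          Ideal.span (Set.range (chartGen G i x)) ^ (1 + j + 1) :=
        Ideal.pow_le_pow_right (by omega) h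
      obtain ⟨d, hd⟩ := X_pow_dvd_of_mul_mem (exists_sub_algebraMap_mem i x) hφ (s := 1)
        ((Ideal.ne_top_iff_one _).mp (span_chartGen_ne_top hx hi)) (by rwa [one_mul])
      rw [hp, pow_succ, mul_assoc] at hd
      have h1 := mul_left_cancel₀ (pow_ne_zero _ PowerSeries.X_ne_zero) hd
      rw [h1, map_mul, PowerSeries.constantCoeff_X, zero_mul] at hp0
      exact hg hp0.symm
    obtain ⟨ρ₀, hρ₀, hcρ₀⟩ := exists_tangent_sum_mul_ne_zero hG hdet hx hi hc hc'
    have hYT (ρ) (hρ : ρ ∈ tangentDirections G i x 0) : eval ρ Y = 0 :=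
      eval_eq_zero_of_mul_dotPoly hvan ((hT _).mpr hρ₀) hcρ₀ ((hT _).mpr hρ)
    have hYm : aeval (chartGen G i x) Y ∈ Ideal.span (Set.range (chartGen G i x)) ^ (j + 1) := by
      rcases Nat.eq_zero_or_pos j with rfl | hj
      · obtain ⟨y, rfl⟩ : ∃ y, Y = C y :=
          ⟨_, totalDegree_eq_zero_iff_eq_C.mp (by simpa using hY.1.totalDegree_le)⟩
        have := hYT 0 ⟨rfl, bil_zero_right G x, by simp⟩
        rw [eval_C] at this
        rw [this, C_0, map_zero]
        exact Ideal.zero_mem _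
      · obtain ⟨d, rfl⟩ : ∃ d, j = d + 1 := ⟨j - 1, by omega⟩
        obtain ⟨B, -, hB⟩ := exists_form_of_vanishing_on_tangentDirections hG hx hi (c := 0)
          (by simp) d Y hY.1 hYT
        have h0 : chartEquation G i (linearForm 0) = 0 := by
          have : linearForm (0 : Fin (M + 1) → ℂ) = 0 := by simp [linearForm]
          rw [this]
          exact map_zero (Ideal.Quotient.mk _)
        rwa [h0, zero_mul, sub_zero] at hB
    rw [← sub_add_cancel a (aeval (chartGen G i x) Y)]
    exact Ideal.add_mem _ hY.2 hYm

/-- The strict transform of a hyperplane section cuts out on the exceptional divisor the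
hyperplane given by its equation. -/
theorem strictTransformIdeal_sup_exceptionalIdeal (hG : G.IsSymm) (hdet : IsUnit G.det)
    (hM : 5 ≤ M + 1) (hx : bil G x x = 0) (hi : x i ≠ 0) {c ζ : Fin (M + 1) → ℂ}
    (hc : ∑ j, c j * x j = 0) (hc' : c ∉ Submodule.span ℂ {G.mulVec x}) {α β : ℂ} (hβ : β ≠ 0)
    (hζ : ζ = α • G.mulVec x + β • c) {u : ChartRing G i} (hu : u ∈ pointIdeal G i x) :
    strictTransformIdeal (pointIdeal G i x) u (chartEquation G i (linearForm ζ)) ⊔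
        exceptionalIdeal (pointIdeal G i x) u =
      exceptionalHyperplaneIdeal (pointIdeal G i x) u (chartEquation G i (linearForm c)) := by
  have hGx (v : Fin (M + 1) → ℂ) : ∑ l, G.mulVec x l * v l = bil G x v := by
    rw [bil_eq_dotProduct]
    refine Finset.sum_congr rfl fun l _ => ?_
    rw [Matrix.mulVec, dotProduct]
    congr 1
    exact Finset.sum_congr rfl fun j _ => by rw [hG.apply]; rfl
  have hζx : ∑ j, ζ j * x j = 0 := by
    have : ∑ j, ζ j * x j = α * ∑ j, G.mulVec x j * x j + β * ∑ j, c j * x j := by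
      rw [hζ, Finset.mul_sum, Finset.mul_sum, ← Finset.sum_add_distrib]
      refine Finset.sum_congr rfl fun j _ => ?_
      simp only [Pi.add_apply, Pi.smul_apply, smul_eq_mul]
      ring
    rw [this, hGx, hx, hc]; ring
  have hζ' : ζ ∉ Submodule.span ℂ {G.mulVec x} := by
    intro hmem
    apply hc'
    have h1 : c = β⁻¹ • (ζ - α • G.mulVec x) := by
      rw [hζ, add_sub_cancel_left, smul_smul, inv_mul_cancel₀ hβ, one_smul]
    rw [h1]
    exact Submodule.smul_mem _ _ (Submodule.sub_mem _ hmem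
      (Submodule.smul_mem _ _ (Submodule.mem_span_singleton_self _)))
  set m := pointIdeal G i x with hm
  have ht : chartEquation G i (linearForm c) ∈ m := by
    rw [← sum_mul_chartGen hc]
    exact Ideal.sum_mem _ fun j _ => Ideal.mul_mem_left _ _ (Ideal.subset_span ⟨j, rfl⟩)
  -- The equation of Gx lies in m², so the equations of ζ and βc agree modulo m².
  obtain ⟨e, he, hZ⟩ : ∃ e ∈ m ^ 2, chartEquation G i (linearForm ζ) =
      algebraMap ℂ _ α * e + algebraMap ℂ _ β * chartEquation G i (linearForm c) := by
    refine ⟨_, bil_chartGen_mem hG hx hi, ?_⟩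
    rw [← sum_mul_chartGen hζx, ← sum_mul_chartGen hc, bil_eq_dotProduct, Finset.mul_sum,
      Finset.mul_sum, ← Finset.sum_add_distrib]
    refine Finset.sum_congr rfl fun l _ => ?_
    have h1 : ζ l = α * ∑ j, G j l * x j + β * c l := by
      rw [hζ, Pi.add_apply, Pi.smul_apply, Pi.smul_apply, Matrix.mulVec, dotProduct, smul_eq_mul,
        smul_eq_mul]
      congr 2
      exact Finset.sum_congr rfl fun j _ => by rw [hG.apply]
    rw [h1]
    simp only [ext, map_add, map_mul, map_sum]
    ring
  obtain ⟨zt, hzt⟩ := exists_blowupChart_mul_eq (u := u) ht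
  have hztm : zt ∈ exceptionalHyperplaneIdeal m u (chartEquation G i (linearForm c)) :=
    Ideal.mem_sup_right (Ideal.subset_span (congrArg Subtype.val hzt))
  apply le_antisymm
  · refine sup_le (fun s hs => ?_) le_sup_left
    -- An element of the strict transform is ζa/u^(K+1). Non-cancellation of the order of ζ gives a
    -- in m^K, so the element is β(t/u)(a/u^K) modulo the exceptional ideal.
    obtain ⟨K, a, ha, hsa⟩ := exists_of_mem_strictTransformIdeal hu hs
    have haK := mem_pow_of_mul_mem hG hdet hM hx hi hζx hζ' ha
    obtain ⟨za, hza⟩ := exists_blowupChart_mul_pow_eq (m := m) (u := u) haK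
    have h1 : s - algebraMap _ _ (algebraMap ℂ (ChartRing G i) β) * zt * za ∈
        exceptionalIdeal m u := by
      refine mem_exceptionalIdeal_of_pow (k := K + 1)
        (y := algebraMap ℂ (ChartRing G i) α * (e * a)) ?_ ?_
      · refine Ideal.mul_mem_left _ _ ?_
        have := mul_mem_pow_add he haK
        rwa [add_comm 2 K] at this
      · rw [sub_mul, hsa, hZ]
        simp only [map_mul, map_add, ← hza, ← hzt]
        ring
    rw [← sub_add_cancel s (algebraMap _ _ (algebraMap ℂ (ChartRing G i) β) * zt * za)]
    exact Ideal.add_mem _ (Ideal.mem_sup_left h1)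
      (Ideal.mul_mem_right _ _ (Ideal.mul_mem_left _ _ hztm))
  · refine sup_le le_sup_right (Ideal.span_le.mpr fun z hz => ?_)
    have hz' : z * algebraMap _ _ u = algebraMap _ _ (chartEquation G i (linearForm c)) :=
      Subtype.ext hz
    have hem : e ∈ m := Ideal.pow_le_self two_ne_zero he
    obtain ⟨ze, hze⟩ := exists_blowupChart_mul_eq (u := u) hem
    have hze' : ze ∈ exceptionalIdeal m u :=
      mem_exceptionalIdeal_of_pow (k := 1) he (by rwa [pow_one])
    let A' := algebraMap (ChartRing G i) (blowupChart m u)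
    -- This is ζ/u; it lies in the strict transform and differs from β(t/u) by the exceptional
    -- element αe/u.
    have hZs : A' (algebraMap ℂ _ α) * ze + A' (algebraMap ℂ _ β) * z ∈
        strictTransformIdeal m u (chartEquation G i (linearForm ζ)) := by
      rw [strictTransformIdeal, Ideal.mem_comap, Ideal.mem_span_singleton]
      have hunit := IsLocalization.Away.algebraMap_isUnit (S := Localization.Away u) u
      refine hunit.dvd_mul_right.mp (dvd_of_eq ?_)
      have h2 : (A' (algebraMap ℂ _ α) * ze + A' (algebraMap ℂ _ β) * z) * algebraMap _ _ u =
          algebraMap _ _ (chartEquation G i (linearForm ζ)) := by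
        rw [hZ, map_add, map_mul, map_mul, ← hz', ← hze]
        ring
      exact (congrArg Subtype.val h2).symm
    have hββ : A' (algebraMap ℂ _ β⁻¹) * A' (algebraMap ℂ _ β) = 1 := by
      rw [← map_mul, ← map_mul, inv_mul_cancel₀ hβ, map_one, map_one]
    have h3 : z = A' (algebraMap ℂ _ β⁻¹) *
        ((A' (algebraMap ℂ _ α) * ze + A' (algebraMap ℂ _ β) * z) - A' (algebraMap ℂ _ α) * ze) := by
      linear_combination (-z) * hββ
    rw [SetLike.mem_coe, h3]
    exact Ideal.mul_mem_left _ _ (Ideal.sub_mem _ (Ideal.mem_sup_left hZs)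
      (Ideal.mem_sup_right (Ideal.mul_mem_left _ _ hze')))

end StrictTransform

/-! ### Generic points and dimension -/

section GenericPoint

/-- The generic point of an irreducible variety, over an algebraically closed field. -/
lemma exists_generic_point {k σ : Type} [Field k] (I : Ideal (MvPolynomial σ k)) [I.IsPrime] :
    ∃ (Ω : Type) (_ : Field Ω) (_ : Algebra k Ω) (_ : IsAlgClosed Ω) (x : σ → Ω),
      ∀ f, aeval x f = 0 ↔ f ∈ I := by
  let A := MvPolynomial σ k ⧸ I
  let K := FractionRing A
  let φ : MvPolynomial σ k →ₐ[k] AlgebraicClosure K :=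
    ((Algebra.ofId A (AlgebraicClosure K)).restrictScalars k).comp (Ideal.Quotient.mkₐ k I)
  refine ⟨AlgebraicClosure K, inferInstance, inferInstance, inferInstance, fun j => φ (X j),
    fun f => ?_⟩
  have h1 : aeval (fun j => φ (X j)) = φ := by
    ext j; simp
  have hinj : Function.Injective (algebraMap A (AlgebraicClosure K)) := by
    rw [IsScalarTower.algebraMap_eq A K (AlgebraicClosure K)]
    exact (algebraMap K (AlgebraicClosure K)).injective.comp (IsFractionRing.injective A K)
  rw [h1]
  change algebraMap A (AlgebraicClosure K) (Ideal.Quotient.mk I f) = 0 ↔ _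
  rw [map_eq_zero_iff _ hinj, Ideal.Quotient.eq_zero_iff_mem]

/-- The dimension of a hypersurface. -/
lemma add_one_le_of_le_ringKrullDim {k : Type*} [Field k] {N d : ℕ}
    {I : Ideal (MvPolynomial (Fin N) k)} {q : MvPolynomial (Fin N) k} (hq : q ≠ 0) (hqI : q ∈ I)
    (hd : (d : WithBot ℕ∞) ≤ ringKrullDim (MvPolynomial (Fin N) k ⧸ I)) : d + 1 ≤ N := by
  have h1 := ringKrullDim_quotient_succ_le_of_nonZeroDivisor (mem_nonZeroDivisors_of_ne_zero hq)
  have h2 := ringKrullDim_le_of_surjective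
    (Ideal.Quotient.factor (Ideal.span_le.mpr (Set.singleton_subset_iff.mpr hqI)))
    (Ideal.Quotient.factor_surjective _)
  rw [MvPolynomial.ringKrullDim_of_isNoetherianRing, ringKrullDim_eq_zero_of_field, zero_add] at h1
  have h3 := (add_le_add_left (hd.trans h2) 1).trans h1
  rw [Nat.card_fin] at h3
  exact_mod_cast h3

end GenericPoint

/-! ### Transversality minors and specialization -/

section Minors

variable {k ι : Type*} [Field k] [Fintype ι]

/-- The value at `e` of the linear form with coefficients `C'`. -/
def sumPoly (C' : ι → MvPolynomial ι k) (e : ι → k) : MvPolynomial ι k := ∑ j, C' j * C (e j)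

lemma aeval_sumPoly {R : Type*} [CommRing R] [Algebra k R] (C' : ι → MvPolynomial ι k) (e : ι → k)
    (x : ι → R) : aeval x (sumPoly C' e) = ∑ j, aeval x (C' j) * ext R e j := by
  simp [sumPoly, ext]

lemma eval_sumPoly (C' : ι → MvPolynomial ι k) (e x : ι → k) :
    eval x (sumPoly C' e) = ∑ j, eval x (C' j) * e j := by
  simp [sumPoly]

lemma sumPoly_isHomogeneous {C' : ι → MvPolynomial ι k} {d : ℕ} (h : ∀ j, (C' j).IsHomogeneous d)
    (e : ι → k) : (sumPoly C' e).IsHomogeneous d :=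
  IsHomogeneous.sum _ _ _ fun j _ => (h j).mul (isHomogeneous_C _ _)

/-- The minors of the linear forms `bil G x` and `C'`. -/
def transversalityPoly (G : Matrix ι ι k) (C' : ι → MvPolynomial ι k) (e₁ e₂ : ι → k) : MvPolynomial ι k :=
  linPoly G e₁ * sumPoly C' e₂ - linPoly G e₂ * sumPoly C' e₁

lemma transversalityPoly_isHomogeneous (G : Matrix ι ι k) {C' : ι → MvPolynomial ι k} {d : ℕ}
    (h : ∀ j, (C' j).IsHomogeneous d) (e₁ e₂ : ι → k) :
    (transversalityPoly G C' e₁ e₂).IsHomogeneous (1 + d) :=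
  ((linPoly_isHomogeneous G e₁).mul (sumPoly_isHomogeneous h e₂)).sub
    ((linPoly_isHomogeneous G e₂).mul (sumPoly_isHomogeneous h e₁))

lemma sum_mul_single [DecidableEq ι] (c : ι → k) (l : ι) :
    ∑ j, c j * (Pi.single l 1 : ι → k) j = c l := by
  simp [Pi.single_apply]

lemma bil_single_eq_mulVec [DecidableEq ι] {G : Matrix ι ι k} (hG : G.IsSymm) (x : ι → k) (l : ι) :
    bil G (Pi.single l 1) x = G.mulVec x l := by
  rw [bil_comm hG, bil_single_right, mul_one, Matrix.mulVec, dotProduct]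
  exact Finset.sum_congr rfl fun j _ => by rw [hG.apply]; rfl

/-- If `c` is generically not a multiple of `bil G x`, then some minor does not vanish. -/
lemma exists_transversalityPoly_notMem [DecidableEq ι] [IsAlgClosed k] {G : Matrix ι ι k} (hG : G.IsSymm)
    (hdet : IsUnit G.det) {I : Ideal (MvPolynomial ι k)} [I.IsPrime] (hX : ∃ j, X j ∉ I)
    {h : MvPolynomial ι k} (hh : h ∉ I) {C' : ι → MvPolynomial ι k}
    (H : ∀ x : ι → k, x ≠ 0 → (∀ f ∈ I, eval x f = 0) → eval x h ≠ 0 →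
      (fun j => eval x (C' j)) ∉ Submodule.span k {G.mulVec x}) :
    ∃ e₁ e₂, transversalityPoly G C' e₁ e₂ ∉ I := by
  by_contra! hcon
  obtain ⟨x, hx0, hx, hhx⟩ := exists_general hh hX
  apply H x hx0 hx hhx
  have hdet' : IsUnit (G.map (algebraMap k k)).det := by simpa using hdet
  obtain ⟨e, he⟩ : ∃ e, bil G x e ≠ 0 := by
    by_contra! hcon'
    exact hx0 (eq_zero_of_bil_eq_zero hG hdet' hcon')
  rw [Submodule.mem_span_singleton]
  refine ⟨(∑ j, eval x (C' j) * e j) / bil G x e, funext fun l => ?_⟩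
  have h1 := hx _ (hcon e (Pi.single l 1))
  rw [transversalityPoly, map_sub, map_mul, map_mul, eval_linPoly, eval_linPoly, eval_sumPoly, eval_sumPoly,
    sum_mul_single, bil_single_eq_mulVec hG, bil_comm hG e] at h1
  rw [Pi.smul_apply, smul_eq_mul, div_mul_eq_mul_div, div_eq_iff he]
  linear_combination -h1

lemma dualVec_notMem_span [DecidableEq ι] {Ω : Type*} [Field Ω] [Algebra k Ω] {G : Matrix ι ι k}
    (hG : G.IsSymm) (hdet : IsUnit G.det) {C' : ι → MvPolynomial ι k} {e₁ e₂ : ι → k} {x : ι → Ω}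
    (h : aeval x (transversalityPoly G C' e₁ e₂) ≠ 0) :
    dualVec G (fun j => aeval x (C' j)) ∉ Submodule.span Ω {x} := by
  intro hmem
  obtain ⟨a, ha⟩ := Submodule.mem_span_singleton.mp hmem
  have h1 (e : ι → k) : ∑ j, aeval x (C' j) * ext Ω e j = a * bil G (ext Ω e) x := by
    rw [← bil_dualVec hG hdet, ← ha, bil_smul_left, bil_comm hG x]
  apply h
  rw [transversalityPoly, map_sub, map_mul, map_mul, aeval_linPoly, aeval_linPoly, aeval_sumPoly,
    aeval_sumPoly, h1, h1]
  ring

/-- A linear relation between a constant vector and the two linear forms at the generic point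
specializes to general points. -/
lemma exists_specialized_relation [DecidableEq ι] {Ω : Type*} [Field Ω] [Algebra k Ω]
    {G : Matrix ι ι k} (hG : G.IsSymm) (hdet : IsUnit G.det) {I : Ideal (MvPolynomial ι k)}
    {C' : ι → MvPolynomial ι k} {d : ℕ} (hC : ∀ j, (C' j).IsHomogeneous d) {e₁ e₂ : ι → k}
    {x : ι → Ω} (hx : ∀ f, aeval x f = 0 ↔ f ∈ I) (h : aeval x (transversalityPoly G C' e₁ e₂) ≠ 0)
    {z : ι → k} {α β : Ω} (hβ : β ≠ 0)
    (hz : ext Ω z = α • x + β • dualVec G (fun j => aeval x (C' j))) :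
    ∃ (e : ℕ) (h : MvPolynomial ι k), h.IsHomogeneous e ∧ aeval x h ≠ 0 ∧
      ∀ y : ι → k, (∀ f ∈ I, eval y f = 0) → eval y h ≠ 0 →
        ∃ a b : k, b ≠ 0 ∧ G.mulVec z = a • G.mulVec y + b • fun j => eval y (C' j) := by
  have hze (e : ι → k) : algebraMap k Ω (bil G z e) =
      α * aeval x (linPoly G e) + β * aeval x (sumPoly C' e) := by
    rw [← bil_ext, hz, bil_add_left, bil_smul_left, bil_smul_left, bil_dualVec hG hdet,
      aeval_linPoly, aeval_sumPoly, bil_comm hG x]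
  set Δ := transversalityPoly G C' e₁ e₂ with hΔ
  -- Cramer's rule: A/Δ and P/Δ express α and β. Cleared of denominators, the linear relation
  -- becomes polynomial identities at the generic point, which hold at every point of the variety.
  set A := C (bil G z e₁) * sumPoly C' e₂ - C (bil G z e₂) * sumPoly C' e₁ with hA
  set P := linPoly G e₁ * C (bil G z e₂) - linPoly G e₂ * C (bil G z e₁) with hP
  have hΔx : aeval x Δ = aeval x (linPoly G e₁) * aeval x (sumPoly C' e₂) -
      aeval x (linPoly G e₂) * aeval x (sumPoly C' e₁) := by
    rw [hΔ, transversalityPoly, map_sub, map_mul, map_mul]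
  have hAx : aeval x A = α * aeval x Δ := by
    rw [hA, map_sub, map_mul, map_mul, aeval_C, aeval_C, hze, hze, hΔx]; ring
  have hPx : aeval x P = β * aeval x Δ := by
    rw [hP, map_sub, map_mul, map_mul, aeval_C, aeval_C, hze, hze, hΔx]; ring
  have hmem (l : ι) : Δ * C (bil G z (Pi.single l 1)) - A * linPoly G (Pi.single l 1) -
      P * sumPoly C' (Pi.single l 1) ∈ I := by
    rw [← hx]
    simp only [map_sub, map_mul, hAx, hPx]
    rw [aeval_C, hze]
    ring
  refine ⟨_, Δ * P, (transversalityPoly_isHomogeneous G hC e₁ e₂).mul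
    (((linPoly_isHomogeneous G e₁).mul (isHomogeneous_C _ _)).sub
      ((linPoly_isHomogeneous G e₂).mul (isHomogeneous_C _ _))), ?_, fun y hy hne => ?_⟩
  · rw [map_mul, hPx]
    exact mul_ne_zero h (mul_ne_zero hβ h)
  rw [map_mul] at hne
  have hΔy := left_ne_zero_of_mul hne
  refine ⟨eval y A / eval y Δ, eval y P / eval y Δ, div_ne_zero (right_ne_zero_of_mul hne) hΔy,
    funext fun l => ?_⟩
  have h1 := hy _ (hmem l)
  rw [map_sub, map_sub, map_mul, map_mul, map_mul, eval_C, eval_linPoly, eval_sumPoly,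
    sum_mul_single, bil_comm hG z, bil_single_eq_mulVec hG, bil_single_eq_mulVec hG] at h1
  simp only [Pi.add_apply, Pi.smul_apply, smul_eq_mul]
  field_simp
  linear_combination h1

end Minors

/-! ### Removing copies of the section -/

section Removal

variable {k ι Ω : Type*} [Field k] [CharZero k] [Fintype ι] [Field Ω] [Algebra k Ω]

/-- Removing a hyperplane section from a divisor drops the order along the arcs by two. -/
lemma arcOrder_of_decomposition {G : Matrix ι ι k} (hG : G.IsSymm) {x c : ι → Ω}
    (hx : bil G x x = 0) {z : ι → k} {α β : Ω} (hβ : β ≠ 0) (hz : ext Ω z = α • x + β • c)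
    (hcx : bil G c x = 0) {f g : MvPolynomial ι k} {a e : ℕ} (hae : 2 * a ≤ e)
    (hfg : quadPoly G ∣ f - linPoly G z ^ a * g)
    (h : ∀ r w, bil G x r = 0 → bil G c r = 0 → Polynomial.X ^ e ∣ aeval (arc G x r w) f) :
    ArcOrder G x (ext Ω z) g (e - 2 * a) := by
  have : CharZero Ω := Algebra.charZero_of_charZero k Ω
  intro r w hxr hzr hxw hzw
  have hcr : bil G c r = 0 := by
    rw [hz, bil_add_left, bil_smul_left, bil_smul_left, hxr, mul_zero, zero_add] at hzr
    exact (mul_eq_zero.mp hzr).resolve_left hβ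
  have hzx : bil G (ext Ω z) x = 0 := by
    rw [hz, bil_add_left, bil_smul_left, bil_smul_left, hx, hcx]; ring
  obtain ⟨q, hq⟩ := hfg
  -- The arc lies on Q, which discards multiples of the quadratic form, and each factor of the
  -- linear form contributes a constant times t².
  have h1 : aeval (arc G x r w) f = (Polynomial.C (2 * bil G x w * bil G (ext Ω z) w)) ^ a *
      Polynomial.X ^ (2 * a) * aeval (arc G x r w) g := by
    have h2 := congrArg (aeval (arc G x r w)) hq
    rw [map_sub, map_mul, map_mul, map_pow, aeval_quadPoly, aeval_linPoly, bil_arc_self hG hx,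
      zero_mul, sub_eq_zero] at h2
    have h3 : ext (Polynomial Ω) z = constVec (ext Ω z) := rfl
    rw [h2, h3, bil_arc hxr hzr hzx, mul_pow, ← pow_mul]
  have h2 := h r w hxr hcr
  have hu : IsUnit ((Polynomial.C (2 * bil G x w * bil G (ext Ω z) w)) ^ a) :=
    (Polynomial.isUnit_C.mpr (IsUnit.mk0 _
      (mul_ne_zero (mul_ne_zero two_ne_zero hxw) hzw))).pow a
  rw [h1, mul_assoc, hu.dvd_mul_left] at h2
  rw [show e = 2 * a + (e - 2 * a) by omega, pow_add] at h2
  exact (mul_dvd_mul_iff_left (pow_ne_zero _ Polynomial.X_ne_zero)).mp h2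

end Removal

/-! ### Polar sections and the generic form of the condition H(n) -/

variable {M : ℕ} {G : Matrix (Fin (M + 1)) (Fin (M + 1)) ℂ}

lemma linearForm_eq_linPoly (hG : G.IsSymm) (z : Fin (M + 1) → ℂ) :
    linearForm (G.mulVec z) = linPoly G z := by
  rw [linPoly, bil_eq_dotProduct, linearForm]
  refine Finset.sum_congr rfl fun l _ => ?_
  congr 1
  rw [Matrix.mulVec, dotProduct, map_sum]
  refine Finset.sum_congr rfl fun j _ => ?_
  rw [hG.apply, map_mul]
  rfl

lemma bil_eq_zero_of_bil_self_eq_zero {k ι : Type*} [Field k] [CharZero k] [Fintype ι]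
    {G : Matrix ι ι k} (hG : G.IsSymm) (h : ∀ v : ι → k, bil G v v = 0) (v w : ι → k) :
    bil G v w = 0 := by
  have h1 := h (v + w)
  rw [bil_add_left, bil_add_right, bil_add_right, h, h, bil_comm hG w] at h1
  have h2 : (2 : k) * bil G v w = 0 := by linear_combination h1
  exact (mul_eq_zero.mp h2).resolve_left two_ne_zero

lemma quadPoly_ne_zero (hG : G.IsSymm) (hdet : IsUnit G.det) : quadPoly G ≠ 0 := by
  have hdet' : IsUnit (G.map (algebraMap ℂ ℂ)).det := by simpa using hdet
  intro h0
  have h1 := eq_zero_of_bil_eq_zero (x := fun _ => (1 : ℂ)) hG hdet' fun y =>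
    bil_eq_zero_of_bil_self_eq_zero hG (fun v => by rw [← eval_quadPoly, h0, map_zero]) _ y
  exact one_ne_zero (congrFun h1 0)

lemma linPoly_ne_zero (hG : G.IsSymm) (hdet : IsUnit G.det) {z : Fin (M + 1) → ℂ} (hz : z ≠ 0) :
    linPoly G z ≠ 0 := by
  have hdet' : IsUnit (G.map (algebraMap ℂ ℂ)).det := by simpa using hdet
  intro h0
  exact hz (eq_zero_of_bil_eq_zero hG hdet' fun y => by rw [← eval_linPoly, h0, map_zero])

/-- The hyperplane section polar to `z`. -/
def polarSection (hG : G.IsSymm) (hdet : IsUnit G.det) {z : Fin (M + 1) → ℂ} (hz : z ≠ 0) :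
    HyperplaneSection G where
  form := linPoly G z
  isHomogeneous := linPoly_isHomogeneous G z
  not_dvd := by
    rintro ⟨q, hq⟩
    have hlin := linPoly_ne_zero hG hdet hz
    have h1 := (linPoly_isHomogeneous G z).totalDegree hlin
    have hq0 : q ≠ 0 := by
      rintro rfl
      exact hlin (by rw [hq, mul_zero])
    rw [hq, quadric_eq_quadPoly, totalDegree_mul_of_isDomain (quadPoly_ne_zero hG hdet) hq0,
      (quadPoly_isHomogeneous G).totalDegree (quadPoly_ne_zero hG hdet)] at h1
    omega

lemma IrreducibleSubvariety.ForGeneralPoint.and {B : IrreducibleSubvariety G}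
    {P P' : (Fin (M + 1) → ℂ) → Prop} (h : B.ForGeneralPoint P) (h' : B.ForGeneralPoint P') :
    B.ForGeneralPoint fun x => P x ∧ P' x := by
  obtain ⟨e, f, hf, hfB, H⟩ := h
  obtain ⟨e', f', hf', hfB', H'⟩ := h'
  refine ⟨e + e', f * f', hf.mul hf', fun hmem => (B.isPrime.mem_or_mem hmem).elim hfB hfB',
    fun x hx0 hx hne => ?_⟩
  rw [map_mul] at hne
  exact ⟨H x hx0 hx (left_ne_zero_of_mul hne), H' x hx0 hx (right_ne_zero_of_mul hne)⟩

/-- Along the arcs at the generic point of `B` tangent to the hyperplane of the family, a divisor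
satisfying the condition `H(n)` vanishes to order greater than `2 n`. -/
lemma EffectiveDivisor.ConditionH.X_pow_dvd (hG : G.IsSymm) (hdet : IsUnit G.det)
    (hM : 5 ≤ M + 1) {B : IrreducibleSubvariety G} (hX : ∃ j, X j ∉ B.ideal) {l : ℕ}
    {D : EffectiveDivisor G l} {n : ℕ} {F : HyperplaneFamily B} (hH : D.ConditionH n F)
    {Ω : Type*} [Field Ω] [Algebra ℂ Ω] {x : Fin (M + 1) → Ω}
    (hx : ∀ f, aeval x f = 0 ↔ f ∈ B.ideal) {e₁ e₂ : Fin (M + 1) → ℂ}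
    (hΔ : aeval x (transversalityPoly G F.coeff e₁ e₂) ≠ 0) {r : Fin (M + 1) → Ω}
    (w : Fin (M + 1) → Ω) (hxr : bil G x r = 0) (hcr : ∑ j, aeval x (F.coeff j) * r j = 0) :
    Polynomial.X ^ (2 * n + 1) ∣ aeval (arc G x r w) D.form := by
  have := B.isPrime
  obtain ⟨e, h, -, hh, H⟩ := IrreducibleSubvariety.ForGeneralPoint.and hH F.isHyperplane
  refine X_pow_dvd_generic hh hX (fun y hy0 hy hne r w hyr hcr => ?_) hx (e₁ := e₁) (e₂ := e₂) ?_ w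
    hxr hcr
  · obtain ⟨⟨i, hi, hlt⟩, hc, -⟩ := H y hy0 hy hne
    have hyy : bil G y y = 0 := by
      rw [← eval_quadPoly, ← quadric_eq_quadPoly]
      exact hy _ B.quadric_mem
    exact X_pow_dvd_of_lt_mult hG hdet hM hyy hi hc D.isHomogeneous hlt w hyr hcr
  · rw [transversalityPoly, map_sub, map_mul, map_mul, aeval_linPoly, aeval_linPoly, aeval_sumPoly,
      aeval_sumPoly, bil_comm hG _ x, bil_comm hG _ x] at hΔ
    exact hΔ

/-- The equation of divisors given by a congruence of forms. -/
lemma EffectiveDivisor.eqSMulAdd_of_dvd {l l' a : ℕ} {D : EffectiveDivisor G l}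
    {Z : HyperplaneSection G} {D' : EffectiveDivisor G l'}
    (h : quadric G ∣ D.form - Z.form ^ a * D'.form) : D.EqSMulAdd a Z D' := by
  obtain ⟨q, hq⟩ := h
  apply le_antisymm <;> refine Ideal.span_le.mpr (Set.insert_subset_iff.mpr
    ⟨Ideal.subset_span (Set.mem_insert _ _), Set.singleton_subset_iff.mpr ?_⟩) <;>
    rw [SetLike.mem_coe, Ideal.mem_span_pair]
  · exact ⟨q, 1, by linear_combination -hq⟩
  · exact ⟨-q, 1, by linear_combination hq⟩

end QuadricDivisor

end

open QuadricDivisor MvPolynomial in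
theorem proposition2p1 {M : ℕ} (G : Matrix (Fin (M + 1)) (Fin (M + 1)) ℂ)
    (hsymm : G.IsSymm) (hdet : G.det ≠ 0)
    (B : QuadricDivisor.IrreducibleSubvariety G) (hB : B.DimGE 3)
    {l : ℕ} (D : QuadricDivisor.EffectiveDivisor G l)
    (n : ℕ) (hn : 1 ≤ n)
    (F : QuadricDivisor.HyperplaneFamily B) (hH : D.ConditionH n F) :
    2 * n < l ∨
      ∃ Z : QuadricDivisor.HyperplaneSection G,
        Z.form ∈ B.ideal ∧
        (B.ForGeneralPoint fun x => Z.StrictInterExceptionalEq F x) ∧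
        ∃ (a l' : ℕ) (D' : QuadricDivisor.EffectiveDivisor G l'),
          a + l' = l ∧ D.EqSMulAdd a Z D' ∧ ¬ D'.ContainsSection Z ∧
          2 * (n : ℤ) - (l : ℤ) < (a : ℤ) := by
  rcases lt_or_ge (2 * n) l with hl | hl
  · exact Or.inl hl
  right
  have hdet' : IsUnit G.det := isUnit_iff_ne_zero.mpr hdet
  have := B.isPrime
  have hdim : ((4 : ℕ) : WithBot ℕ∞) ≤ ringKrullDim (MvPolynomial (Fin (M + 1)) ℂ ⧸ B.ideal) := hB
  -- The affine cone over B has dimension at least four and lies in the hypersurface q = 0.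
  have hM : 5 ≤ M + 1 :=
    add_one_le_of_le_ringKrullDim (quadPoly_ne_zero hsymm hdet') B.quadric_mem hdim
  have hcard : 5 ≤ Fintype.card (Fin (M + 1)) := by rwa [Fintype.card_fin]
  obtain ⟨Ω, _, _, _, x, hx⟩ := exists_generic_point B.ideal
  have : CharZero Ω := Algebra.charZero_of_charZero ℂ Ω
  obtain ⟨d, hd⟩ := exists_independent_derivations B.isPrime.ne_top hdim hx
  -- The ideal of B is not the irrelevant one: otherwise x = 0 would have no variations.
  have hX : ∃ j, X j ∉ B.ideal := by
    by_contra! hcon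
    have hx0 : x = 0 := funext fun j => by simpa using (hx _).mpr (hcon j)
    refine hd.ne_zero 0 (funext fun j => ?_)
    simp [dv, hx0]
  have hxx : bil G x x = 0 := by
    rw [← aeval_quadPoly]
    exact (hx _).mpr B.quadric_mem
  obtain ⟨e, h, hhom, hh, hF⟩ := F.isHyperplane
  obtain ⟨e₁, e₂, hΔ⟩ := exists_transversalityPoly_notMem hsymm hdet' hX hh
    fun y hy0 hy hne => (hF y hy0 hy hne).2
  rw [← hx] at hΔ
  set c : Fin (M + 1) → Ω := dualVec G fun j => aeval x (F.coeff j) with hc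
  have hcx : bil G c x = 0 := by
    have hmem : ∑ j, F.coeff j * X j ∈ B.ideal := mem_of_forall_general hh hX fun y hy0 hy hne => by
      simpa using (hF y hy0 hy hne).1
    rw [hc, bil_dualVec hsymm hdet']
    simpa using (hx _).mpr hmem
  have hcspan : c ∉ Submodule.span Ω {x} := dualVec_notMem_span hsymm hdet' hΔ
  have hdvd (r w : Fin (M + 1) → Ω) (hxr : bil G x r = 0) (hcr : bil G c r = 0) :
      Polynomial.X ^ (2 * n + 1) ∣ aeval (arc G x r w) D.form :=
    hH.X_pow_dvd hsymm hdet' hM hX hx hΔ w hxr (by rwa [hc, bil_dualVec hsymm hdet'] at hcr)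
  -- The order 2n + 1 exceeds the degree exactly because l ≤ 2n.
  obtain ⟨hM', z, α, β, hβ, hz⟩ := exists_hyperplane_of_arcOrder hsymm hdet' hcard hxx hcx hcspan
    (fun a ha => mem_range_of_forall_derivation_eq_zero a ha) hd D.isHomogeneous
    (Nat.lt_succ_of_le hl) (fun r w hxr hcr _ _ => hdvd r w hxr hcr)
    (exists_eval_ne_zero_of_not_dvd hsymm hdet' (by omega) D.not_dvd)
  have hz0 : z ≠ 0 := by
    rintro rfl
    apply hcspan
    have h0 : ext Ω (0 : Fin (M + 1) → ℂ) = 0 := funext fun _ => map_zero _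
    rw [Submodule.mem_span_singleton]
    refine ⟨-(β⁻¹ * α), ?_⟩
    have h1 : β⁻¹ • (α • x + β • c) = 0 := by rw [← hz, h0, smul_zero]
    rw [smul_add, smul_smul, smul_smul, inv_mul_cancel₀ hβ, one_smul] at h1
    rw [neg_smul]
    exact neg_eq_of_add_eq_zero_right h1
  refine ⟨polarSection hsymm hdet' hz0, ?_, ?_, ?_⟩
  · change linPoly G z ∈ _
    rw [← hx, aeval_linPoly, hz, bil_add_left, bil_smul_left, bil_smul_left, hxx, hcx]
    ring
  -- The relation z = αx + βc at the generic point specializes to general points with a nonzero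
  -- coefficient of c, so the polar hyperplane of z and the given one cut out the same hyperplane of
  -- E_p.
  · obtain ⟨e', h', hhom', hh', hrel⟩ :=
      exists_specialized_relation hsymm hdet' F.isHomogeneous hx hΔ hβ hz
    refine ⟨e + e', h * h', hhom.mul hhom', fun hmem => (B.isPrime.mem_or_mem hmem).elim hh
      fun hm => hh' ((hx _).mpr hm), fun y hy0 hy hne i hi u hu _ => ?_⟩
    rw [map_mul] at hne
    obtain ⟨hcy, hcspan'⟩ := hF y hy0 hy (left_ne_zero_of_mul hne)
    obtain ⟨a, b, hb, hab⟩ := hrel y hy (right_ne_zero_of_mul hne)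
    have hyy : bil G y y = 0 := by
      rw [← eval_quadPoly]
      exact hy _ B.quadric_mem
    change strictTransformIdeal _ _ (chartEquation G i (linPoly G z)) ⊔ _ = _
    rw [← linearForm_eq_linPoly hsymm]
    exact strictTransformIdeal_sup_exceptionalIdeal hsymm hdet' hM hyy hi hcy hcspan' hb hab hu
  · obtain ⟨a, l', g, hal, hg, hfg, v, hvv, hzv, hgv⟩ :=
      exists_decomposition hsymm hdet' (by omega) hz0 l D.isHomogeneous D.not_dvd
    refine ⟨a, l', ⟨g, hg, fun hdvd => ?_⟩, hal, EffectiveDivisor.eqSMulAdd_of_dvd hfg,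
      fun hcon => hgv (hcon v ?_ ?_), ?_⟩
    · refine hgv ?_
      obtain ⟨q, rfl⟩ := hdvd
      rw [quadric_eq_quadPoly, map_mul, eval_quadPoly, hvv, zero_mul]
    · rw [quadric_eq_quadPoly, eval_quadPoly, hvv]
    · exact (eval_linPoly G z v).trans hzv
    -- If a ≤ 2n - l, then l' = l - a < 2n + 1 - 2a: the order of the residual form still exceeds
    -- its degree, so it vanishes on Z, including at the point v.
    · by_contra hle
      have hord := arcOrder_of_decomposition hsymm hxx hβ hz hcx (e := 2 * n + 1) (a := a)
        (by omega) hfg hdvd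
      exact hgv (eval_eq_zero_of_arcOrder hsymm hdet' hM' hz0 hd hg (by omega) hord hvv hzv)
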